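/- Let $\mathbb K\in\{\mathbb R,\mathbb C\}$, let $A\in\mathbb K^{m\times m}$, $B\in\mathbb K^{m\times n}$, $Q=Q^*\in\mathbb K^{m\times m}$, $S\in\mathbb K^{n\times m}$, $R=R^*\in\mathbb K^{n\times n}$, and put $$M=\begin{bmatrix}Q&S^*\\ S&R\end{bmatrix},\qquad \sigma(x,u)=\langle Qx,x\rangle+2\,\mathrm{Re}\,\langle Sx,u\rangle+\langle Ru,u\rangle .$$ A trajectory is a pair $(x,u)$ with $u\in L^2_{\mathrm{loc}}([0,\infty);\mathbb K^n)$ and $x:[0,\infty)\to\mathbb K^m$ locally absolutely continuous such that $\dot x=Ax+Bu$ almost everywhere; write $E(x,u,0,t)=\int_0^t\sigma(x(s),u(s))\,ds$. The triple $(A,B,M)$ is called *minimally stable* if for every $x^0\in\mathbb K^m$ there is a trajectory $(x,u)$ with $x(0)=x^0$, $E(x,u,0,t)\le 0$ for all $t\ge 0$, and $x(t)\to 0$ as $t\to\infty$. It is called *hyperstable* if there is a constant $c>0$ such that for every trajectory $(x,u)$ and every $\beta\ge 0$ with $E(x,u,0,t)\le\beta^2$ for all $t\ge 0$, one has $|x(t)|\le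 c\,(|x(0)|+\beta)$ for all $t\ge 0$. The Popov function is $$\Pi(\eta,\zeta)=\begin{bmatrix}(\bar\eta I-A)^{-1}B\\ I\end{bmatrix}^{*}\begin{bmatrix}Q&S^*\\ S&R\end{bmatrix}\begin{bmatrix}(\zeta I-A)^{-1}B\\ I\end{bmatrix},$$ defined for $\eta,\zeta\in\mathbb C$ with $\det(\bar\eta I-A)\ne 0$ and $\det(\zeta I-A)\neq 0$. **Theorem (Popov).** Suppose that $B\ne 0$, that $(A,B,M)$ is minimally stable, and that $\det\Pi(\eta,\zeta)$ is not identically zero as a meromorphic function of $(\eta,\zeta)$. Then $(A,B,M)$ is hyperstable if and only if $$\Pi(-i\omega,i\omega)\ge 0\quad\text{for all }\omega\in\mathbb R\text{ with }\det(i\omega I-A)\ne 0,$$ where $\ge 0$ means positive semidefinite as a Hermitian form on $\mathbb C^n$. -/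

import Mathlib

open MeasureTheory Filter Topology
open scoped ComplexOrder

namespace PopovLTI

noncomputable section

variable {𝕜 : Type*} [RCLike 𝕜] {m n : ℕ}

/-- `x` is a state trajectory of `ẋ = A x + B u` on `[0, ∞)` driven by the input `u`: the input is
locally square-integrable on `[0, ∞)` and `x` is a Carathéodory solution, that is, a continuous
function on `[0, ∞)` satisfying the integrated equation (equivalently, `x` is locally absolutely
continuous and the equation holds almost everywhere). Values at negative times are irrelevant. -/
structure IsTrajectory (A : Matrix (Fin m) (Fin m) 𝕜) (B : Matrix (Fin m) (Fin n) 𝕜)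
    (x : ℝ → EuclideanSpace 𝕜 (Fin m)) (u : ℝ → EuclideanSpace 𝕜 (Fin n)) : Prop where
  memLp_input : ∀ T : ℝ, 0 ≤ T → MemLp u 2 (volume.restrict (Set.Icc 0 T))
  continuousOn_state : ContinuousOn x (Set.Ici 0)
  state_eq : ∀ t : ℝ, 0 ≤ t →
    x t = x 0 + ∫ s in (0 : ℝ)..t, (A.toEuclideanLin (x s) + B.toEuclideanLin (u s))

/-- The supply rate `σ(x, u) = ⟨Q x, x⟩ + 2 Re ⟨S x, u⟩ + ⟨R u, u⟩`. -/
def supplyRate (Q : Matrix (Fin m) (Fin m) 𝕜) (S : Matrix (Fin n) (Fin m) 𝕜)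
    (R : Matrix (Fin n) (Fin n) 𝕜)
    (x : EuclideanSpace 𝕜 (Fin m)) (u : EuclideanSpace 𝕜 (Fin n)) : ℝ :=
  RCLike.re (inner 𝕜 (Q.toEuclideanLin x) x) + 2 * RCLike.re (inner 𝕜 (S.toEuclideanLin x) u)
    + RCLike.re (inner 𝕜 (R.toEuclideanLin u) u)

/-- The supplied energy `E(x, u, 0, t)`, the integral of the supply rate over `[0, t]`. -/
def energy (Q : Matrix (Fin m) (Fin m) 𝕜) (S : Matrix (Fin n) (Fin m) 𝕜)
    (R : Matrix (Fin n) (Fin n) 𝕜)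
    (x : ℝ → EuclideanSpace 𝕜 (Fin m)) (u : ℝ → EuclideanSpace 𝕜 (Fin n)) (t : ℝ) : ℝ :=
  ∫ s in (0 : ℝ)..t, supplyRate Q S R (x s) (u s)

/-- Minimal stability of `(A, B, M)`, where `M = [Q, S*; S, R]`. -/
def MinimallyStable (A : Matrix (Fin m) (Fin m) 𝕜) (B : Matrix (Fin m) (Fin n) 𝕜)
    (Q : Matrix (Fin m) (Fin m) 𝕜) (S : Matrix (Fin n) (Fin m) 𝕜)
    (R : Matrix (Fin n) (Fin n) 𝕜) : Prop :=
  ∀ x₀ : EuclideanSpace 𝕜 (Fin m),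
    ∃ (x : ℝ → EuclideanSpace 𝕜 (Fin m)) (u : ℝ → EuclideanSpace 𝕜 (Fin n)),
      IsTrajectory A B x u ∧ x 0 = x₀ ∧ (∀ t : ℝ, 0 ≤ t → energy Q S R x u t ≤ 0) ∧
        Tendsto x atTop (𝓝 0)

/-- Hyperstability of `(A, B, M)`, where `M = [Q, S*; S, R]`. -/
def Hyperstable (A : Matrix (Fin m) (Fin m) 𝕜) (B : Matrix (Fin m) (Fin n) 𝕜)
    (Q : Matrix (Fin m) (Fin m) 𝕜) (S : Matrix (Fin n) (Fin m) 𝕜)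
    (R : Matrix (Fin n) (Fin n) 𝕜) : Prop :=
  ∃ c : ℝ, 0 < c ∧
    ∀ (x : ℝ → EuclideanSpace 𝕜 (Fin m)) (u : ℝ → EuclideanSpace 𝕜 (Fin n)) (β : ℝ),
      IsTrajectory A B x u → 0 ≤ β → (∀ t : ℝ, 0 ≤ t → energy Q S R x u t ≤ β ^ 2) →
        ∀ t : ℝ, 0 ≤ t → ‖x t‖ ≤ c * (‖x 0‖ + β)

/-- A matrix over `𝕜 ∈ {ℝ, ℂ}` viewed as a complex matrix. -/
def toComplex {k l : Type*} (X : Matrix k l 𝕜) : Matrix k l ℂ :=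
  X.map (RCLike.map 𝕜 ℂ)

/-- `s I - A` as a complex matrix. -/
def charMat (A : Matrix (Fin m) (Fin m) 𝕜) (s : ℂ) : Matrix (Fin m) (Fin m) ℂ :=
  s • (1 : Matrix (Fin m) (Fin m) ℂ) - toComplex A

/-- The block column with entries `(s I - A)⁻¹ B` and `I`, where `det (s I - A) ≠ 0`. -/
def frequencyColumn (A : Matrix (Fin m) (Fin m) 𝕜) (B : Matrix (Fin m) (Fin n) 𝕜) (s : ℂ) :
    Matrix (Fin m ⊕ Fin n) (Fin n) ℂ :=
  Matrix.fromRows ((charMat A s)⁻¹ * toComplex B) 1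

/-- The Popov function `Π(η, ζ)`, meaningful where
`det (conj η I - A) ≠ 0` and `det (ζ I - A) ≠ 0`. -/
def popov (A : Matrix (Fin m) (Fin m) 𝕜) (B : Matrix (Fin m) (Fin n) 𝕜)
    (Q : Matrix (Fin m) (Fin m) 𝕜) (S : Matrix (Fin n) (Fin m) 𝕜)
    (R : Matrix (Fin n) (Fin n) 𝕜) (η ζ : ℂ) : Matrix (Fin n) (Fin n) ℂ :=
  (frequencyColumn A B (star η)).conjTranspose
    * toComplex (Matrix.fromBlocks Q S.conjTranspose S R) * frequencyColumn A B ζ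

/-- The meromorphic function `det Π(η, ζ)` of two variables is not identically zero: it is nonzero
at some point outside the polar set. -/
def PopovDetNonzero (A : Matrix (Fin m) (Fin m) 𝕜) (B : Matrix (Fin m) (Fin n) 𝕜)
    (Q : Matrix (Fin m) (Fin m) 𝕜) (S : Matrix (Fin n) (Fin m) 𝕜)
    (R : Matrix (Fin n) (Fin n) 𝕜) : Prop :=
  ∃ η ζ : ℂ, (charMat A (star η)).det ≠ 0 ∧ (charMat A ζ).det ≠ 0 ∧
    (popov A B Q S R η ζ).det ≠ 0

/-- The frequency-domain inequality: `Π(-iω, iω) ≥ 0` whenever `det (iω I - A) ≠ 0`. -/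
def FDI (A : Matrix (Fin m) (Fin m) 𝕜) (B : Matrix (Fin m) (Fin n) 𝕜)
    (Q : Matrix (Fin m) (Fin m) 𝕜) (S : Matrix (Fin n) (Fin m) 𝕜)
    (R : Matrix (Fin n) (Fin n) 𝕜) : Prop :=
  ∀ ω : ℝ, (charMat A (Complex.I * ω)).det ≠ 0 →
    (popov A B Q S R (-(Complex.I * ω)) (Complex.I * ω)).PosSemidef

end

end PopovLTI

/-! Stack state and input into w = (x, u), let X extract the state and put D w = A x + B u. After
complexification a trajectory solves d/dt (X w) = D w with supply rate ⟪M w, w⟫. Where s is not an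
eigenvalue of A, the solutions of s X w = D w are the values of `frequencyColumn`, so Π is the
supply form evaluated on exponential solutions.

From the frequency inequality to hyperstability (`FDI.hyperstable`): on the reachable subspace the
pencil (X, D) is controllable, and the Kalman–Yakubovich–Popov lemma `exists_storage` gives
operators P and Y with ⟪M w, w⟫ = ‖Y w‖² + 2 Re ⟪P X w, D w⟫; the last term is the derivative of the
storage ⟪P x, x⟫. The lemma is proved by convex duality: an obstruction would be a finite family
with ∑ (X w_k)(D w_k)* + (D w_k)(X w_k)* = 0 and negative total supply, but a unitary change of
basis turns such a family into vectors at imaginary or infinite frequency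
(`sum_nonneg_of_sum_outer_eq_zero`), where the supply is nonnegative. Minimal stability makes P ≥ 0,
and every state in ker P can be steered to zero inside ker P without dissipation. An energy bound
therefore controls P x uniformly and Y w in L²; what remains is the component of x in ker P. Since
det Π is not identically zero, a dimension count (`IsDissipative.eq_zero_of_lossless`) shows that X
w, P D w and Y w determine w. Hence the component in ker P obeys a stable linear equation forced by
P x and Y w (`IsDissipative.exists_state_bound`). The unreachable part is an autonomous decaying
signal e; its cross terms are absorbed by adding a term bilinear in e and x to the storage
(`IsDissipative.exists_bound_of_energy_le`).

From hyperstability to the frequency inequality (`Hyperstable.fdi`): if the supply were negative at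
iω, then for small δ > 0 the exponential solution with rate δ + iω would still have negative mean
supply. Its energy is bounded above while its state grows like exp(δt), which hyperstability
forbids. The cases ω = 0 and B v = 0 follow by continuity. -/

namespace PopovLTI

set_option linter.unusedSectionVars false

/-! ### Controllable pencils: limits of frequencies and rigidity of storages -/

section KYP

variable {E W : Type*} [NormedAddCommGroup E] [InnerProductSpace ℂ E]
  [NormedAddCommGroup W] [InnerProductSpace ℂ W]

/-- Kernel vectors of a surjective map persist under linear perturbation of the map, so a closed
condition that holds on the perturbed kernels holds on the original one. -/
theorem nonneg_of_pencil_perturbation [FiniteDimensional ℂ E] {q : W → ℝ} (hq : Continuous q) (X₀ X₁ : W →L[ℂ] E)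
    (hX₀ : Function.Surjective X₀)
    (h : ∀ᶠ δ : ℝ in 𝓝[≠] 0, ∀ w, X₀ w + (δ : ℂ) • X₁ w = 0 → 0 ≤ q w)
    {w : W} (hw : X₀ w = 0) : 0 ≤ q w := by
  have : CompleteSpace E := FiniteDimensional.complete ℂ E
  obtain ⟨ρ', hρ'⟩ := X₀.toLinearMap.exists_rightInverse_of_surjective
    (LinearMap.range_eq_top.2 hX₀)
  set ρ : E →L[ℂ] W := LinearMap.toContinuousLinearMap ρ' with hρdef
  have hρ : ∀ y, X₀ (ρ y) = y := fun y => LinearMap.congr_fun hρ' y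
  -- Since (X₀ + δ X₁) ρ = T δ, subtracting ρ (T δ)⁻¹ (δ X₁ w) from w lands in the perturbed kernel,
  -- and the correction tends to zero with δ.
  set T : ℝ → (E →L[ℂ] E) := fun δ => 1 + (δ : ℂ) • (X₁.comp ρ) with hT
  have hTc : Continuous T := by fun_prop
  have hT0 : T 0 = 1 := by simp [hT]
  have hinv : Tendsto (fun δ => Ring.inverse (T δ)) (𝓝 0) (𝓝 1) := by
    have h1 : ContinuousAt (Ring.inverse : (E →L[ℂ] E) → _) (T 0) := by
      rw [hT0]; simpa using NormedRing.inverse_continuousAt (1 : (E →L[ℂ] E)ˣ)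
    have h2 := h1.tendsto.comp hTc.continuousAt.tendsto
    simpa [hT0, Function.comp_def] using h2
  have hunit : ∀ᶠ δ in 𝓝 (0 : ℝ), IsUnit (T δ) := by
    have : {x : E →L[ℂ] E | IsUnit x} ∈ 𝓝 (T 0) := Units.isOpen.mem_nhds (by simp [hT0])
    exact hTc.continuousAt.eventually this
  set w' : ℝ → W := fun δ => w - ρ (Ring.inverse (T δ) ((δ : ℂ) • X₁ w)) with hw'
  have hlim : Tendsto w' (𝓝 0) (𝓝 w) := by
    have h2 : Tendsto (fun δ : ℝ => (δ : ℂ) • X₁ w) (𝓝 0) (𝓝 0) := by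
      have : Continuous (fun δ : ℝ => (δ : ℂ) • X₁ w) := by fun_prop
      simpa using this.tendsto 0
    have h3 : Tendsto (fun δ : ℝ => Ring.inverse (T δ) ((δ : ℂ) • X₁ w)) (𝓝 0) (𝓝 0) := by
      have h9 : Continuous (fun p : (E →L[ℂ] E) × E => p.1 p.2) := by fun_prop
      simpa [Function.comp_def] using (h9.tendsto (1, 0)).comp (hinv.prodMk_nhds h2)
    have h4 := (ρ.continuous.tendsto 0).comp h3
    simpa [hw', Function.comp_def] using (tendsto_const_nhds (x := w)).sub h4
  have hker : ∀ᶠ δ in 𝓝 (0 : ℝ), X₀ (w' δ) + (δ : ℂ) • X₁ (w' δ) = 0 := by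
    filter_upwards [hunit] with δ hδ
    have h5 : T δ (Ring.inverse (T δ) ((δ : ℂ) • X₁ w)) = (δ : ℂ) • X₁ w := by
      have := Ring.mul_inverse_cancel _ hδ
      calc _ = (T δ * Ring.inverse (T δ)) ((δ : ℂ) • X₁ w) := rfl
        _ = _ := by rw [this]; rfl
    set y := Ring.inverse (T δ) ((δ : ℂ) • X₁ w) with hy
    have h6 : T δ y = y + (δ : ℂ) • X₁ (ρ y) := by simp [hT]
    have h7 : w' δ = w - ρ y := rfl
    rw [h7, map_sub, map_sub, hw, hρ, smul_sub, ← h5, h6]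
    abel
  have h8 : ∀ᶠ δ in 𝓝[≠] (0 : ℝ), 0 ≤ q (w' δ) := by
    filter_upwards [h, hker.filter_mono nhdsWithin_le_nhds] with δ h9 h10 using h9 _ h10
  exact ge_of_tendsto ((hq.tendsto w).comp (hlim.mono_left nhdsWithin_le_nhds)) h8

/-- A pencil that is controllable in the sense that no proper subspace `Z` satisfies
`X w ∈ Z → D w ∈ Z` is surjective at every frequency. -/
theorem pencil_surjective {X D : W →L[ℂ] E}
    (hC : ∀ Z : Submodule ℂ E, (∀ w, X w ∈ Z → D w ∈ Z) → Z = ⊤) (c : ℂ) :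
    Function.Surjective (c • X - D) := by
  suffices h : LinearMap.range (c • X - D).toLinearMap = ⊤ from LinearMap.range_eq_top.1 h
  refine hC _ fun w hw => ?_
  have h1 : D w = c • X w - (c • X - D) w := by simp
  rw [h1]
  exact Submodule.sub_mem _ (Submodule.smul_mem _ _ hw) ⟨w, rfl⟩

/-- An exceptional frequency ω is a limit of ω + δ, and the frequency at infinity is the limit of
1/δ. Surjectivity of the limiting map, by controllability at finite ω and by assumption on X at
infinity, lets kernel vectors be followed along the limit. -/
theorem nonneg_of_forall_frequency [FiniteDimensional ℂ E] {X D : W →L[ℂ] E} {q : W → ℝ} (hq : Continuous q)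
    (hX : Function.Surjective X)
    (hC : ∀ Z : Submodule ℂ E, (∀ w, X w ∈ Z → D w ∈ Z) → Z = ⊤)
    {s : Set ℝ} (hs : s.Finite)
    (hF : ∀ ω : ℝ, ω ∉ s → ∀ w, (Complex.I * ω) • X w = D w → 0 ≤ q w) :
    (∀ (ω : ℝ) (w : W), (Complex.I * ω) • X w = D w → 0 ≤ q w) ∧ ∀ w, X w = 0 → 0 ≤ q w := by
  constructor
  · intro ω w hw
    refine nonneg_of_pencil_perturbation hq ((Complex.I * ω) • X - D) (Complex.I • X)
      (pencil_surjective hC _) ?_ (w := w) (by simp [hw])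
    have h1 : ∀ᶠ δ : ℝ in 𝓝[≠] 0, ω + δ ∉ s := by
      have h2 : (s \ {ω})ᶜ ∈ 𝓝 ω :=
        (hs.subset Set.sdiff_subset).isClosed.isOpen_compl.mem_nhds (by simp)
      have h3 : Tendsto (fun δ : ℝ => ω + δ) (𝓝[≠] 0) (𝓝 ω) := by
        have : Continuous (fun δ : ℝ => ω + δ) := by fun_prop
        simpa using (this.tendsto 0).mono_left (nhdsWithin_le_nhds (s := {0}ᶜ))
      filter_upwards [h3 h2, self_mem_nhdsWithin] with δ h4 h5 h6
      exact h4 ⟨h6, by simpa using h5⟩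
    filter_upwards [h1] with δ hδ w hw
    refine hF _ hδ w ?_
    simp only [sub_apply, smul_apply] at hw
    rw [← sub_eq_zero, ← hw, Complex.ofReal_add, mul_add, add_smul, smul_smul, mul_comm (δ : ℂ)]
    abel
  · intro w hw
    refine nonneg_of_pencil_perturbation hq X (Complex.I • D) hX ?_ hw
    have h1 : ∀ᶠ δ : ℝ in 𝓝[≠] 0, δ⁻¹ ∉ s := by
      have h2 : Tendsto (fun δ : ℝ => δ⁻¹) (𝓝[≠] 0) (Bornology.cobounded ℝ) :=
        tendsto_inv₀_nhdsNE_zero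
      exact h2 (Bornology.isBounded_def.1 hs.isBounded)
    filter_upwards [h1, self_mem_nhdsWithin] with δ hδ h0 w hw
    refine hF _ hδ w ?_
    have h3 : X w = -((δ : ℂ) • Complex.I • D w) := eq_neg_of_add_eq_zero_left hw
    have h0' : (δ : ℂ) ≠ 0 := by simpa using h0
    rw [h3, smul_neg, smul_smul, smul_smul, mul_assoc _ (δ : ℂ)]
    have : Complex.I * ((δ⁻¹ : ℝ) : ℂ) * ((δ : ℂ) * Complex.I) = -1 := by
      push_cast
      field_simp
      simp
    rw [this]; simp

/-- If a self-adjoint `P` satisfies `re ⟪P X w, D w⟫ ≥ 0` for a controllable pencil, then `P = 0`. -/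
theorem selfAdjoint_eq_zero_of_nonneg {X D : W →L[ℂ] E} [CompleteSpace E]
    (hX : Function.Surjective X)
    (hC : ∀ Z : Submodule ℂ E, (∀ w, X w ∈ Z → D w ∈ Z) → Z = ⊤)
    {P : E →L[ℂ] E} (hP : IsSelfAdjoint P)
    (h : ∀ w, 0 ≤ (inner ℂ (P (X w)) (D w)).re) : P = 0 := by
  have key : LinearMap.ker P.toLinearMap = ⊤ := by
    refine hC _ fun w hw => ?_
    have hw : P (X w) = 0 := hw
    change P (D w) = 0
    -- With X v = P D w the form at w + t v has linear coefficient ‖P D w‖² and no constant term, so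
    -- a small negative t makes it negative unless P D w = 0. Thus ker P is invariant in the sense
    -- of `hC`.
    obtain ⟨v, hv⟩ := hX (P (D w))
    have h1 : ∀ t : ℝ, 0 ≤ t * ‖P (D w)‖ ^ 2 + t ^ 2 * (inner ℂ (P (X v)) (D v)).re := by
      intro t
      have h2 := h (w + (t : ℂ) • v)
      simp only [map_add, map_smul, hw, zero_add, inner_add_right, inner_smul_left,
        inner_smul_right, Complex.conj_ofReal] at h2
      have h3 : inner ℂ (P (X v)) (D w) = ((‖P (D w)‖ ^ 2 : ℝ) : ℂ) := by
        have := (ContinuousLinearMap.isSelfAdjoint_iff_isSymmetric.1 hP) (X v) (D w)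
        have h4 : inner ℂ (P (X v)) (D w) = inner ℂ (X v) (P (D w)) := this
        rw [h4, hv, inner_self_eq_norm_sq_to_K]; push_cast; rfl
      rw [h3] at h2
      simp only [Complex.add_re, Complex.re_ofReal_mul, Complex.ofReal_re] at h2
      linarith
    by_contra hne
    have hpos : 0 < ‖P (D w)‖ ^ 2 := by positivity
    set a := ‖P (D w)‖ ^ 2
    set b := (inner ℂ (P (X v)) (D v)).re
    have h5 := h1 (-(a / (2 * (|b| + 1))))
    have hb : 0 < |b| + 1 := by positivity
    have h6 : (a / (2 * (|b| + 1))) ^ 2 * b ≤ (a / (2 * (|b| + 1))) * (a / 2) := by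
      rw [sq, mul_assoc]
      refine mul_le_mul_of_nonneg_left ?_ (by positivity)
      rw [div_mul_eq_mul_div, div_le_div_iff₀ (by positivity) (by positivity)]
      nlinarith [le_abs_self b]
    have h7 : 0 < a / (2 * (|b| + 1)) := by positivity
    nlinarith
  ext x
  have : x ∈ LinearMap.ker P.toLinearMap := by rw [key]; trivial
  exact this

end KYP

/-! ### Diagonalizing families with vanishing symmetrized outer product -/

section KYP

variable {E W : Type*} [NormedAddCommGroup E] [InnerProductSpace ℂ E] [FiniteDimensional ℂ E]
  [NormedAddCommGroup W] [InnerProductSpace ℂ W] [FiniteDimensional ℂ W]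

/-- A quadratic form that is nonnegative along every generalized eigenvector of the pencil
`(X, D)` on the imaginary axis (including infinity) is nonnegative when summed over a finite family
`w` with `∑ (X w_k)(D w_k)* + (D w_k)(X w_k)* = 0`. -/
theorem sum_nonneg_of_sum_outer_eq_zero {ι : Type*} [Fintype ι] {X D : W →L[ℂ] E}
    (M : W →L[ℂ] W)
    (hfin : ∀ (ω : ℝ) (w : W), (Complex.I * ω) • X w = D w → 0 ≤ (inner ℂ (M w) w).re)
    (hinf : ∀ w, X w = 0 → 0 ≤ (inner ℂ (M w) w).re) (w : ι → W)
    (hw : ∀ a : E, (∑ k, inner ℂ (X (w k)) a * inner ℂ a (D (w k))).re = 0) :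
    0 ≤ ∑ k, (inner ℂ (M (w k)) (w k)).re := by
  classical
  -- L synthesizes the family from an orthonormal basis. With G = X L and F = D L the hypothesis
  -- becomes G F* + F G* = 0, and the total supply becomes the real part of the trace of L* M L.
  let L : EuclideanSpace ℂ ι →ₗ[ℂ] W := (EuclideanSpace.basisFun ι ℂ).toBasis.constr ℂ w
  have hL : ∀ k, L (EuclideanSpace.basisFun ι ℂ k) = w k := fun k => by
    simpa only [L, OrthonormalBasis.coe_toBasis] using
      (EuclideanSpace.basisFun ι ℂ).toBasis.constr_basis ℂ w k
  let G : EuclideanSpace ℂ ι →ₗ[ℂ] E := X.toLinearMap ∘ₗ L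
  let F : EuclideanSpace ℂ ι →ₗ[ℂ] E := D.toLinearMap ∘ₗ L
  let Gs := LinearMap.adjoint G
  let Fs := LinearMap.adjoint F
  have hFG : ∀ a, inner ℂ (Fs a) (Gs a) = ∑ k, inner ℂ (X (w k)) a * inner ℂ a (D (w k)) := by
    intro a
    rw [← (EuclideanSpace.basisFun ι ℂ).sum_inner_mul_inner (Fs a) (Gs a)]
    refine Finset.sum_congr rfl fun k _ => ?_
    simp only [Fs, Gs, LinearMap.adjoint_inner_left, LinearMap.adjoint_inner_right]
    rw [mul_comm]
    simp only [G, F, LinearMap.comp_apply, hL, ContinuousLinearMap.coe_coe]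
  have hH : G ∘ₗ Fs + F ∘ₗ Gs = 0 := by
    rw [← inner_map_self_eq_zero]
    intro a
    have h1 : inner ℂ (G (Fs a)) a = inner ℂ (Fs a) (Gs a) :=
      (LinearMap.adjoint_inner_right G _ _).symm
    have h2 : inner ℂ (F (Gs a)) a = inner ℂ (Gs a) (Fs a) :=
      (LinearMap.adjoint_inner_right F _ _).symm
    have h3 : inner ℂ ((G ∘ₗ Fs + F ∘ₗ Gs) a) a = inner ℂ (G (Fs a)) a + inner ℂ (F (Gs a)) a :=
      inner_add_left _ _ _
    rw [h3, h1, h2, ← inner_conj_symm (Gs a) (Fs a), Complex.add_conj, hFG, hw]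
    simp
  have hH' : ∀ a, G (Fs a) = -F (Gs a) := fun a => by
    have := LinearMap.congr_fun hH a
    exact eq_neg_of_add_eq_zero_left this
  let Z := LinearMap.ker G
  have hrange : LinearMap.range Gs = Zᗮ := (LinearMap.orthogonal_ker G).symm
  have hmem : ∀ a, Gs a ∈ Zᗮ := fun a => hrange ▸ ⟨a, rfl⟩
  let Gr : E →ₗ[ℂ] Zᗮ := Gs.codRestrict Zᗮ hmem
  obtain ⟨r, hr⟩ := Gr.exists_rightInverse_of_surjective (by
    rw [LinearMap.range_eq_top]
    rintro ⟨c, hc⟩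
    rw [← hrange] at hc
    obtain ⟨a, ha⟩ := hc
    exact ⟨a, Subtype.ext ha⟩)
  have hr' : ∀ c : Zᗮ, Gs (r c) = c := fun c => congrArg Subtype.val (LinearMap.congr_fun hr c)
  -- From G F* = -F G* and range G* = (ker G)ᗮ, F restricted to (ker G)ᗮ equals G T, where the
  -- projection discards what G cannot see. The same identity makes T skew-adjoint.
  let T : Zᗮ →ₗ[ℂ] Zᗮ := -((Zᗮ.orthogonalProjectionOnto).toLinearMap ∘ₗ Fs ∘ₗ r)
  have hGp : ∀ v, G (Zᗮ.orthogonalProjectionOnto v : EuclideanSpace ℂ ι) = G v := by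
    intro v
    have h1 : v - (Zᗮ.orthogonalProjectionOnto v : EuclideanSpace ℂ ι) ∈ Zᗮᗮ :=
      Zᗮ.sub_starProjection_mem_orthogonal v
    rw [Submodule.orthogonal_orthogonal] at h1
    have h2 : G (v - _) = 0 := h1
    rw [map_sub, sub_eq_zero] at h2
    exact h2.symm
  have hGT : ∀ c : Zᗮ, G (T c) = F c := by
    intro c
    have : ((T c : Zᗮ) : EuclideanSpace ℂ ι) = -(Zᗮ.orthogonalProjectionOnto (Fs (r c)) : Zᗮ) := rfl
    rw [this, map_neg, hGp, hH', neg_neg, hr']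
  have hTin : ∀ c c' : Zᗮ, inner ℂ (T c) c' = -inner ℂ (r c) (F c') := by
    intro c c'
    have h1 : T c = -(Zᗮ.orthogonalProjectionOnto (Fs (r c)) : Zᗮ) := rfl
    rw [h1, inner_neg_left, Submodule.inner_orthogonalProjectionOnto_eq_of_mem_right]
    simp only [Fs, LinearMap.adjoint_inner_left]
  have hskew : ∀ c c' : Zᗮ, inner ℂ (T c) c' = -inner ℂ c (T c') := by
    intro c c'
    rw [hTin, ← inner_conj_symm c (T c'), hTin c' c, map_neg, inner_conj_symm, neg_neg]
    have h1 : inner ℂ (r c) (F c') + inner ℂ (F c) (r c') = 0 := by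
      have h2 : F c' = F (Gs (r c')) := by rw [hr']
      have h3 : inner ℂ (F c) (r c') = inner ℂ (r c) (G (Fs (r c'))) := by
        have h4 : inner ℂ (r c) (G (Fs (r c'))) = inner ℂ (Gs (r c)) (Fs (r c')) :=
          (LinearMap.adjoint_inner_left G _ _).symm
        rw [h4, hr']
        exact (LinearMap.adjoint_inner_right F _ _).symm
      rw [h3, h2, hH', inner_neg_right, add_neg_cancel]
    exact (eq_neg_of_add_eq_zero_right h1).symm
  have hsym : (Complex.I • T).IsSymmetric := by
    intro c c'
    simp only [LinearMap.smul_apply, inner_smul_left, inner_smul_right, Complex.conj_I, hskew c c']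
    ring
  let y := hsym.eigenvectorBasis rfl
  let z := stdOrthonormalBasis ℂ Z
  -- The trace may be computed in this basis. Basis vectors in ker G give w with X w = 0, the
  -- infinite frequency; eigenvectors of T, whose eigenvalues are imaginary, give i ω X w = D w.
  let b := (z.prod y).map Z.orthogonalDecomposition.symm
  let Sop : EuclideanSpace ℂ ι →ₗ[ℂ] EuclideanSpace ℂ ι :=
    LinearMap.adjoint L ∘ₗ M.toLinearMap ∘ₗ L
  have hS : ∀ c, (inner ℂ c (Sop c)).re = (inner ℂ (M (L c)) (L c)).re := by
    intro c
    simp only [Sop, LinearMap.comp_apply, LinearMap.adjoint_inner_right,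
      ContinuousLinearMap.coe_coe]
    rw [← inner_conj_symm, Complex.conj_re]
  have htr : ∑ k, (inner ℂ (M (w k)) (w k)).re = ∑ i, (inner ℂ (M (L (b i))) (L (b i))).re := by
    have h1 := LinearMap.trace_eq_sum_inner Sop (EuclideanSpace.basisFun ι ℂ)
    rw [LinearMap.trace_eq_sum_inner Sop b] at h1
    have h2 := congrArg Complex.re h1
    rw [Complex.re_sum, Complex.re_sum] at h2
    simp only [hS, hL] at h2
    exact h2.symm
  rw [htr]
  refine Finset.sum_nonneg fun i _ => ?_
  rcases i with i | j
  · refine hinf _ ?_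
    have h1 : b (Sum.inl i) = (z i : EuclideanSpace ℂ ι) := by
      simp [b]
    rw [h1]
    exact (z i).2
  · have h1 : b (Sum.inr j) = (y j : EuclideanSpace ℂ ι) := by
      simp [b]
    rw [h1]
    refine hfin (-(hsym.eigenvalues rfl j)) _ ?_
    have h2 : Complex.I • T (y j) = (hsym.eigenvalues rfl j : ℂ) • y j :=
      hsym.apply_eigenvectorBasis rfl j
    have h3 : T (y j) = (Complex.I * (-(hsym.eigenvalues rfl j) : ℝ)) • y j := by
      have := congrArg (fun v => (-Complex.I) • v) h2
      simp only [smul_smul] at this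
      rw [neg_mul, Complex.I_mul_I, neg_neg, one_smul] at this
      rw [this]; congr 1; push_cast; ring
    change _ • G (y j) = F (y j)
    rw [← hGT, h3, Submodule.coe_smul, map_smul]

end KYP

/-! ### The Kalman–Yakubovich–Popov lemma by convex duality -/

section KYP

variable {E W : Type*} [NormedAddCommGroup E] [InnerProductSpace ℂ E] [FiniteDimensional ℂ E]
  [NormedAddCommGroup W] [InnerProductSpace ℂ W] [FiniteDimensional ℂ W]

/-- **Kalman–Yakubovich–Popov lemma** for a controllable pencil `(X, D)`: nonnegativity of the
supply rate at all but finitely many frequencies yields a quadratic storage function. -/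
theorem exists_storage [CompleteSpace E] {X D : W →L[ℂ] E} (M : W →L[ℂ] W)
    (hX : Function.Surjective X)
    (hC : ∀ Z : Submodule ℂ E, (∀ w, X w ∈ Z → D w ∈ Z) → Z = ⊤)
    {s : Set ℝ} (hs : s.Finite)
    (hF : ∀ ω : ℝ, ω ∉ s → ∀ w, (Complex.I * ω) • X w = D w → 0 ≤ (inner ℂ (M w) w).re) :
    ∃ P : E →L[ℂ] E, IsSelfAdjoint P ∧
      ∀ w, 2 * (inner ℂ (P (X w)) (D w)).re ≤ (inner ℂ (M w) w).re := by
  classical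
  rcases subsingleton_or_nontrivial W with hW | hW
  · exact ⟨0, IsSelfAdjoint.zero _, fun w => by simp [Subsingleton.elim w 0]⟩
  have hqc : Continuous fun w => (inner ℂ (M w) w).re := by fun_prop
  obtain ⟨hfin, hinf⟩ := nonneg_of_forall_frequency hqc hX hC hs hF
  let H := selfAdjoint.submodule ℝ (E →L[ℂ] E)
  let b := Module.finBasis ℝ H
  let d := Module.finrank ℝ H
  let g : Fin d → W → ℝ := fun i w => -2 * (inner ℂ ((b i : E →L[ℂ] E) (X w)) (D w)).re
  let J := {w : W // w ≠ 0} × {ε : ℝ // 0 < ε}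
  -- The ε-term makes the supply strictly positive in the separation argument; ε is sent to zero
  -- once P is found.
  let q : J → ℝ := fun j => (inner ℂ (M j.1.1) j.1.1).re + j.2.1 * ‖j.1.1‖ ^ 2
  let Φ : J → ℝ × (Fin d → ℝ) := fun j => (q j, fun i => g i j.1.1)
  let t : J → Set (ℝ × (Fin d → ℝ)) := fun j =>
    {ψ | 0 ≤ ψ.1 ∧ 0 ≤ ψ.1 * q j + ∑ i, ψ.2 i * g i j.1.1}
  have hclosed : ∀ j, IsClosed (t j) := fun j => by
    have hcont : Continuous fun ψ : ℝ × (Fin d → ℝ) => ψ.1 * q j + ∑ i, ψ.2 i * g i j.1.1 := by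
      fun_prop
    exact (isClosed_le continuous_const continuous_fst).inter (isClosed_le continuous_const hcont)
  -- The unknown ψ collects a multiplier for the supply and the coordinates of P. Normalizing it to
  -- the compact unit sphere reduces the infinitely many constraints to finitely many and keeps ψ
  -- nonzero.
  have hsep : ∀ u : Finset J, (Metric.sphere (0 : ℝ × (Fin d → ℝ)) 1 ∩ ⋂ j ∈ u, t j).Nonempty := by
    intro u
    suffices h : ∃ ψ : ℝ × (Fin d → ℝ), ψ ≠ 0 ∧ ∀ j ∈ u, ψ ∈ t j by
      obtain ⟨ψ, h0, hψ⟩ := h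
      have hn : 0 < ‖ψ‖ := norm_pos_iff.2 h0
      refine ⟨‖ψ‖⁻¹ • ψ, by simp [norm_smul, hn.ne'], ?_⟩
      simp only [Set.mem_iInter]
      intro j hj
      obtain ⟨h1, h2⟩ := hψ j hj
      refine ⟨mul_nonneg (by positivity) h1, ?_⟩
      have : (‖ψ‖⁻¹ • ψ).1 * q j + ∑ i, (‖ψ‖⁻¹ • ψ).2 i * g i j.1.1
          = ‖ψ‖⁻¹ * (ψ.1 * q j + ∑ i, ψ.2 i * g i j.1.1) := by
        simp only [Prod.smul_fst, Prod.smul_snd, Pi.smul_apply, smul_eq_mul, mul_add,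
          Finset.mul_sum, mul_assoc]
      rw [this]
      positivity
    rcases u.eq_empty_or_nonempty with rfl | hne
    · exact ⟨(1, 0), by simp, by simp⟩
    -- A convex combination of the points Φ j on this ray is the dual obstruction: all storage terms
    -- cancel while the total supply is nonpositive.
    let ray : Set (ℝ × (Fin d → ℝ)) := {x | x.1 ≤ 0 ∧ x.2 = 0}
    have hray : Convex ℝ ray := by
      rintro x ⟨hx1, hx2⟩ y ⟨hy1, hy2⟩ a c ha hc _
      refine ⟨?_, by simp [hx2, hy2]⟩
      simp only [Prod.fst_add, Prod.smul_fst, smul_eq_mul]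
      nlinarith
    have hrayc : IsClosed ray := (isClosed_le continuous_fst continuous_const).inter
      (isClosed_eq continuous_snd continuous_const)
    have hdisj : Disjoint (convexHull ℝ (u.image Φ : Set (ℝ × (Fin d → ℝ)))) ray := by
      rw [Set.disjoint_left]
      rintro x hx ⟨hx1, hx2⟩
      rw [Finset.mem_convexHull'] at hx
      obtain ⟨c, hc0, hc1, hcx⟩ := hx
      have hpre : ∀ y : u.image Φ, ∃ j, Φ j = y := fun y => by
        obtain ⟨j, -, hj⟩ := Finset.mem_image.1 y.2
        exact ⟨j, hj⟩
      choose j hj using hpre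
      have hc0' : ∀ y : u.image Φ, 0 ≤ c y := fun y => hc0 y y.2
      rw [← Finset.sum_coe_sort] at hc1 hcx
      have hx1' : ∑ y : u.image Φ, c y * q (j y) = x.1 := by
        rw [← hcx, Prod.fst_sum]
        refine Finset.sum_congr rfl fun y _ => ?_
        rw [Prod.smul_fst, ← hj y]; rfl
      have hx2' : ∀ i, ∑ y : u.image Φ, c y * g i (j y).1.1 = 0 := by
        intro i
        have : x.2 i = 0 := by rw [hx2]; rfl
        refine Eq.trans ?_ this
        rw [← hcx, Prod.snd_sum, Finset.sum_apply]
        refine Finset.sum_congr rfl fun y _ => ?_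
        rw [Prod.smul_snd, ← hj y]; rfl
      -- ℓ pairs a candidate storage with the weighted family. Being zero on a basis it is zero on
      -- the rank-one operators a a*, which is the outer-product hypothesis for the vectors scaled
      -- by √(c y).
      let ℓ : H →ₗ[ℝ] ℝ :=
        { toFun := fun T => ∑ y : u.image Φ,
            c y * (inner ℂ ((T : E →L[ℂ] E) (X (j y).1.1)) (D (j y).1.1)).re
          map_add' := fun T T' => by
            simp [mul_add, Finset.sum_add_distrib]
          map_smul' := fun a T => by
            simp only [Submodule.coe_smul, smul_apply, RingHom.id_apply, smul_eq_mul,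
              Finset.mul_sum]
            refine Finset.sum_congr rfl fun y _ => ?_
            rw [← Complex.coe_smul, inner_smul_left, Complex.conj_ofReal, Complex.re_ofReal_mul]
            ring }
      have hℓ : ℓ = 0 := b.ext fun i => by
        have h1 : -2 * ℓ (b i) = 0 := by
          refine Eq.trans ?_ (hx2' i)
          change -2 * ∑ y : u.image Φ, _ = _
          rw [Finset.mul_sum]
          exact Finset.sum_congr rfl fun y _ => mul_left_comm _ _ _
        simpa using h1
      have hR := sum_nonneg_of_sum_outer_eq_zero (X := X) (D := D) M hfin hinf
        (fun y : u.image Φ => ((√(c y) : ℝ) : ℂ) • (j y).1.1) (by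
          intro a
          let T : H := ⟨InnerProductSpace.rankOne ℂ a a,
            (InnerProductSpace.adjoint_rankOne a a : _)⟩
          have hT : ℓ T = 0 := by rw [hℓ]; rfl
          refine Eq.trans ?_ hT
          rw [Complex.re_sum]
          refine Finset.sum_congr rfl fun y _ => ?_
          have h1 : (T : E →L[ℂ] E) (X (j y).1.1) = inner ℂ a (X (j y).1.1) • a := rfl
          rw [h1, map_smul, map_smul, inner_smul_left, inner_smul_right, inner_smul_left,
            inner_conj_symm, Complex.conj_ofReal, mul_assoc, mul_left_comm _ (√(c y) : ℂ),
            Complex.re_ofReal_mul, Complex.re_ofReal_mul, ← mul_assoc,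
            Real.mul_self_sqrt (hc0' y)])
      have hR' : 0 ≤ ∑ y : u.image Φ, c y * (inner ℂ (M (j y).1.1) (j y).1.1).re := by
        convert hR using 2 with y
        rw [map_smul, inner_smul_left, inner_smul_right, Complex.conj_ofReal,
          Complex.re_ofReal_mul, Complex.re_ofReal_mul, ← mul_assoc, Real.mul_self_sqrt (hc0' y)]
      have hpos : 0 < ∑ y : u.image Φ, c y * ((j y).2.1 * ‖(j y).1.1‖ ^ 2) := by
        have hp : ∀ y : u.image Φ, 0 < (j y).2.1 * ‖(j y).1.1‖ ^ 2 := fun y =>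
          mul_pos (j y).2.2 (by have := norm_pos_iff.2 (j y).1.2; positivity)
        obtain ⟨y, hy⟩ : ∃ y : u.image Φ, 0 < c y := by
          by_contra! hcon
          have : ∑ y : u.image Φ, c y ≤ 0 := Finset.sum_nonpos fun y _ => hcon y
          linarith
        exact Finset.sum_pos' (fun y _ => mul_nonneg (hc0' y) (hp y).le)
          ⟨y, Finset.mem_univ _, mul_pos hy (hp y)⟩
      have hsum : x.1 = ∑ y : u.image Φ, c y * (inner ℂ (M (j y).1.1) (j y).1.1).re
          + ∑ y : u.image Φ, c y * ((j y).2.1 * ‖(j y).1.1‖ ^ 2) := by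
        rw [← hx1', ← Finset.sum_add_distrib]
        exact Finset.sum_congr rfl fun y _ => by simp only [q]; ring
      linarith
    obtain ⟨f, a, v, h1, h2, h3⟩ := geometric_hahn_banach_compact_closed (convex_convexHull ℝ _)
      ((u.image Φ).finite_toSet.isCompact_convexHull ℝ) hray hrayc hdisj
    have hv : v < 0 := by
      have := h3 0 ⟨le_rfl, rfl⟩
      simpa using this
    have hf : ∀ x, f x = x.1 * f (1, 0) + ∑ i, x.2 i * f (0, Pi.single i 1) := by
      intro x
      have e1 : x = x.1 • ((1, 0) : ℝ × (Fin d → ℝ))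
          + ∑ i, x.2 i • ((0, Pi.single i 1) : ℝ × (Fin d → ℝ)) := by
        refine Prod.ext ?_ ?_
        · simp [Prod.fst_sum]
        · simp only [Prod.snd_add, Prod.smul_snd, smul_zero, zero_add, Prod.snd_sum]
          exact pi_eq_sum_univ' x.2
      conv_lhs => rw [e1]
      rw [map_add, map_sum, map_smul, smul_eq_mul]
      simp only [map_smul, smul_eq_mul]
    -- Otherwise f would be unbounded below on the ray. This sign makes the multiplier -f (1, 0) of
    -- the supply nonnegative.
    have hf1 : f (1, 0) ≤ 0 := by
      by_contra! hcon
      have := h3 ((v / f (1, 0)), 0) ⟨(div_neg_of_neg_of_pos hv hcon).le, rfl⟩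
      rw [hf] at this
      simp [div_mul_cancel₀ _ hcon.ne'] at this
    refine ⟨(-f (1, 0), fun i => -f (0, Pi.single i 1)), ?_, ?_⟩
    · intro h0
      obtain ⟨j, hj⟩ := hne
      have h4 := h1 (Φ j) (subset_convexHull ℝ _ (by exact_mod_cast Finset.mem_image_of_mem Φ hj))
      have h5 := congrArg Prod.fst h0
      have h6 := fun i => congrFun (congrArg Prod.snd h0) i
      simp only [Prod.fst_zero, neg_eq_zero, Prod.snd_zero, Pi.zero_apply] at h5 h6
      rw [hf] at h4
      simp only [h5, h6, mul_zero, Finset.sum_const_zero, add_zero] at h4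
      linarith
    · intro j hj
      have h4 := h1 (Φ j) (subset_convexHull ℝ _ (by exact_mod_cast Finset.mem_image_of_mem Φ hj))
      rw [hf] at h4
      refine ⟨by simpa using hf1, ?_⟩
      simp only [neg_mul, Finset.sum_neg_distrib]
      simp only [Φ, mul_comm (q j), mul_comm (g _ _)] at h4
      linarith
  obtain ⟨ψ, hψ1, hψ⟩ := (isCompact_sphere (0 : ℝ × (Fin d → ℝ)) 1).inter_iInter_nonempty t
    hclosed hsep
  simp only [Set.mem_iInter] at hψ
  let P : H := ∑ i, ψ.2 i • b i
  have hPin : ∀ w, ∑ i, ψ.2 i * g i w = -2 * (inner ℂ ((P : E →L[ℂ] E) (X w)) (D w)).re := by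
    intro w
    simp only [P, g, Submodule.coe_sum, Submodule.coe_smul, sum_apply,
      sum_inner, Complex.re_sum, Finset.mul_sum]
    refine Finset.sum_congr rfl fun i _ => ?_
    rw [smul_apply, ← Complex.coe_smul, inner_smul_left, Complex.conj_ofReal,
      Complex.re_ofReal_mul]
    ring
  have hPsa : IsSelfAdjoint (P : E →L[ℂ] E) := P.2
  have hineq : ∀ w, 2 * (inner ℂ ((P : E →L[ℂ] E) (X w)) (D w)).re
      ≤ ψ.1 * (inner ℂ (M w) w).re := by
    intro w
    rcases eq_or_ne w 0 with rfl | hw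
    · simp
    refine le_of_forall_pos_le_add fun ε hε => ?_
    have hn : 0 < ‖w‖ := norm_pos_iff.2 hw
    have hψ0 : 0 ≤ ψ.1 := (hψ (⟨w, hw⟩, ⟨1, one_pos⟩)).1
    have h1 := (hψ (⟨w, hw⟩, ⟨ε / ((ψ.1 + 1) * ‖w‖ ^ 2), by positivity⟩)).2
    simp only [q, hPin] at h1
    have h2 : ψ.1 * (ε / ((ψ.1 + 1) * ‖w‖ ^ 2) * ‖w‖ ^ 2) ≤ ε := by
      have : ψ.1 * (ε / ((ψ.1 + 1) * ‖w‖ ^ 2) * ‖w‖ ^ 2) = ψ.1 / (ψ.1 + 1) * ε := by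
        field_simp
      rw [this]
      have : ψ.1 / (ψ.1 + 1) ≤ 1 := by
        rw [div_le_one (by positivity)]; linarith
      nlinarith
    linarith
  have hψ0 : 0 ≤ ψ.1 := by
    obtain ⟨w, hw⟩ := exists_ne (0 : W)
    exact (hψ (⟨w, hw⟩, ⟨1, one_pos⟩)).1
  -- If the supply has multiplier zero, controllability forces P = 0 and then ψ = 0, which is not on
  -- the sphere. Otherwise P is divided by the multiplier.
  rcases hψ0.eq_or_lt with h0 | hpos
  · exfalso
    have hP0 : (-(P : E →L[ℂ] E)) = 0 := by
      refine selfAdjoint_eq_zero_of_nonneg hX hC hPsa.neg fun w => ?_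
      have := hineq w
      rw [← h0, zero_mul] at this
      simp only [neg_apply, inner_neg_left, Complex.neg_re]
      linarith
    have hP0' : P = 0 := by
      rw [neg_eq_zero] at hP0
      exact Subtype.ext hP0
    have hc := Fintype.linearIndependent_iff.1 b.linearIndependent ψ.2 hP0'
    have : ψ = 0 := Prod.ext h0.symm (funext hc)
    simp [this] at hψ1
  · refine ⟨ψ.1⁻¹ • (P : E →L[ℂ] E), ?_, fun w => ?_⟩
    · exact (ψ.1⁻¹ • P).2
    · have := hineq w
      rw [smul_apply, ← Complex.coe_smul, inner_smul_left, Complex.conj_ofReal,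
        Complex.re_ofReal_mul]
      rw [mul_left_comm, inv_mul_le_iff₀ hpos]
      exact this

end KYP

/-! ### Calculus of primitives of locally integrable functions -/

section Primitive

variable {F₁ F₂ F₃ : Type*} [NormedAddCommGroup F₁] [NormedSpace ℝ F₁] [CompleteSpace F₁]
  [NormedAddCommGroup F₂] [NormedSpace ℝ F₂] [CompleteSpace F₂]
  [NormedAddCommGroup F₃] [NormedSpace ℝ F₃] [CompleteSpace F₃]

/-- `x` is, on `[0, ∞)`, the primitive of the locally integrable function `f`. -/
structure IsPrimitive (x f : ℝ → F₁) : Prop where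
  integrable : ∀ T : ℝ, 0 ≤ T → IntervalIntegrable f volume 0 T
  eq : ∀ t : ℝ, 0 ≤ t → x t = x 0 + ∫ s in (0 : ℝ)..t, f s

omit [CompleteSpace F₁] in
theorem IsPrimitive.continuousOn {x f : ℝ → F₁} (h : IsPrimitive x f) {T : ℝ} (hT : 0 ≤ T) :
    ContinuousOn x (Set.Icc 0 T) := by
  have h1 : ContinuousOn (fun t => x 0 + ∫ s in (0 : ℝ)..t, f s) (Set.uIcc 0 T) :=
    continuousOn_const.add (intervalIntegral.continuousOn_primitive_interval'
      (h.integrable T hT) Set.left_mem_uIcc)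
  rw [Set.uIcc_of_le hT] at h1
  exact h1.congr fun t ht => h.eq t ht.1

omit [CompleteSpace F₁] in
theorem IsPrimitive.eq_sub {x f : ℝ → F₁} (h : IsPrimitive x f) {s t : ℝ} (hs : 0 ≤ s)
    (ht : 0 ≤ t) : x t - x s = ∫ r in s..t, f r := by
  rw [h.eq t ht, h.eq s hs, add_sub_add_left_eq_sub,
    intervalIntegral.integral_interval_sub_left (h.integrable t ht) (h.integrable s hs)]

theorem IsPrimitive.clm {x f : ℝ → F₁} (h : IsPrimitive x f) (L : F₁ →L[ℝ] F₂) :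
    IsPrimitive (fun t => L (x t)) (fun t => L (f t)) where
  integrable T hT := by
    have := h.integrable T hT
    rw [intervalIntegrable_iff] at this ⊢
    exact L.integrable_comp this
  eq t ht := by
    rw [L.intervalIntegral_comp_comm (h.integrable t ht), ← map_add, ← h.eq t ht]

omit [CompleteSpace F₁] in
theorem IsPrimitive.add {x y f g : ℝ → F₁} (h : IsPrimitive x f) (h' : IsPrimitive y g) :
    IsPrimitive (fun t => x t + y t) (fun t => f t + g t) where
  integrable T hT := (h.integrable T hT).add (h'.integrable T hT)
  eq t ht := by
    rw [intervalIntegral.integral_add (h.integrable t ht) (h'.integrable t ht), h.eq t ht,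
      h'.eq t ht]
    abel

theorem isPrimitive_of_hasDerivAt {x f : ℝ → F₁} (h : ∀ t, HasDerivAt x (f t) t)
    (hf : Continuous f) : IsPrimitive x f where
  integrable T _ := hf.intervalIntegrable 0 T
  eq t _ := by
    rw [intervalIntegral.integral_eq_sub_of_hasDerivAt (fun s _ => h s)
      (hf.intervalIntegrable 0 t)]
    abel

/-- Absolute continuity is inherited by domination of increments. -/
theorem absolutelyContinuousOnInterval_of_dist_le {X Y : Type*} [PseudoMetricSpace X]
    [PseudoMetricSpace Y] {φ : ℝ → X} {h : ℝ → Y} {a b : ℝ}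
    (hh : AbsolutelyContinuousOnInterval h a b)
    (hle : ∀ s ∈ Set.uIcc a b, ∀ t ∈ Set.uIcc a b, dist (φ s) (φ t) ≤ dist (h s) (h t)) :
    AbsolutelyContinuousOnInterval φ a b := by
  refine tendsto_of_tendsto_of_tendsto_of_le_of_le' tendsto_const_nhds hh
    (Eventually.of_forall fun E => Finset.sum_nonneg fun _ _ => dist_nonneg) ?_
  have : AbsolutelyContinuousOnInterval.disjWithin a b ∈
      AbsolutelyContinuousOnInterval.totalLengthFilter ⊓
        𝓟 (AbsolutelyContinuousOnInterval.disjWithin a b) :=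
    mem_inf_of_right (mem_principal_self _)
  filter_upwards [this] with E hE
  exact Finset.sum_le_sum fun i hi => hle _ (hE.1 i hi).1 _ (hE.1 i hi).2

omit [CompleteSpace F₁] [CompleteSpace F₂] [CompleteSpace F₃] in
theorem intervalIntegrable_bilin_left (L : F₁ →L[ℝ] F₂ →L[ℝ] F₃) {f : ℝ → F₁} {z : ℝ → F₂} {T : ℝ}
    (hT : 0 ≤ T) (hf : IntervalIntegrable f volume 0 T) (hz : ContinuousOn z (Set.Icc 0 T)) :
    IntervalIntegrable (fun t => L (f t) (z t)) volume 0 T := by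
  obtain ⟨K, hK⟩ := isCompact_Icc.exists_bound_of_continuousOn hz
  have hzm : AEStronglyMeasurable z (volume.restrict (Set.uIoc 0 T)) := by
    rw [Set.uIoc_of_le hT]
    exact (hz.mono Set.Ioc_subset_Icc_self).aestronglyMeasurable measurableSet_Ioc
  refine (hf.norm.const_mul (‖L‖ * K)).mono_fun
    (L.aestronglyMeasurable_comp₂ hf.aestronglyMeasurable_restrict_uIoc hzm) ?_
  filter_upwards [ae_restrict_mem measurableSet_uIoc] with t ht
  rw [Set.uIoc_of_le hT] at ht
  have h1 := hK t ⟨ht.1.le, ht.2⟩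
  have hK0 : 0 ≤ K := (norm_nonneg _).trans h1
  calc ‖L (f t) (z t)‖ ≤ ‖L‖ * ‖f t‖ * ‖z t‖ := L.le_opNorm₂ _ _
    _ ≤ ‖L‖ * ‖f t‖ * K := by gcongr
    _ = ‖L‖ * K * ‖f t‖ := by ring
    _ ≤ _ := le_abs_self _

theorem intervalIntegrable_of_mem_Icc {A : Type*} [NormedAddCommGroup A] {φ : ℝ → A} {s t T : ℝ}
    (hφ : IntervalIntegrable φ volume 0 T) (hs : 0 ≤ s) (hst : s ≤ t) (ht : t ≤ T) :
    IntervalIntegrable φ volume 0 t ∧ IntervalIntegrable φ volume 0 s ∧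
      IntervalIntegrable φ volume s t := by
  have h0t := hs.trans hst
  refine ⟨hφ.mono_set ?_, hφ.mono_set ?_, hφ.mono_set ?_⟩
  · rw [Set.uIcc_of_le h0t, Set.uIcc_of_le (h0t.trans ht)]; exact Set.Icc_subset_Icc_right ht
  · rw [Set.uIcc_of_le hs, Set.uIcc_of_le (h0t.trans ht)]
    exact Set.Icc_subset_Icc_right (hst.trans ht)
  · rw [Set.uIcc_of_le hst, Set.uIcc_of_le (h0t.trans ht)]; exact Set.Icc_subset_Icc hs ht

/-- Product rule for primitives of locally integrable functions. -/
theorem IsPrimitive.bilin (L : F₁ →L[ℝ] F₂ →L[ℝ] F₃) {x f : ℝ → F₁} {z g : ℝ → F₂}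
    (hx : IsPrimitive x f) (hz : IsPrimitive z g) :
    IsPrimitive (fun t => L (x t) (z t)) (fun t => L (f t) (z t) + L (x t) (g t)) := by
  have hint : ∀ T, 0 ≤ T → IntervalIntegrable (fun t => L (f t) (z t) + L (x t) (g t))
      volume 0 T := fun T hT =>
    (intervalIntegrable_bilin_left L hT (hx.integrable T hT) (hz.continuousOn hT)).add
      (intervalIntegrable_bilin_left L.flip hT (hz.integrable T hT) (hx.continuousOn hT))
  refine ⟨hint, fun T hT => ?_⟩
  obtain ⟨K₁, hK₁⟩ := isCompact_Icc.exists_bound_of_continuousOn (hx.continuousOn hT)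
  obtain ⟨K₂, hK₂⟩ := isCompact_Icc.exists_bound_of_continuousOn (hz.continuousOn hT)
  set K := max (max K₁ K₂) 0 with hKdef
  have hK0 : 0 ≤ K := le_max_right _ _
  have hKx : ∀ t ∈ Set.Icc 0 T, ‖x t‖ ≤ K := fun t ht =>
    (hK₁ t ht).trans ((le_max_left _ _).trans (le_max_left _ _))
  have hKz : ∀ t ∈ Set.Icc 0 T, ‖z t‖ ≤ K := fun t ht =>
    (hK₂ t ht).trans ((le_max_right _ _).trans (le_max_left _ _))
  -- The factor 2 pays once for the increment of L (x t) (z t) and once for the integral of G.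
  -- Domination by the primitive of n makes Φ absolutely continuous; its derivative vanishes almost
  -- everywhere, so Φ is constant.
  let n : ℝ → ℝ := fun t => 2 * (‖L‖ * K) * (‖f t‖ + ‖g t‖)
  have hn : IntervalIntegrable n volume 0 T :=
    ((hx.integrable T hT).norm.add (hz.integrable T hT).norm).const_mul _
  let G : ℝ → F₃ := fun t => L (f t) (z t) + L (x t) (g t)
  let Φ : ℝ → F₃ := fun t => L (x t) (z t) - ∫ s in (0 : ℝ)..t, G s
  have hAC : AbsolutelyContinuousOnInterval Φ 0 T := by
    refine absolutelyContinuousOnInterval_of_dist_le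
      (hn.absolutelyContinuousOnInterval_intervalIntegral Set.left_mem_uIcc) ?_
    rw [Set.uIcc_of_le hT]
    intro s hs t ht
    wlog hst : s ≤ t generalizing s t
    · rw [dist_comm, dist_comm (∫ v in (0 : ℝ)..s, n v)]
      exact this t ht s hs (le_of_not_ge hst)
    have hf := (intervalIntegrable_of_mem_Icc (hx.integrable T hT) hs.1 hst ht.2).2.2
    have hg := (intervalIntegrable_of_mem_Icc (hz.integrable T hT) hs.1 hst ht.2).2.2
    have hG := intervalIntegrable_of_mem_Icc (hint T hT) hs.1 hst ht.2
    have hn' := intervalIntegrable_of_mem_Icc hn hs.1 hst ht.2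
    have e1 : Φ t - Φ s = L (x t - x s) (z t) + L (x s) (z t - z s) - ∫ r in s..t, G r := by
      have := intervalIntegral.integral_interval_sub_left hG.1 hG.2.1
      rw [← this]
      simp only [Φ, G, map_sub, sub_apply]
      abel
    have hIf : ‖x t - x s‖ ≤ ∫ r in s..t, ‖f r‖ := by
      rw [hx.eq_sub hs.1 ht.1]; exact intervalIntegral.norm_integral_le_integral_norm hst
    have hIg : ‖z t - z s‖ ≤ ∫ r in s..t, ‖g r‖ := by
      rw [hz.eq_sub hs.1 ht.1]; exact intervalIntegral.norm_integral_le_integral_norm hst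
    have hIG : ‖∫ r in s..t, G r‖ ≤ ∫ r in s..t, ‖L‖ * K * (‖f r‖ + ‖g r‖) := by
      refine intervalIntegral.norm_integral_le_of_norm_le hst (Eventually.of_forall fun r hr => ?_)
        ((hf.norm.add hg.norm).const_mul _)
      have hr' : r ∈ Set.Icc 0 T := ⟨hs.1.trans hr.1.le, hr.2.trans ht.2⟩
      calc ‖G r‖ ≤ ‖L (f r) (z r)‖ + ‖L (x r) (g r)‖ := norm_add_le _ _
        _ ≤ ‖L‖ * ‖f r‖ * ‖z r‖ + ‖L‖ * ‖x r‖ * ‖g r‖ :=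
          add_le_add (L.le_opNorm₂ _ _) (L.le_opNorm₂ _ _)
        _ ≤ ‖L‖ * ‖f r‖ * K + ‖L‖ * K * ‖g r‖ := by
          gcongr
          · exact hKz r hr'
          · exact hKx r hr'
        _ = _ := by ring
    rw [dist_comm, dist_eq_norm, e1, dist_comm, dist_eq_norm,
      intervalIntegral.integral_interval_sub_left hn'.1 hn'.2.1]
    have e2 : ∫ r in s..t, n r = ‖L‖ * K * (∫ r in s..t, ‖f r‖) + ‖L‖ * K * (∫ r in s..t, ‖g r‖)
        + ∫ r in s..t, ‖L‖ * K * (‖f r‖ + ‖g r‖) := by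
      simp only [n, intervalIntegral.integral_const_mul,
        intervalIntegral.integral_add hf.norm hg.norm]
      ring
    refine le_trans ?_ (le_abs_self _)
    rw [e2]
    refine (norm_sub_le _ _).trans (add_le_add ((norm_add_le _ _).trans (add_le_add ?_ ?_)) hIG)
    · calc ‖L (x t - x s) (z t)‖ ≤ ‖L‖ * ‖x t - x s‖ * ‖z t‖ := L.le_opNorm₂ _ _
        _ ≤ ‖L‖ * (∫ r in s..t, ‖f r‖) * K := by
          gcongr
          · have := intervalIntegral.integral_nonneg (μ := volume) hst
              fun r _ => norm_nonneg (f r)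
            positivity
          · exact hKz t ht
        _ = _ := by ring
    · calc ‖L (x s) (z t - z s)‖ ≤ ‖L‖ * ‖x s‖ * ‖z t - z s‖ := L.le_opNorm₂ _ _
        _ ≤ _ := by
          gcongr
          exact hKx s hs
  have hderiv : ∀ᵐ t, t ∈ Set.uIcc 0 T → HasDerivAt Φ 0 t := by
    have h0 : ∀ᵐ t : ℝ, t ≠ 0 := by simp [ae_iff]
    have hT' : ∀ᵐ t : ℝ, t ≠ T := by simp [ae_iff]
    filter_upwards [h0, hT', (hx.integrable T hT).ae_hasDerivAt_integral,
      (hz.integrable T hT).ae_hasDerivAt_integral, (hint T hT).ae_hasDerivAt_integral]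
      with t ht0 htT hft hgt hGt ht
    have ht' := ht
    rw [Set.uIcc_of_le hT] at ht'
    have hpos : 0 < t := lt_of_le_of_ne ht'.1 ht0.symm
    have hev : ∀ᶠ s in 𝓝 t, 0 ≤ s := (lt_mem_nhds hpos).mono fun s hs => hs.le
    have hdx : HasDerivAt x (f t) t :=
      ((hft ht 0 Set.left_mem_uIcc).const_add (x 0)).congr_of_eventuallyEq
        (hev.mono fun s hs => hx.eq s hs)
    have hdz : HasDerivAt z (g t) t :=
      ((hgt ht 0 Set.left_mem_uIcc).const_add (z 0)).congr_of_eventuallyEq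
        (hev.mono fun s hs => hz.eq s hs)
    have hb := (L.hasFDerivAt_of_bilinear hdx.hasFDerivAt hdz.hasFDerivAt).hasDerivAt
    have hΦ : HasDerivAt Φ _ t := hb.sub (hGt ht 0 Set.left_mem_uIcc)
    exact hΦ.congr_deriv (by simp [add_comm])
  obtain ⟨C, hC⟩ := hAC.const_of_ae_hasDerivAt_zero hderiv
  have h1 := hC 0 Set.left_mem_uIcc
  have h2 := hC T Set.right_mem_uIcc
  simp only [Φ, intervalIntegral.integral_same, sub_zero] at h1 h2
  change L (x T) (z T) = L (x 0) (z 0) + ∫ s in (0 : ℝ)..T, G s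
  rw [h1, ← h2]; abel

end Primitive

/-! ### Exponential decay and bounds for stable linear equations -/

section Stable

variable {F : Type*} [NormedAddCommGroup F] [NormedSpace ℝ F] [FiniteDimensional ℝ F]
  [CompleteSpace F]

/-- The semigroup `exp (t H)`. -/
noncomputable def expSemigroup (H : F →L[ℝ] F) (t : ℝ) : F →L[ℝ] F := NormedSpace.exp (t • H)

omit [FiniteDimensional ℝ F] in
theorem expSemigroup_add (H : F →L[ℝ] F) (s t : ℝ) :
    expSemigroup H (s + t) = expSemigroup H s * expSemigroup H t := by
  let _ : NormedAlgebra ℚ (F →L[ℝ] F) := NormedAlgebra.restrictScalars ℚ ℝ _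
  unfold expSemigroup
  rw [add_smul, NormedSpace.exp_add_of_commute]
  exact ((Commute.refl H).smul_left s).smul_right t

omit [FiniteDimensional ℝ F] in
theorem hasDerivAt_expSemigroup (H : F →L[ℝ] F) (t : ℝ) :
    HasDerivAt (expSemigroup H) (expSemigroup H t * H) t :=
  hasDerivAt_exp_smul_const H t

omit [FiniteDimensional ℝ F] in
theorem continuous_expSemigroup (H : F →L[ℝ] F) : Continuous (expSemigroup H) :=
  continuous_iff_continuousAt.2 fun t => (hasDerivAt_expSemigroup H t).continuousAt

omit [FiniteDimensional ℝ F] [CompleteSpace F] in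
@[simp]
theorem expSemigroup_zero (H : F →L[ℝ] F) : expSemigroup H 0 = 1 := by
  simp [expSemigroup, NormedSpace.exp_zero]

/-- In finite dimensions a pointwise stable semigroup decays exponentially. -/
theorem exists_expSemigroup_decay {H : F →L[ℝ] F}
    (h : ∀ x, Tendsto (fun t => expSemigroup H t x) atTop (𝓝 0)) :
    ∃ C α : ℝ, 0 < C ∧ 0 < α ∧ ∀ t, 0 ≤ t → ‖expSemigroup H t‖ ≤ C * Real.exp (-α * t) := by
  obtain ⟨C₀, hC₀, hb⟩ := (Module.finBasis ℝ F).exists_opNorm_le (F := F)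
  -- Smallness on a finite basis controls the operator norm, so at some time τ the semigroup has
  -- norm at most 1/2. Its powers then decay geometrically, with rate log 2 / τ.
  have h1 : ∀ᶠ t : ℝ in atTop, 0 < t ∧
      ∀ i, ‖expSemigroup H t (Module.finBasis ℝ F i)‖ ≤ 1 / (2 * C₀) := by
    refine (eventually_gt_atTop 0).and (eventually_all.2 fun i => ?_)
    have := (h (Module.finBasis ℝ F i)).norm
    rw [norm_zero] at this
    exact (this.eventually_lt_const (by positivity)).mono fun t ht => ht.le
  obtain ⟨τ, hτ, hτb⟩ := h1.exists
  have hhalf : ‖expSemigroup H τ‖ ≤ 1 / 2 := by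
    refine (hb (by positivity) hτb).trans (le_of_eq ?_)
    field_simp
  obtain ⟨K, hK⟩ := (isCompact_Icc (a := (0 : ℝ)) (b := τ)).exists_bound_of_continuousOn
    (continuous_expSemigroup H).continuousOn
  have hpow : ∀ n : ℕ, ‖expSemigroup H (n * τ)‖ ≤ ‖expSemigroup H 0‖ * (1 / 2) ^ n := by
    intro n
    induction n with
    | zero => simp
    | succ k ih =>
      have e : ((k + 1 : ℕ) : ℝ) * τ = k * τ + τ := by push_cast; ring
      rw [e, expSemigroup_add, pow_succ, ← mul_assoc]
      exact (norm_mul_le _ _).trans (mul_le_mul ih hhalf (norm_nonneg _) (by positivity))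
  have hK0 : 0 ≤ K := (norm_nonneg _).trans (hK 0 ⟨le_rfl, hτ.le⟩)
  set K' := ‖expSemigroup H 0‖ with hK'
  refine ⟨2 * (K' + 1) * (K + 1), Real.log 2 / τ, by positivity,
    div_pos (Real.log_pos one_lt_two) hτ, fun t ht => ?_⟩
  set n := ⌊t / τ⌋₊ with hn
  have hn1 : (n : ℝ) ≤ t / τ := Nat.floor_le (by positivity)
  have hn2 : t / τ < n + 1 := Nat.lt_floor_add_one _
  have hr1 : 0 ≤ t - n * τ := by
    rw [le_div_iff₀ hτ] at hn1; linarith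
  have hr2 : t - n * τ ≤ τ := by
    rw [div_lt_iff₀ hτ] at hn2; linarith
  have e : t = n * τ + (t - n * τ) := by ring
  have hexp : (1 / 2 : ℝ) ^ n ≤ 2 * Real.exp (-(Real.log 2 / τ) * t) := by
    have e1 : (1 / 2 : ℝ) ^ n = Real.exp (-(n * Real.log 2)) := by
      rw [Real.exp_neg, Real.exp_nat_mul, Real.exp_log two_pos, one_div, inv_pow]
    have e2 : 2 * Real.exp (-(Real.log 2 / τ) * t)
        = Real.exp (Real.log 2 - (t / τ) * Real.log 2) := by
      rw [sub_eq_add_neg, Real.exp_add, Real.exp_log two_pos]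
      congr 2; ring
    rw [e1, e2, Real.exp_le_exp]
    nlinarith [Real.log_pos one_lt_two]
  calc ‖expSemigroup H t‖ = ‖expSemigroup H (n * τ) * expSemigroup H (t - n * τ)‖ := by
        rw [← expSemigroup_add, ← e]
    _ ≤ ‖expSemigroup H (n * τ)‖ * ‖expSemigroup H (t - n * τ)‖ := norm_mul_le _ _
    _ ≤ (K' * (1 / 2) ^ n) * K :=
      mul_le_mul (hpow n) (hK _ ⟨hr1, hr2⟩) (norm_nonneg _) (by positivity)
    _ ≤ ((K' + 1) * (2 * Real.exp (-(Real.log 2 / τ) * t))) * (K + 1) := by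
      gcongr <;> linarith
    _ = _ := by ring

omit [FiniteDimensional ℝ F] in
/-- Variation of constants. -/
theorem IsPrimitive.eq_variation_of_constants {H : F →L[ℝ] F} {z f : ℝ → F}
    (h : IsPrimitive z (fun s => H (z s) + f s)) {t : ℝ} (ht : 0 ≤ t) :
    z t = expSemigroup H t (z 0) + ∫ s in (0 : ℝ)..t, expSemigroup H (t - s) (f s) := by
  have h1 : IsPrimitive (fun s => expSemigroup H (t - s))
      (fun s => -(expSemigroup H (t - s) * H)) := by
    refine isPrimitive_of_hasDerivAt (fun s => ?_) ?_
    · have := (hasDerivAt_expSemigroup H (t - s)).scomp s ((hasDerivAt_id s).const_sub t)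
      simpa [Function.comp_def] using this
    · have := continuous_expSemigroup H
      fun_prop
  have h2 := (h1.bilin (ContinuousLinearMap.id ℝ (F →L[ℝ] F)) h).eq t ht
  simp only [ContinuousLinearMap.id_apply, sub_self, expSemigroup_zero, sub_zero] at h2
  refine (show z t = _ from h2).trans ?_
  congr 1
  refine intervalIntegral.integral_congr fun s _ => ?_
  simp

omit [FiniteDimensional ℝ F] in
theorem IsPrimitive.eq_expSemigroup {H : F →L[ℝ] F} {z : ℝ → F}
    (h : IsPrimitive z (fun s => H (z s))) {t : ℝ} (ht : 0 ≤ t) :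
    z t = expSemigroup H t (z 0) := by
  have h' : IsPrimitive z (fun s => H (z s) + (fun _ => (0 : F)) s) := by simpa using h
  simpa using h'.eq_variation_of_constants ht

theorem integral_exp_neg_mul_le {α : ℝ} (hα : 0 < α) (t : ℝ) :
    ∫ s in (0 : ℝ)..t, Real.exp (-α * s) ≤ 1 / α := by
  have h1 : ∀ s ∈ Set.uIcc 0 t, HasDerivAt (fun s => -(1 / α) * Real.exp (-α * s))
      (Real.exp (-α * s)) s := by
    intro s _
    have := (((hasDerivAt_id s).const_mul (-α)).exp).const_mul (-(1 / α))
    refine this.congr_deriv ?_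
    simp only [id]
    field_simp
  rw [intervalIntegral.integral_eq_sub_of_hasDerivAt h1
    ((by fun_prop : Continuous fun s : ℝ => Real.exp (-α * s)).intervalIntegrable _ _)]
  have := Real.exp_pos (-α * t)
  have h2 : 0 < 1 / α := by positivity
  simp only [mul_zero, Real.exp_zero]
  nlinarith

/-- A stable linear system maps the sum of a bounded and a square integrable forcing to a bounded
state. -/
theorem exists_stable_bound {H : F →L[ℝ] F}
    (h : ∀ x, Tendsto (fun t => expSemigroup H t x) atTop (𝓝 0)) :
    ∃ C : ℝ, 0 < C ∧ ∀ (z f₁ f₂ : ℝ → F) (t a b : ℝ), 0 ≤ t → 0 ≤ a → 0 < b →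
      IsPrimitive z (fun s => H (z s) + (f₁ s + f₂ s)) → (∀ s ∈ Set.Icc 0 t, ‖f₁ s‖ ≤ a) →
      IntervalIntegrable (fun s => ‖f₂ s‖ ^ 2) volume 0 t →
      ∫ s in (0 : ℝ)..t, ‖f₂ s‖ ^ 2 ≤ b ^ 2 → ‖z t‖ ≤ C * (‖z 0‖ + a + b) := by
  obtain ⟨C, α, hC, hα, hS⟩ := exists_expSemigroup_decay h
  refine ⟨C * (1 + 1 / α), by positivity, fun z f₁ f₂ t a b ht ha hb hz hf₁ hf₂ hb2 => ?_⟩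
  have h1α : 0 < 1 / α := by positivity
  rw [hz.eq_variation_of_constants ht]
  let e : ℝ → ℝ := fun s => Real.exp (-α * (t - s))
  have hec : Continuous e := by fun_prop
  have he1 : ∀ s ∈ Set.Icc 0 t, e s ≤ 1 := by
    intro s hs
    refine Real.exp_le_one_iff.2 ?_
    have : 0 ≤ α * (t - s) := mul_nonneg hα.le (by linarith [hs.2])
    linarith
  have heint : ∫ s in (0 : ℝ)..t, e s ≤ 1 / α := by
    have := intervalIntegral.integral_comp_sub_left (a := 0) (b := t)
      (fun s => Real.exp (-α * s)) t
    simp only [sub_self, sub_zero] at this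
    simp only [e]
    rw [this]
    exact integral_exp_neg_mul_le hα t
  let g : ℝ → ℝ := fun s => C * (a * e s + (b / 2 * e s + 1 / (2 * b) * ‖f₂ s‖ ^ 2))
  have hie : ∀ c : ℝ, IntervalIntegrable (fun s => c * e s) volume 0 t := fun c =>
    (continuous_const.mul hec).intervalIntegrable _ _
  have hg : IntervalIntegrable g volume 0 t :=
    ((hie a).add ((hie _).add (hf₂.const_mul _))).const_mul _
  have hI : ‖∫ s in (0 : ℝ)..t, expSemigroup H (t - s) (f₁ s + f₂ s)‖ ≤ ∫ s in (0 : ℝ)..t, g s := by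
    refine intervalIntegral.norm_integral_le_of_norm_le ht (Eventually.of_forall fun s hs => ?_) hg
    have hs' : s ∈ Set.Icc 0 t := ⟨hs.1.le, hs.2⟩
    have h2 := hS (t - s) (by linarith [hs.2])
    -- Young's inequality with weight b, together with e² ≤ e: after integration both terms are of
    -- order b. This is where b > 0 matters.
    have h3 : e s * ‖f₂ s‖ ≤ b / 2 * e s + 1 / (2 * b) * ‖f₂ s‖ ^ 2 := by
      have he0 : 0 < e s := Real.exp_pos _
      have h4 : e s ^ 2 ≤ e s := by
        have := he1 s hs'
        nlinarith
      have h5 : b / 2 * e s ^ 2 ≤ b / 2 * e s := by gcongr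
      have h6 : b / 2 * e s ^ 2 + 1 / (2 * b) * ‖f₂ s‖ ^ 2 - e s * ‖f₂ s‖
          = 1 / (2 * b) * (b * e s - ‖f₂ s‖) ^ 2 := by
        field_simp
        ring
      have h7 : 0 ≤ 1 / (2 * b) * (b * e s - ‖f₂ s‖) ^ 2 := by positivity
      linarith
    calc ‖expSemigroup H (t - s) (f₁ s + f₂ s)‖
        ≤ ‖expSemigroup H (t - s)‖ * ‖f₁ s + f₂ s‖ := ContinuousLinearMap.le_opNorm _ _
      _ ≤ (C * e s) * (a + ‖f₂ s‖) := by
        refine mul_le_mul h2 ((norm_add_le _ _).trans ?_) (norm_nonneg _) ?_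
        · have := hf₁ s hs'
          linarith
        · exact mul_nonneg hC.le (Real.exp_pos _).le
      _ = C * (a * e s + e s * ‖f₂ s‖) := by ring
      _ ≤ g s := by
        simp only [g]
        gcongr
  have hgint : ∫ s in (0 : ℝ)..t, g s ≤ C * (a * (1 / α) + (b / 2 * (1 / α) + b / 2)) := by
    simp only [g]
    rw [intervalIntegral.integral_const_mul, intervalIntegral.integral_add (hie a)
      ((hie _).add (hf₂.const_mul _)), intervalIntegral.integral_add (hie _) (hf₂.const_mul _),
      intervalIntegral.integral_const_mul, intervalIntegral.integral_const_mul,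
      intervalIntegral.integral_const_mul]
    have : 1 / (2 * b) * ∫ s in (0 : ℝ)..t, ‖f₂ s‖ ^ 2 ≤ b / 2 := by
      calc _ ≤ 1 / (2 * b) * b ^ 2 := by gcongr
        _ = b / 2 := by field_simp
    gcongr
  have h0 : ‖expSemigroup H t (z 0)‖ ≤ C * ‖z 0‖ := by
    refine (ContinuousLinearMap.le_opNorm _ _).trans ?_
    gcongr
    refine (hS t ht).trans ?_
    have : Real.exp (-α * t) ≤ 1 := Real.exp_le_one_iff.2 (by nlinarith)
    nlinarith
  refine (norm_add_le _ _).trans ((add_le_add h0 (hI.trans hgint)).trans ?_)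
  have e1 : C * (1 + 1 / α) * (‖z 0‖ + a + b) - (C * ‖z 0‖ + C * (a * (1 / α) + (b / 2 * (1 / α) + b / 2)))
      = C * (1 / α * ‖z 0‖ + a + b / 2 + b / 2 * (1 / α)) := by ring
  have : 0 ≤ C * (1 / α * ‖z 0‖ + a + b / 2 + b / 2 * (1 / α)) := by positivity
  linarith

end Stable

/-! ### Locally square-integrable signals -/

section LocL2

variable {F G : Type*} [NormedAddCommGroup F] [InnerProductSpace ℂ F]
  [NormedAddCommGroup G] [InnerProductSpace ℂ G]

/-- Local square integrability on `[0, ∞)`. -/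
def LocL2 (w : ℝ → F) : Prop :=
  ∀ T : ℝ, 0 ≤ T → MemLp w 2 (volume.restrict (Set.Icc 0 T))

theorem LocL2.clm {w : ℝ → F} (h : LocL2 w) (L : F →L[ℂ] G) : LocL2 (fun t => L (w t)) :=
  fun T hT => L.comp_memLp' (h T hT)

theorem intervalIntegrable_of_integrable_Icc {A : Type*} [NormedAddCommGroup A] {f : ℝ → A} {T : ℝ}
    (hT : 0 ≤ T) (h : Integrable f (volume.restrict (Set.Icc 0 T))) :
    IntervalIntegrable f volume 0 T := by
  rw [intervalIntegrable_iff_integrableOn_Icc_of_le hT]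
  exact h

theorem LocL2.intervalIntegrable {w : ℝ → F} (h : LocL2 w) {T : ℝ} (hT : 0 ≤ T) :
    IntervalIntegrable w volume 0 T :=
  intervalIntegrable_of_integrable_Icc hT ((h T hT).integrable one_le_two)

theorem LocL2.sq {w : ℝ → F} (h : LocL2 w) {T : ℝ} (hT : 0 ≤ T) :
    IntervalIntegrable (fun t => ‖w t‖ ^ 2) volume 0 T :=
  intervalIntegrable_of_integrable_Icc hT ((h T hT).integrable_norm_pow two_ne_zero)

theorem LocL2.re_inner {w v : ℝ → F} (h : LocL2 w) (h' : LocL2 v) {T : ℝ} (hT : 0 ≤ T) :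
    IntervalIntegrable (fun t => (inner ℂ (w t) (v t)).re) volume 0 T := by
  refine intervalIntegrable_of_integrable_Icc hT (memLp_one_iff_integrable.1 ?_)
  refine MemLp.of_bilin (p := 2) (q := 2) (fun a b => (inner ℂ a b).re) 1 (h T hT) (h' T hT)
    (Complex.continuous_re.comp_aestronglyMeasurable
      ((h T hT).aestronglyMeasurable.inner (h' T hT).aestronglyMeasurable))
    (Eventually.of_forall fun t => ?_)
  rw [one_mul, ← NNReal.coe_le_coe, NNReal.coe_mul, coe_nnnorm, Real.norm_eq_abs]
  exact (Complex.abs_re_le_norm _).trans (norm_inner_le_norm _ _)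

theorem locL2_of_continuousOn {x : ℝ → F} (h : ∀ T, 0 ≤ T → ContinuousOn x (Set.Icc 0 T)) :
    LocL2 x := fun T hT => by
  obtain ⟨K, hK⟩ := isCompact_Icc.exists_bound_of_continuousOn (h T hT)
  refine MemLp.of_bound ((h T hT).aestronglyMeasurable measurableSet_Icc) K ?_
  filter_upwards [ae_restrict_mem measurableSet_Icc] with t ht using hK t ht

theorem LocL2.add {w v : ℝ → F} (h : LocL2 w) (h' : LocL2 v) : LocL2 (fun t => w t + v t) :=
  fun T hT => (h T hT).add (h' T hT)

theorem IsPrimitive.locL2 {x f : ℝ → F} (h : IsPrimitive x f) : LocL2 x :=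
  locL2_of_continuousOn fun _ hT => h.continuousOn hT

/-- The real part of a complex inner product as a real bilinear map. -/
noncomputable def reInnerL (F : Type*) [NormedAddCommGroup F] [InnerProductSpace ℂ F] :
    F →L[ℝ] F →L[ℝ] ℝ :=
  (LinearMap.mk₂ ℝ (fun a b : F => (inner ℂ a b).re)
    (fun a b c => by simp)
    (fun r a b => by
      rw [← Complex.coe_smul, inner_smul_left, Complex.conj_ofReal, Complex.re_ofReal_mul]; rfl)
    (fun a b c => by simp)
    (fun r a b => by
      rw [← Complex.coe_smul, inner_smul_right, Complex.re_ofReal_mul]; rfl)).mkContinuous₂ 1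
    (fun a b => by
      rw [one_mul, Real.norm_eq_abs]
      exact (Complex.abs_re_le_norm _).trans (norm_inner_le_norm a b))

/-- Derivative of a sesquilinear expression along two primitives. -/
theorem IsPrimitive.re_inner [CompleteSpace F] {x f y g : ℝ → F} (hx : IsPrimitive x f)
    (hy : IsPrimitive y g) :
    IsPrimitive (fun t => (inner ℂ (x t) (y t)).re)
      (fun t => (inner ℂ (f t) (y t)).re + (inner ℂ (x t) (g t)).re) :=
  hx.bilin (reInnerL F) hy

theorem IsPrimitive.clmC [CompleteSpace F] [CompleteSpace G] {x f : ℝ → F} (h : IsPrimitive x f)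
    (L : F →L[ℂ] G) : IsPrimitive (fun t => L (x t)) (fun t => L (f t)) :=
  h.clm (L.restrictScalars ℝ)

theorem IsPrimitive.congr_ae {x f g : ℝ → F} (h : IsPrimitive x f)
    (hfg : ∀ t, 0 ≤ t → ∀ᵐ s ∂volume, s ∈ Set.Ioc 0 t → f s = g s) : IsPrimitive x g where
  integrable T hT := by
    refine (h.integrable T hT).congr_ae ?_
    rw [Set.uIoc_of_le hT]
    exact (ae_restrict_iff' measurableSet_Ioc).2 (hfg T hT)
  eq t ht := by
    rw [h.eq t ht]
    congr 1
    refine intervalIntegral.integral_congr_ae ?_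
    rw [Set.uIoc_of_le ht]
    exact hfg t ht

end LocL2

/-! ### Factoring one linear map through another -/

section Factor

variable {V V' V'' : Type*} [AddCommGroup V] [Module ℂ V] [AddCommGroup V'] [Module ℂ V']
  [AddCommGroup V''] [Module ℂ V'']

theorem exists_factor_of_ker_le (f : V →ₗ[ℂ] V') (g : V →ₗ[ℂ] V'')
    (h : ∀ v, f v = 0 → g v = 0) : ∃ k : V' →ₗ[ℂ] V'', ∀ v, k (f v) = g v := by
  obtain ⟨r, hr⟩ := f.rangeRestrict.exists_rightInverse_of_surjective (LinearMap.range_rangeRestrict f)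
  obtain ⟨k, hk⟩ := LinearMap.exists_extend (g ∘ₗ r)
  refine ⟨k, fun v => ?_⟩
  have h1 : k (f v) = g (r (f.rangeRestrict v)) := LinearMap.congr_fun hk (f.rangeRestrict v)
  have h2 : f (r (f.rangeRestrict v)) = f v :=
    congrArg Subtype.val (LinearMap.congr_fun hr (f.rangeRestrict v))
  rw [h1, ← sub_eq_zero, ← map_sub]
  exact h _ (by rw [map_sub, h2, sub_self])

end Factor

/-! ### From the KYP inequality to a dissipation identity -/

section Controllable

variable {E W : Type*} [NormedAddCommGroup E] [InnerProductSpace ℂ E] [FiniteDimensional ℂ E]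
  [NormedAddCommGroup W] [InnerProductSpace ℂ W] [FiniteDimensional ℂ W]
  [CompleteSpace E] [CompleteSpace W]

/-- `M` dissipates along `(X, D)` with storage `⟪P x, x⟫` and dissipation rate `‖Y w‖²`. -/
structure IsDissipative (X D : W →L[ℂ] E) (M : W →L[ℂ] W) (P : E →L[ℂ] E) (Y : W →L[ℂ] W) :
    Prop where
  storage_selfAdjoint : IsSelfAdjoint P
  rate_selfAdjoint : IsSelfAdjoint Y
  supply_eq : ∀ w, M w = Y (Y w) + X.adjoint (P (D w)) + D.adjoint (P (X w))

theorem IsDissipative.re_inner_eq {X D : W →L[ℂ] E} {M : W →L[ℂ] W} {P : E →L[ℂ] E}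
    {Y : W →L[ℂ] W} (h : IsDissipative X D M P Y) (w : W) :
    (inner ℂ (M w) w).re = ‖Y w‖ ^ 2 + 2 * (inner ℂ (P (X w)) (D w)).re := by
  have h1 : inner ℂ (Y (Y w)) w = ((‖Y w‖ ^ 2 : ℝ) : ℂ) := by
    have := (ContinuousLinearMap.isSelfAdjoint_iff_isSymmetric.1 h.rate_selfAdjoint) (Y w) w
    have h4 : inner ℂ (Y (Y w)) w = inner ℂ (Y w) (Y w) := this
    rw [h4, inner_self_eq_norm_sq_to_K]; push_cast; rfl
  have h2 : (inner ℂ (P (D w)) (X w)).re = (inner ℂ (P (X w)) (D w)).re := by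
    have := (ContinuousLinearMap.isSelfAdjoint_iff_isSymmetric.1 h.storage_selfAdjoint) (D w) (X w)
    have h4 : inner ℂ (P (D w)) (X w) = inner ℂ (D w) (P (X w)) := this
    rw [h4, ← inner_conj_symm, Complex.conj_re]
  rw [h.supply_eq, inner_add_left, inner_add_left, ContinuousLinearMap.adjoint_inner_left,
    ContinuousLinearMap.adjoint_inner_left, h1, Complex.add_re, Complex.add_re, h2,
    Complex.ofReal_re]
  ring

/-- The KYP inequality says that the supply minus the storage derivative is a positive operator; Y
is its square root. -/
theorem exists_isDissipative {X D : W →L[ℂ] E} {M : W →L[ℂ] W} (hM : IsSelfAdjoint M)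
    (hX : Function.Surjective X)
    (hC : ∀ Z : Submodule ℂ E, (∀ w, X w ∈ Z → D w ∈ Z) → Z = ⊤)
    {s : Set ℝ} (hs : s.Finite)
    (hF : ∀ ω : ℝ, ω ∉ s → ∀ w, (Complex.I * ω) • X w = D w → 0 ≤ (inner ℂ (M w) w).re) :
    ∃ P Y, IsDissipative X D M P Y := by
  obtain ⟨P, hP, hineq⟩ := exists_storage M hX hC hs hF
  let F : W →L[ℂ] W := M - X.adjoint ∘L P ∘L D - D.adjoint ∘L P ∘L X
  have hPs := ContinuousLinearMap.isSelfAdjoint_iff_isSymmetric.1 hP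
  have hF1 : ∀ v w, inner ℂ (F v) w = inner ℂ (M v) w - inner ℂ (P (D v)) (X w)
      - inner ℂ (P (X v)) (D w) := by
    intro v w
    simp only [F, sub_apply, ContinuousLinearMap.comp_apply, inner_sub_left,
      ContinuousLinearMap.adjoint_inner_left]
  have hFpos : F.IsPositive := by
    refine ContinuousLinearMap.isPositive_def.2 ⟨?_, fun w => ?_⟩
    · intro v w
      have h1 : inner ℂ (M v) w = inner ℂ v (M w) :=
        (ContinuousLinearMap.isSelfAdjoint_iff_isSymmetric.1 hM) v w
      have h2 : inner ℂ (P (D v)) (X w) = inner ℂ (D v) (P (X w)) := hPs _ _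
      have h3 : inner ℂ (P (X v)) (D w) = inner ℂ (X v) (P (D w)) := hPs _ _
      change inner ℂ (F v) w = inner ℂ v (F w)
      rw [← inner_conj_symm v, hF1, hF1, map_sub, map_sub, inner_conj_symm, inner_conj_symm,
        inner_conj_symm, h1, h2, h3]
      ring
    · have h2 : (inner ℂ (P (D w)) (X w)).re = (inner ℂ (P (X w)) (D w)).re := by
        have h4 : inner ℂ (P (D w)) (X w) = inner ℂ (D w) (P (X w)) := hPs _ _
        rw [h4, ← inner_conj_symm, Complex.conj_re]
      change 0 ≤ (inner ℂ (F w) w).re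
      rw [hF1, Complex.sub_re, Complex.sub_re, h2]
      linarith [hineq w]
  have hF0 : 0 ≤ F := (ContinuousLinearMap.nonneg_iff_isPositive F).2 hFpos
  refine ⟨P, CFC.sqrt F, hP, (CFC.sqrt_nonneg F).isSelfAdjoint, fun w => ?_⟩
  have h1 : CFC.sqrt F (CFC.sqrt F w) = F w := by
    have := CFC.sqrt_mul_sqrt_self F hF0
    exact DFunLike.congr_fun this w
  rw [h1]
  simp only [F, sub_apply, ContinuousLinearMap.comp_apply]
  abel

/-- The storage identity along a trajectory. -/
theorem IsDissipative.isPrimitive_storage {X D : W →L[ℂ] E} {M : W →L[ℂ] W} {P : E →L[ℂ] E}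
    {Y : W →L[ℂ] W} (h : IsDissipative X D M P Y) {x f : ℝ → E} (hx : IsPrimitive x f) :
    IsPrimitive (fun t => (inner ℂ (P (x t)) (x t)).re)
      (fun t => 2 * (inner ℂ (P (x t)) (f t)).re) := by
  have h1 := (hx.clmC P).re_inner hx
  have h2 : ∀ t, (inner ℂ (P (f t)) (x t)).re + (inner ℂ (P (x t)) (f t)).re
      = 2 * (inner ℂ (P (x t)) (f t)).re := by
    intro t
    have h4 : inner ℂ (P (f t)) (x t) = inner ℂ (f t) (P (x t)) :=
      (ContinuousLinearMap.isSelfAdjoint_iff_isSymmetric.1 h.storage_selfAdjoint) _ _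
    rw [h4, ← inner_conj_symm, Complex.conj_re]
    ring
  simpa only [h2] using h1
end Controllable

/-! ### Consequences of minimal stability: positive storage and lossless motion -/

section Controllable

variable {E W : Type*} [NormedAddCommGroup E] [InnerProductSpace ℂ E] [FiniteDimensional ℂ E]
  [NormedAddCommGroup W] [InnerProductSpace ℂ W] [FiniteDimensional ℂ W]
  [CompleteSpace E] [CompleteSpace W]

/-- `w` is a trajectory of the descriptor system `d/dt (X w) = D w`. -/
structure IsBehavior (X D : W →L[ℂ] E) (w : ℝ → W) : Prop where
  isPrimitive : IsPrimitive (fun t => X (w t)) (fun t => D (w t))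
  locL2 : LocL2 w

/-- Minimal stability of the descriptor system `d/dt (X w) = D w` with supply rate `⟪M w, w⟫`. -/
def IsMinimallyStable (X D : W →L[ℂ] E) (M : W →L[ℂ] W) : Prop :=
  ∀ x₀ : E, ∃ w, IsBehavior X D w ∧ X (w 0) = x₀ ∧
    (∀ t : ℝ, 0 ≤ t → ∫ s in (0 : ℝ)..t, (inner ℂ (M (w s)) (w s)).re ≤ 0) ∧
    Tendsto (fun t => X (w t)) atTop (𝓝 0)

variable {X D : W →L[ℂ] E} {M : W →L[ℂ] W} {P : E →L[ℂ] E} {Y : W →L[ℂ] W}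

theorem IsDissipative.energy_balance (h : IsDissipative X D M P Y) {w : ℝ → W}
    (hw : IsBehavior X D w) {t : ℝ} (ht : 0 ≤ t) :
    ∫ s in (0 : ℝ)..t, (inner ℂ (M (w s)) (w s)).re =
      (inner ℂ (P (X (w t))) (X (w t))).re - (inner ℂ (P (X (w 0))) (X (w 0))).re
        + ∫ s in (0 : ℝ)..t, ‖Y (w s)‖ ^ 2 := by
  have h1 := h.isPrimitive_storage hw.isPrimitive
  have h2 := h1.eq t ht
  rw [h2, add_sub_cancel_left, ← intervalIntegral.integral_add (h1.integrable t ht)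
    ((hw.locL2.clm Y).sq ht)]
  refine intervalIntegral.integral_congr fun s _ => ?_
  simp only [h.re_inner_eq]
  ring

theorem IsDissipative.storage_le (h : IsDissipative X D M P Y) {w : ℝ → W}
    (hw : IsBehavior X D w)
    (hE : ∀ t : ℝ, 0 ≤ t → ∫ s in (0 : ℝ)..t, (inner ℂ (M (w s)) (w s)).re ≤ 0)
    {t : ℝ} (ht : 0 ≤ t) :
    (inner ℂ (P (X (w t))) (X (w t))).re + ∫ s in (0 : ℝ)..t, ‖Y (w s)‖ ^ 2
      ≤ (inner ℂ (P (X (w 0))) (X (w 0))).re := by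
  have := hE t ht
  rw [h.energy_balance hw ht] at this
  linarith

/-- Along a minimally stable trajectory the storage never exceeds its initial value, yet it
converges to its value at the origin, which is zero. -/
theorem IsDissipative.storage_nonneg (h : IsDissipative X D M P Y)
    (hmin : IsMinimallyStable X D M) (x : E) : 0 ≤ (inner ℂ (P x) x).re := by
  obtain ⟨w, hw, rfl, hE, hlim⟩ := hmin x
  have hc : Continuous fun y : E => (inner ℂ (P y) y).re := by fun_prop
  have h1 := (hc.tendsto 0).comp hlim
  rw [map_zero, inner_zero_left, Complex.zero_re] at h1
  refine le_of_tendsto h1 ?_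
  filter_upwards [eventually_ge_atTop 0] with t ht
  have h2 := h.storage_le hw hE ht
  have h3 : 0 ≤ ∫ s in (0 : ℝ)..t, ‖Y (w s)‖ ^ 2 :=
    intervalIntegral.integral_nonneg ht fun s _ => by positivity
  simp only [Function.comp_apply]
  linarith

/-- A nonnegative self-adjoint storage has a self-adjoint square root. -/
theorem IsDissipative.exists_sqrt_storage (h : IsDissipative X D M P Y)
    (hmin : IsMinimallyStable X D M) :
    ∃ S : E →L[ℂ] E, (∀ x, P x = S (S x)) ∧ ∀ x, ‖S x‖ ^ 2 = (inner ℂ (P x) x).re := by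
  have hP0 : 0 ≤ P := (ContinuousLinearMap.nonneg_iff_isPositive P).2
    (ContinuousLinearMap.isPositive_def.2
      ⟨ContinuousLinearMap.isSelfAdjoint_iff_isSymmetric.1 h.storage_selfAdjoint,
        fun x => h.storage_nonneg hmin x⟩)
  have hs : ∀ x, P x = CFC.sqrt P (CFC.sqrt P x) := fun x =>
    (DFunLike.congr_fun (CFC.sqrt_mul_sqrt_self P hP0) x).symm
  refine ⟨CFC.sqrt P, hs, fun x => ?_⟩
  have h1 : inner ℂ (CFC.sqrt P (CFC.sqrt P x)) x = inner ℂ (CFC.sqrt P x) (CFC.sqrt P x) :=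
    (ContinuousLinearMap.isSelfAdjoint_iff_isSymmetric.1 (CFC.sqrt_nonneg P).isSelfAdjoint) _ _
  rw [hs, h1, inner_self_eq_norm_sq_to_K]
  norm_cast

/-- From a state without storage there is a stable trajectory without storage and dissipation. -/
theorem IsDissipative.exists_lossless (h : IsDissipative X D M P Y)
    (hmin : IsMinimallyStable X D M) {x : E} (hx : P x = 0) :
    ∃ w, IsBehavior X D w ∧ X (w 0) = x ∧ Tendsto (fun t => X (w t)) atTop (𝓝 0) ∧
      (∀ t, 0 ≤ t → P (X (w t)) = 0) ∧
      ∀ t, 0 ≤ t → ∀ᵐ s ∂volume, s ∈ Set.Ioc 0 t → Y (w s) = 0 := by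
  obtain ⟨S, hS, hS2⟩ := h.exists_sqrt_storage hmin
  obtain ⟨w, hw, rfl, hE, hlim⟩ := hmin x
  have key : ∀ t, 0 ≤ t → (inner ℂ (P (X (w t))) (X (w t))).re = 0 ∧
      ∫ s in (0 : ℝ)..t, ‖Y (w s)‖ ^ 2 = 0 := by
    intro t ht
    have h2 := h.storage_le hw hE ht
    rw [hx, inner_zero_left, Complex.zero_re] at h2
    have h3 : 0 ≤ ∫ s in (0 : ℝ)..t, ‖Y (w s)‖ ^ 2 :=
      intervalIntegral.integral_nonneg ht fun s _ => by positivity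
    have h4 := h.storage_nonneg hmin (X (w t))
    constructor <;> linarith
  refine ⟨w, hw, rfl, hlim, fun t ht => ?_, fun t ht => ?_⟩
  · have h1 := (key t ht).1
    rw [← hS2, sq_eq_zero_iff, norm_eq_zero] at h1
    rw [hS, h1, map_zero]
  · have h1 := (key t ht).2
    have h2 := (hw.locL2.clm Y).sq ht
    rw [intervalIntegral.integral_eq_zero_iff_of_le_of_nonneg_ae ht
      (Eventually.of_forall fun s => by positivity) h2] at h1
    filter_upwards [(ae_restrict_iff' measurableSet_Ioc).1 h1] with s hs hs'
    have := hs hs'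
    simpa using this

/-- Viability of the kernel of the storage: every state in it admits an instantaneous input that
keeps the state in it without dissipation. -/
theorem IsDissipative.exists_viable (h : IsDissipative X D M P Y)
    (hmin : IsMinimallyStable X D M) {x : E} (hx : P x = 0) :
    ∃ w, X w = x ∧ P (D w) = 0 ∧ Y w = 0 := by
  obtain ⟨w, hw, rfl, -, hP, hY⟩ := h.exists_lossless hmin hx
  let V : Submodule ℂ W := LinearMap.ker (P ∘L D).toLinearMap ⊓ LinearMap.ker Y.toLinearMap
  let Z : Submodule ℂ E := V.map X.toLinearMap
  suffices hmem : X (w 0) ∈ Z by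
    obtain ⟨v, ⟨hv1, hv2⟩, hv⟩ := hmem
    exact ⟨v, hv, hv1, hv2⟩
  have hZ : IsClosed (Z : Set E) := Z.closed_of_finiteDimensional
  -- The losslessness of w holds only almost everywhere, so w is averaged over [0, τ]. D of the
  -- average is a difference quotient of X w and hence lies in ker P; letting τ → 0 uses that the
  -- finite-dimensional Z is closed.
  let avg : ℝ → W := fun τ => ((τ⁻¹ : ℝ) : ℂ) • ∫ s in (0 : ℝ)..τ, w s
  have hint : ∀ τ, 0 < τ → IntervalIntegrable w volume 0 τ := fun τ hτ =>
    hw.locL2.intervalIntegrable hτ.le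
  have hcomm : ∀ (L : W →L[ℂ] E) (τ : ℝ), 0 < τ →
      L (∫ s in (0 : ℝ)..τ, w s) = ∫ s in (0 : ℝ)..τ, L (w s) := fun L τ hτ =>
    (L.intervalIntegral_comp_comm (hint τ hτ)).symm
  have hXavg : ∀ τ, 0 < τ → X (avg τ) ∈ Z := by
    intro τ hτ
    refine ⟨avg τ, ⟨?_, ?_⟩, rfl⟩
    · change P (D (avg τ)) = 0
      have h1 : D (∫ s in (0 : ℝ)..τ, w s) = X (w τ) - X (w 0) := by
        rw [hcomm D τ hτ, hw.isPrimitive.eq_sub le_rfl hτ.le]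
      simp only [avg, map_smul, h1, map_sub, hP τ hτ.le, hP 0 le_rfl, sub_self, smul_zero]
    · change Y (avg τ) = 0
      have h1 : Y (∫ s in (0 : ℝ)..τ, w s) = 0 := by
        rw [← Y.intervalIntegral_comp_comm (hint τ hτ)]
        refine (intervalIntegral.integral_congr_ae (g := fun _ => (0 : W)) ?_).trans (by simp)
        rw [Set.uIoc_of_le hτ.le]
        exact hY τ hτ.le
      simp only [avg, map_smul, h1, smul_zero]
  have hlim : Tendsto (fun τ => X (avg τ)) (𝓝[>] 0) (𝓝 (X (w 0))) := by
    have hc := hw.isPrimitive.continuousOn zero_le_one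
    rw [Metric.tendsto_nhdsWithin_nhds]
    intro ε hε
    have hc0 := hc 0 ⟨le_rfl, zero_le_one⟩
    rw [Metric.continuousWithinAt_iff] at hc0
    obtain ⟨δ, hδ, hδ'⟩ := hc0 (ε / 2) (by positivity)
    refine ⟨min δ 1, by positivity, fun τ hτ hτδ => ?_⟩
    have hτ0 : (0 : ℝ) < τ := hτ
    rw [Real.dist_eq, sub_zero, abs_of_pos hτ0] at hτδ
    have e1 : X (avg τ) - X (w 0) = ((τ⁻¹ : ℝ) : ℂ) • ∫ s in (0 : ℝ)..τ, (X (w s) - X (w 0)) := by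
      have hXint : IntervalIntegrable (fun s => X (w s)) volume 0 τ :=
        (hw.locL2.clm X).intervalIntegrable hτ0.le
      rw [intervalIntegral.integral_sub hXint (by simp), intervalIntegral.integral_const,
        smul_sub, sub_zero, ← hcomm X τ hτ0, ← Complex.coe_smul τ, smul_smul,
        ← Complex.ofReal_mul, inv_mul_cancel₀ hτ0.ne', Complex.ofReal_one, one_smul]
      simp only [avg, map_smul]
    rw [dist_eq_norm, e1, norm_smul]
    have h2 : ‖∫ s in (0 : ℝ)..τ, (X (w s) - X (w 0))‖ ≤ ε / 2 * |τ - 0| := by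
      refine intervalIntegral.norm_integral_le_of_norm_le_const fun s hs => ?_
      rw [Set.uIoc_of_le hτ0.le] at hs
      rw [← dist_eq_norm]
      refine (hδ' ⟨hs.1.le, ?_⟩ ?_).le
      · linarith [hs.2, min_le_right δ 1]
      · rw [Real.dist_eq, sub_zero, abs_of_pos hs.1]
        linarith [hs.2, min_le_left δ 1]
    rw [sub_zero, abs_of_pos hτ0] at h2
    have h3 : ‖((τ⁻¹ : ℝ) : ℂ)‖ = τ⁻¹ := by
      rw [Complex.norm_real, Real.norm_eq_abs, abs_of_pos (inv_pos.2 hτ0)]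
    rw [h3]
    calc τ⁻¹ * ‖∫ s in (0 : ℝ)..τ, (X (w s) - X (w 0))‖ ≤ τ⁻¹ * (ε / 2 * τ) := by gcongr
      _ = ε / 2 := by field_simp
      _ < ε := by linarith
  refine hZ.mem_of_tendsto hlim ?_
  filter_upwards [self_mem_nhdsWithin] with τ hτ using hXavg τ hτ

/-- If no nonzero `w` at some frequency `c` is annihilated by `M`, then the input is determined by
the dissipation and the storage. -/
theorem IsDissipative.eq_zero_of_lossless (h : IsDissipative X D M P Y)
    (hmin : IsMinimallyStable X D M) {c : ℂ}
    (hdet : ∀ w, c • X w = D w → M w = 0 → w = 0) {w : W} (hX : X w = 0) (hD : P (D w) = 0)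
    (hY : Y w = 0) : w = 0 := by
  by_contra hne
  let N : Submodule ℂ E := LinearMap.ker P.toLinearMap
  let V : Submodule ℂ W := LinearMap.ker (P ∘L X).toLinearMap ⊓
    (LinearMap.ker (P ∘L D).toLinearMap ⊓ LinearMap.ker Y.toLinearMap)
  -- By viability X maps V onto N = ker P. A nonzero w as assumed lies in its kernel, so dim V > dim
  -- N and the pencil c X - D from V to N is singular for every c. A kernel vector is annihilated by
  -- M because P X, P D and Y vanish on it.
  let XV : V →ₗ[ℂ] N := (X.toLinearMap ∘ₗ V.subtype).codRestrict N fun v => v.2.1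
  have hsurj : Function.Surjective XV := by
    rintro ⟨x, hx⟩
    obtain ⟨v, hv1, hv2, hv3⟩ := h.exists_viable hmin (x := x) hx
    refine ⟨⟨v, ?_, hv2, hv3⟩, Subtype.ext hv1⟩
    change P (X v) = 0
    rw [hv1]; exact hx
  have hker : LinearMap.ker XV ≠ ⊥ := by
    intro hbot
    have hwV : w ∈ V := ⟨by change P (X w) = 0; rw [hX, map_zero], hD, hY⟩
    have h1 : (⟨w, hwV⟩ : V) ∈ LinearMap.ker XV := Subtype.ext hX
    rw [hbot] at h1
    exact hne (congrArg Subtype.val h1)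
  have hrank := XV.finrank_range_add_finrank_ker
  rw [LinearMap.range_eq_top.2 hsurj, finrank_top] at hrank
  have hpos : 0 < Module.finrank ℂ (LinearMap.ker XV) :=
    Nat.pos_of_ne_zero fun h0 => hker (Submodule.finrank_eq_zero.1 h0)
  let DV : V →ₗ[ℂ] N := (D.toLinearMap ∘ₗ V.subtype).codRestrict N fun v => v.2.2.1
  obtain ⟨v, hv, hv0⟩ := Submodule.exists_mem_ne_zero_of_ne_bot
    (LinearMap.ker_ne_bot_of_finrank_lt (f := c • XV - DV) (by omega))
  have hv1 : c • X (v : W) = D (v : W) := by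
    have h1 : (c • XV - DV) v = 0 := hv
    have h2 := congrArg Subtype.val h1
    exact sub_eq_zero.1 h2
  refine hv0 (Subtype.ext (hdet v hv1 ?_))
  have e1 : P (X (v : W)) = 0 := v.2.1
  have e2 : P (D (v : W)) = 0 := v.2.2.1
  have e3 : Y (v : W) = 0 := v.2.2.2
  rw [h.supply_eq, e1, e2, e3]
  simp

end Controllable

/-! ### Bounding the state component in the kernel of the storage -/

section Controllable

variable {E W : Type*} [NormedAddCommGroup E] [InnerProductSpace ℂ E] [FiniteDimensional ℂ E]
  [NormedAddCommGroup W] [InnerProductSpace ℂ W] [FiniteDimensional ℂ W]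
  [CompleteSpace E] [CompleteSpace W]

variable {X D : W →L[ℂ] E} {M : W →L[ℂ] W} {P : E →L[ℂ] E} {Y : W →L[ℂ] W}

/-- Input-to-state bound: the state is controlled by its storage part, the dissipation and the
external forcing. -/
theorem IsDissipative.exists_state_bound (h : IsDissipative X D M P Y)
    (hmin : IsMinimallyStable X D M)
    (hinj : ∀ w, X w = 0 → P (D w) = 0 → Y w = 0 → w = 0) :
    ∃ C : ℝ, 0 < C ∧ ∀ (w : ℝ → W) (g : ℝ → E) (t p a b : ℝ), 0 ≤ t → 0 ≤ p → 0 ≤ a → 0 < b →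
      IsPrimitive (fun s => X (w s)) (fun s => D (w s) + g s) → LocL2 w →
      (∀ s ∈ Set.Icc 0 t, ‖P (X (w s))‖ ≤ p) → (∀ s ∈ Set.Icc 0 t, ‖g s‖ ≤ a) →
      ∫ s in (0 : ℝ)..t, ‖Y (w s)‖ ^ 2 ≤ b ^ 2 →
      ‖X (w t)‖ ≤ C * (‖X (w 0)‖ + p + a + b) := by
  let N : Submodule ℂ E := LinearMap.ker P.toLinearMap
  -- K₀ is the set of velocities produced by inputs invisible to both X and Y. It meets ker P
  -- trivially by `hinj`, so the projection Γ onto ker P can be chosen to kill it; then Γ D w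
  -- depends only on X w and Y w.
  let K₀ : Submodule ℂ E := (LinearMap.ker X.toLinearMap ⊓ LinearMap.ker Y.toLinearMap).map
    D.toLinearMap
  have hdisj : Disjoint K₀ N := by
    rw [Submodule.disjoint_def]
    rintro _ ⟨w, ⟨hw1, hw2⟩, rfl⟩ hw3
    change D w = 0
    rw [hinj w hw1 hw3 hw2, map_zero]
  obtain ⟨N', hN', hcompl⟩ := hdisj.exists_isCompl
  let Γ' : E →ₗ[ℂ] N := N.projectionOnto N' hcompl.symm
  let Γ : E →L[ℂ] N := LinearMap.toContinuousLinearMap Γ'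
  have hΓN : ∀ n : N, Γ n = n := fun n => Submodule.projectionOnto_apply_left hcompl.symm n
  have hΓ0 : ∀ w, X w = 0 → Y w = 0 → Γ (D w) = 0 := fun w h1 h2 =>
    (Submodule.projectionOnto_apply_eq_zero_iff hcompl.symm).2 (hN' ⟨w, ⟨h1, h2⟩, rfl⟩)
  obtain ⟨J, hJ⟩ := exists_factor_of_ker_le (X.toLinearMap.prod Y.toLinearMap)
    (Γ.toLinearMap ∘ₗ D.toLinearMap) (fun w hw => by
      have h1 : (X w, Y w) = (0, 0) := hw
      rw [Prod.mk.injEq] at h1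
      exact hΓ0 w h1.1 h1.2)
  let J₁ : E →L[ℂ] N := LinearMap.toContinuousLinearMap (J ∘ₗ LinearMap.inl ℂ E W)
  let J₂ : W →L[ℂ] N := LinearMap.toContinuousLinearMap (J ∘ₗ LinearMap.inr ℂ E W)
  have hΓD : ∀ w, Γ (D w) = J₁ (X w) + J₂ (Y w) := by
    intro w
    have h1 : J (X w, Y w) = Γ (D w) := hJ w
    rw [← h1]
    change _ = J (X w, 0) + J (0, Y w)
    rw [← map_add, Prod.mk_add_mk, add_zero, zero_add]
  -- The part of x outside Γ x vanishes on ker P, hence is a linear function of P x.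
  obtain ⟨R', hR'⟩ := exists_factor_of_ker_le P.toLinearMap
    (LinearMap.id - N.subtype ∘ₗ Γ.toLinearMap) (fun x hx => by
      have h1 : (Γ x : E) = x := congrArg Subtype.val (hΓN ⟨x, hx⟩)
      simp [h1])
  let R : E →L[ℂ] E := LinearMap.toContinuousLinearMap R'
  have hR : ∀ x, x = (Γ x : E) + R (P x) := by
    intro x
    have h1 : R (P x) = x - Γ x := hR' x
    rw [h1]; abel
  let H : N →L[ℝ] N := (J₁ ∘L N.subtypeL).restrictScalars ℝ
  have hH : ∀ n : N, H n = J₁ (n : E) := fun _ => rfl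
  -- A lossless trajectory from n stays in ker P with Y w = 0 almost everywhere, so it solves z' = H
  -- z exactly, and minimal stability sends it to zero.
  have hstab : ∀ n, Tendsto (fun t => expSemigroup H t n) atTop (𝓝 0) := by
    intro n
    obtain ⟨w, hw, hw0, hlim, hP, hY⟩ := h.exists_lossless hmin (x := (n : E)) n.2
    have h1 := (hw.isPrimitive.clmC Γ).congr_ae (g := fun s => H (Γ (X (w s)))) (fun t ht => by
      filter_upwards [hY t ht] with s hs hst
      rw [hΓD, hs hst, map_zero, add_zero, hH]
      congr 1
      have := hR (X (w s))
      rw [hP s hst.1.le, map_zero, add_zero] at this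
      exact this)
    have h2 : Tendsto (fun t => Γ (X (w t))) atTop (𝓝 0) := by
      have := (Γ.continuous.tendsto 0).comp hlim
      simpa [Function.comp_def] using this
    refine h2.congr' ?_
    filter_upwards [eventually_ge_atTop 0] with t ht
    rw [h1.eq_expSemigroup ht, hw0, hΓN]
  obtain ⟨C, hC, hbound⟩ := exists_stable_bound hstab
  have hCpos : 0 < C * (‖Γ‖ + ‖J₁‖ * ‖R‖ + ‖Γ‖ + ‖J₂‖ + 1) + ‖R‖ := by positivity
  refine ⟨_, hCpos, fun w g t p a b ht hp ha hb hx hw hPp hga hYb => ?_⟩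
  have hz : IsPrimitive (fun s => Γ (X (w s)))
      (fun s => H (Γ (X (w s))) + ((J₁ (R (P (X (w s)))) + Γ (g s)) + J₂ (Y (w s)))) := by
    have h1 := hx.clmC Γ
    have h2 : ∀ s, Γ (D (w s) + g s)
        = H (Γ (X (w s))) + ((J₁ (R (P (X (w s)))) + Γ (g s)) + J₂ (Y (w s))) := by
      intro s
      have h3 : J₁ (X (w s)) = H (Γ (X (w s))) + J₁ (R (P (X (w s)))) := by
        conv_lhs => rw [hR (X (w s))]
        rw [map_add]; rfl
      rw [map_add, hΓD, h3]
      abel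
    simpa only [h2] using h1
  have hJ₂ : ∀ s, ‖J₂ (Y (w s))‖ ^ 2 ≤ ‖J₂‖ ^ 2 * ‖Y (w s)‖ ^ 2 := fun s => by
    rw [← mul_pow]
    exact pow_le_pow_left₀ (norm_nonneg _) (J₂.le_opNorm _) 2
  have hb2 : ∫ s in (0 : ℝ)..t, ‖J₂ (Y (w s))‖ ^ 2 ≤ ((‖J₂‖ + 1) * b) ^ 2 := by
    calc _ ≤ ∫ s in (0 : ℝ)..t, ‖J₂‖ ^ 2 * ‖Y (w s)‖ ^ 2 :=
          intervalIntegral.integral_mono_on ht (((hw.clm Y).clm J₂).sq ht)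
            (((hw.clm Y).sq ht).const_mul _) fun s _ => hJ₂ s
      _ = ‖J₂‖ ^ 2 * ∫ s in (0 : ℝ)..t, ‖Y (w s)‖ ^ 2 := intervalIntegral.integral_const_mul _ _
      _ ≤ ‖J₂‖ ^ 2 * b ^ 2 := by gcongr
      _ ≤ _ := by
        rw [← mul_pow]
        gcongr
        linarith
  have hmain := hbound _ _ _ t (‖J₁‖ * ‖R‖ * p + ‖Γ‖ * a) ((‖J₂‖ + 1) * b) ht (by positivity)
    (by positivity) hz (fun s hs => by
      refine (norm_add_le _ _).trans (add_le_add ?_ ?_)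
      · calc ‖J₁ (R (P (X (w s))))‖ ≤ ‖J₁‖ * ‖R (P (X (w s)))‖ := J₁.le_opNorm _
          _ ≤ ‖J₁‖ * (‖R‖ * ‖P (X (w s))‖) := by gcongr; exact R.le_opNorm _
          _ ≤ ‖J₁‖ * (‖R‖ * p) := by gcongr; exact hPp s hs
          _ = _ := by ring
      · refine (Γ.le_opNorm _).trans ?_
        gcongr
        exact hga s hs) (((hw.clm Y).clm J₂).sq ht) hb2
  have hx0 : ‖Γ (X (w 0))‖ ≤ ‖Γ‖ * ‖X (w 0)‖ := Γ.le_opNorm _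
  have hxt : ‖X (w t)‖ ≤ ‖Γ (X (w t))‖ + ‖R‖ * p := by
    conv_lhs => rw [hR (X (w t))]
    refine (norm_add_le _ _).trans (add_le_add le_rfl ((R.le_opNorm _).trans ?_))
    gcongr
    exact hPp t ⟨ht, le_rfl⟩
  have h1 : C * (‖Γ (X (w 0))‖ + (‖J₁‖ * ‖R‖ * p + ‖Γ‖ * a) + (‖J₂‖ + 1) * b)
      ≤ C * (‖Γ‖ * ‖X (w 0)‖ + (‖J₁‖ * ‖R‖ * p + ‖Γ‖ * a) + (‖J₂‖ + 1) * b) := by gcongr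
  refine hxt.trans ((add_le_add (hmain.trans h1) le_rfl).trans ?_)
  set γ := ‖Γ‖
  set j := ‖J₁‖ * ‖R‖
  have e1 : 0 ≤ C * ((j + γ + ‖J₂‖ + 1) * ‖X (w 0)‖ + (γ + γ + ‖J₂‖ + 1) * p
      + (γ + j + ‖J₂‖ + 1) * a + (γ + j + γ) * b) + ‖R‖ * (‖X (w 0)‖ + a + b) := by positivity
  linarith [e1, show (C * (γ + j + γ + ‖J₂‖ + 1) + ‖R‖) * (‖X (w 0)‖ + p + a + b)
    - (C * (γ * ‖X (w 0)‖ + (j * p + γ * a) + (‖J₂‖ + 1) * b) + ‖R‖ * p)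
    = C * ((j + γ + ‖J₂‖ + 1) * ‖X (w 0)‖ + (γ + γ + ‖J₂‖ + 1) * p
      + (γ + j + ‖J₂‖ + 1) * a + (γ + j + γ) * b) + ‖R‖ * (‖X (w 0)‖ + a + b) by ring]

end Controllable

/-! ### Energy estimates in the presence of an external decaying signal -/

section Controllable

variable {E W Eᵤ : Type*} [NormedAddCommGroup E] [InnerProductSpace ℂ E] [FiniteDimensional ℂ E]
  [NormedAddCommGroup W] [InnerProductSpace ℂ W] [FiniteDimensional ℂ W]
  [NormedAddCommGroup Eᵤ] [InnerProductSpace ℂ Eᵤ] [FiniteDimensional ℂ Eᵤ]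
  [CompleteSpace E] [CompleteSpace W] [CompleteSpace Eᵤ]

variable {X D : W →L[ℂ] E} {M : W →L[ℂ] W} {P : E →L[ℂ] E} {Y : W →L[ℂ] W}

theorem abs_re_inner_le {F : Type*} [NormedAddCommGroup F] [InnerProductSpace ℂ F] (a b : F) :
    |(inner ℂ a b).re| ≤ ‖a‖ * ‖b‖ :=
  (Complex.abs_re_le_norm _).trans (norm_inner_le_norm a b)

/-- Pointwise dissipation inequality for the system driven by an external state `e`, with a storage
function that contains a cross term in `e`. -/
theorem IsDissipative.exists_cross_storage (h : IsDissipative X D M P Y)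
    (hinj : ∀ w, X w = 0 → D w = 0 → Y w = 0 → w = 0)
    (H : Eᵤ →L[ℂ] Eᵤ) (G : Eᵤ →L[ℂ] E) (k : Eᵤ →L[ℂ] W) (n : Eᵤ →L[ℂ] Eᵤ) :
    ∃ (c : Eᵤ →L[ℂ] E) (κ : ℝ), 0 ≤ κ ∧ ∀ w e,
      1 / 2 * ‖Y w‖ ^ 2 + (2 * (inner ℂ (P (X w)) (D w + G e)).re
        + 2 * ((inner ℂ (c (H e)) (X w)).re + (inner ℂ (c e) (D w + G e)).re))
      ≤ (inner ℂ (M w) w).re + 2 * (inner ℂ (k e) w).re + (inner ℂ (n e) e).re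
        + κ * (‖e‖ ^ 2 + ‖e‖ * ‖X w‖) := by
  -- Since w is a linear function of X w, D w and Y w, the cross term ⟪k e, w⟫ splits in three. The
  -- D w part belongs to the derivative of ⟪c₂ e, x⟫ and moves into the storage, the X w part goes
  -- into κ, and the Y w part costs half of ‖Y w‖².
  obtain ⟨ℓ, hℓ⟩ := exists_factor_of_ker_le
    (X.toLinearMap.prod (D.toLinearMap.prod Y.toLinearMap)) (LinearMap.id : W →ₗ[ℂ] W)
    (fun w hw => by
      have h1 : (X w, D w, Y w) = (0, 0, 0) := hw
      simp only [Prod.mk.injEq] at h1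
      exact hinj w h1.1 h1.2.1 h1.2.2)
  let a₁ : E →L[ℂ] W := LinearMap.toContinuousLinearMap (ℓ ∘ₗ LinearMap.inl ℂ E (E × W))
  let a₂ : E →L[ℂ] W := LinearMap.toContinuousLinearMap
    (ℓ ∘ₗ LinearMap.inr ℂ E (E × W) ∘ₗ LinearMap.inl ℂ E W)
  let a₃ : W →L[ℂ] W := LinearMap.toContinuousLinearMap
    (ℓ ∘ₗ LinearMap.inr ℂ E (E × W) ∘ₗ LinearMap.inr ℂ E W)
  have ha : ∀ w, w = a₁ (X w) + a₂ (D w) + a₃ (Y w) := by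
    intro w
    have h1 : ℓ (X w, D w, Y w) = w := hℓ w
    have h2 : a₁ (X w) + a₂ (D w) + a₃ (Y w) = ℓ (X w, 0, 0) + ℓ (0, D w, 0) + ℓ (0, 0, Y w) := rfl
    rw [h2, ← map_add, ← map_add]
    simp [h1]
  let c₁ : Eᵤ →L[ℂ] E := a₁.adjoint ∘L k
  let c₂ : Eᵤ →L[ℂ] E := a₂.adjoint ∘L k
  let c₃ : Eᵤ →L[ℂ] W := a₃.adjoint ∘L k
  have hk : ∀ e w, (inner ℂ (k e) w).re = (inner ℂ (c₁ e) (X w)).re + (inner ℂ (c₂ e) (D w)).re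
      + (inner ℂ (c₃ e) (Y w)).re := by
    intro e w
    conv_lhs => rw [ha w]
    simp only [c₁, c₂, c₃, ContinuousLinearMap.comp_apply, ContinuousLinearMap.adjoint_inner_left,
      inner_add_right, Complex.add_re]
  refine ⟨c₂, 2 * ‖c₁‖ + 2 * ‖c₃‖ ^ 2 + ‖n‖ + 2 * ‖P‖ * ‖G‖ + 2 * ‖c₂‖ * ‖H‖ + 2 * ‖c₂‖ * ‖G‖,
    by positivity, fun w e => ?_⟩
  rw [h.re_inner_eq, hk]
  simp only [inner_add_right, Complex.add_re]
  have b1 : -(‖c₁‖ * (‖e‖ * ‖X w‖)) ≤ (inner ℂ (c₁ e) (X w)).re := by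
    have h1 : ‖c₁ e‖ * ‖X w‖ ≤ ‖c₁‖ * ‖e‖ * ‖X w‖ := by gcongr; exact c₁.le_opNorm e
    have := abs_le.1 (abs_re_inner_le (c₁ e) (X w))
    linarith
  -- The weight 1/4 becomes 1/2 after doubling, which is exactly the dissipation given up in the
  -- statement.
  have b3 : -(‖c₃‖ ^ 2 * ‖e‖ ^ 2 + 1 / 4 * ‖Y w‖ ^ 2) ≤ (inner ℂ (c₃ e) (Y w)).re := by
    have h1 : ‖c₃ e‖ * ‖Y w‖ ≤ ‖c₃‖ * ‖e‖ * ‖Y w‖ := by gcongr; exact c₃.le_opNorm e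
    have := abs_le.1 (abs_re_inner_le (c₃ e) (Y w))
    nlinarith [sq_nonneg (‖c₃‖ * ‖e‖ - 1 / 2 * ‖Y w‖)]
  have bn : -(‖n‖ * ‖e‖ ^ 2) ≤ (inner ℂ (n e) e).re := by
    have h1 : ‖n e‖ * ‖e‖ ≤ ‖n‖ * ‖e‖ * ‖e‖ := by gcongr; exact n.le_opNorm e
    have := abs_le.1 (abs_re_inner_le (n e) e)
    nlinarith
  have bP : (inner ℂ (P (X w)) (G e)).re ≤ ‖P‖ * ‖G‖ * (‖e‖ * ‖X w‖) := by
    have h1 : ‖P (X w)‖ * ‖G e‖ ≤ (‖P‖ * ‖X w‖) * (‖G‖ * ‖e‖) := by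
      gcongr
      · exact P.le_opNorm _
      · exact G.le_opNorm _
    have := abs_le.1 (abs_re_inner_le (P (X w)) (G e))
    linarith
  have bH : (inner ℂ (c₂ (H e)) (X w)).re ≤ ‖c₂‖ * ‖H‖ * (‖e‖ * ‖X w‖) := by
    have h1 : ‖c₂ (H e)‖ * ‖X w‖ ≤ (‖c₂‖ * (‖H‖ * ‖e‖)) * ‖X w‖ := by
      gcongr
      exact (c₂.le_opNorm _).trans (by gcongr; exact H.le_opNorm _)
    have := abs_le.1 (abs_re_inner_le (c₂ (H e)) (X w))
    linarith
  have bG : (inner ℂ (c₂ e) (G e)).re ≤ ‖c₂‖ * ‖G‖ * ‖e‖ ^ 2 := by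
    have h1 : ‖c₂ e‖ * ‖G e‖ ≤ (‖c₂‖ * ‖e‖) * (‖G‖ * ‖e‖) := by
      gcongr
      · exact c₂.le_opNorm _
      · exact G.le_opNorm _
    have := abs_le.1 (abs_re_inner_le (c₂ e) (G e))
    nlinarith
  have hex : 0 ≤ ‖e‖ * ‖X w‖ := by positivity
  have p1 : 0 ≤ (2 * ‖c₃‖ ^ 2 + ‖n‖ + 2 * ‖c₂‖ * ‖G‖) * (‖e‖ * ‖X w‖) := by positivity
  have p2 : 0 ≤ (2 * ‖c₁‖ + 2 * ‖P‖ * ‖G‖ + 2 * ‖c₂‖ * ‖H‖) * ‖e‖ ^ 2 := by positivity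
  linarith

/-- Squaring yields m² ≤ C₄ (a + β)² + C₄ (a + β) m, and a quadratic inequality of this type bounds
m by a multiple of a + β. This closes the loop when the bound on a maximum m involves m itself. -/
theorem le_of_le_mul_add_sqrt {C₃ κ₁ a β m b : ℝ} (hκ₁0 : 0 ≤ κ₁)
    (ha0 : 0 ≤ a) (hβ : 0 < β) (hm0 : 0 ≤ m) (hb2 : b ^ 2 = 2 * (β ^ 2 + κ₁ * (a ^ 2 + a * m)))
    (hmb : m ≤ C₃ * (a + b)) : m ≤ (2 * C₃ ^ 2 * (3 + 2 * κ₁) + 1) * (a + β) := by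
  set C₄ := 2 * C₃ ^ 2 * (3 + 2 * κ₁) with hC₄
  have hC₄0 : 0 ≤ C₄ := by positivity
  have hm2 : m ^ 2 ≤ C₄ * (a + β) ^ 2 + C₄ * (a + β) * m := by
    have h1 : m ^ 2 ≤ (C₃ * (a + b)) ^ 2 := by gcongr
    have h2 : (a + b) ^ 2 ≤ 2 * a ^ 2 + 2 * b ^ 2 := by nlinarith [sq_nonneg (a - b)]
    have h3 : m ^ 2 ≤ C₃ ^ 2 * (2 * a ^ 2 + 2 * b ^ 2) := by
      rw [mul_pow] at h1
      exact h1.trans (by gcongr)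
    rw [hb2] at h3
    have p2 : 0 ≤ 2 * C₃ ^ 2 * (2 * a ^ 2 + (1 + 2 * κ₁) * β ^ 2 + 2 * a * β
      + (3 + 2 * κ₁) * (β * m) + 3 * (a * m) + (4 + 4 * κ₁) * (a * β)) := by positivity
    have e1 : C₄ * (a + β) ^ 2 + C₄ * (a + β) * m
        - C₃ ^ 2 * (2 * a ^ 2 + 2 * (2 * (β ^ 2 + κ₁ * (a ^ 2 + a * m))))
        = 2 * C₃ ^ 2 * (2 * a ^ 2 + (1 + 2 * κ₁) * β ^ 2 + 2 * a * β
      + (3 + 2 * κ₁) * (β * m) + 3 * (a * m) + (4 + 4 * κ₁) * (a * β)) := by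
      rw [hC₄]; ring
    linarith
  have hfinal : m ≤ (C₄ + 1) * (a + β) := by
    by_contra! hcon
    have hs : 0 < a + β := by positivity
    have h1 : C₄ * (a + β) * ((C₄ + 1) * (a + β)) ≤ C₄ * (a + β) * m :=
      mul_le_mul_of_nonneg_left hcon.le (by positivity)
    have h2 : (C₄ + 1) * (a + β) * m < m * m := by
      have : 0 < m := lt_of_le_of_lt (by positivity) hcon
      exact mul_lt_mul_of_pos_right hcon this
    have h3 : (a + β) * ((C₄ + 1) * (a + β)) ≤ (a + β) * m :=
      mul_le_mul_of_nonneg_left hcon.le hs.le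
    nlinarith [sq_nonneg (a + β)]
  exact hfinal

set_option maxHeartbeats 800000 in
/-- Energy bounds give state bounds for the system driven by a stable external state `e`. -/
theorem IsDissipative.exists_bound_of_energy_le (h : IsDissipative X D M P Y)
    (hmin : IsMinimallyStable X D M)
    (hinj : ∀ w, X w = 0 → P (D w) = 0 → Y w = 0 → w = 0)
    (H : Eᵤ →L[ℂ] Eᵤ)
    (hH : ∀ e, Tendsto (fun t => expSemigroup (H.restrictScalars ℝ) t e) atTop (𝓝 0))
    (G : Eᵤ →L[ℂ] E) (k : Eᵤ →L[ℂ] W) (n : Eᵤ →L[ℂ] Eᵤ) :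
    ∃ C : ℝ, 0 < C ∧ ∀ (w : ℝ → W) (e : ℝ → Eᵤ) (β : ℝ), 0 < β →
      IsPrimitive e (fun s => H (e s)) →
      IsPrimitive (fun s => X (w s)) (fun s => D (w s) + G (e s)) → LocL2 w →
      (∀ t, 0 ≤ t → ∫ s in (0 : ℝ)..t, ((inner ℂ (M (w s)) (w s)).re
        + 2 * (inner ℂ (k (e s)) (w s)).re + (inner ℂ (n (e s)) (e s)).re) ≤ β ^ 2) →
      ∀ t, 0 ≤ t → ‖X (w t)‖ ≤ C * (‖X (w 0)‖ + ‖e 0‖ + β) := by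
  obtain ⟨S, hS, hS2⟩ := h.exists_sqrt_storage hmin
  obtain ⟨C₁, hC₁, hstate⟩ := h.exists_state_bound hmin hinj
  obtain ⟨C₂, α, hC₂, hα, hdecay⟩ := exists_expSemigroup_decay hH
  obtain ⟨c, κ, hκ, hineq⟩ := h.exists_cross_storage
    (fun w h1 h2 h3 => hinj w h1 (by rw [h2, map_zero]) h3) H G k n
  -- constants in the integrated dissipation inequality
  set κ₁ := κ * (C₂ ^ 2 + C₂) * (1 / α) + 2 * ‖c‖ * C₂ + ‖P‖ + 2 * ‖c‖ with hκ₁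
  have hκ₁0 : 0 ≤ κ₁ := by positivity
  set C₃ := C₁ * (1 + ‖G‖ * C₂ + (‖S‖ + 1)) with hC₃
  have hC₃0 : 0 < C₃ := by positivity
  refine ⟨2 * C₃ ^ 2 * (3 + 2 * κ₁) + 1, by positivity, fun w e β hβ he hx hw hE T hT => ?_⟩
  set a := ‖X (w 0)‖ + ‖e 0‖ with ha
  have ha0 : 0 ≤ a := by positivity
  have hxc := hx.continuousOn hT
  -- The cross terms between e and x need an a priori bound on the state, so the estimate is run up
  -- to the time τ where ‖X w‖ is maximal on [0, T], with the maximum m as an unknown.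
  obtain ⟨τ, hτ, hmax⟩ := isCompact_Icc.exists_isMaxOn ⟨0, le_rfl, hT⟩ hxc.norm
  set m := ‖X (w τ)‖ with hm
  have hm' : ∀ s ∈ Set.Icc 0 τ, ‖X (w s)‖ ≤ m := fun s hs => hmax ⟨hs.1, hs.2.trans hτ.2⟩
  have hm0 : 0 ≤ m := norm_nonneg _
  have hx0m : ‖X (w 0)‖ ≤ m := hm' 0 ⟨le_rfl, hτ.1⟩
  have he' : ∀ s, 0 ≤ s → ‖e s‖ ≤ C₂ * ‖e 0‖ * Real.exp (-α * s) := by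
    intro s hs
    rw [IsPrimitive.eq_expSemigroup (H := H.restrictScalars ℝ) he hs]
    refine (ContinuousLinearMap.le_opNorm _ _).trans ?_
    calc _ ≤ (C₂ * Real.exp (-α * s)) * ‖e 0‖ := by gcongr; exact hdecay s hs
      _ = _ := by ring
  have hexp1 : ∀ s, 0 ≤ s → Real.exp (-α * s) ≤ 1 := fun s hs =>
    Real.exp_le_one_iff.2 (by nlinarith)
  have he1 : ∀ s, 0 ≤ s → ‖e s‖ ≤ C₂ * ‖e 0‖ := fun s hs =>
    (he' s hs).trans (mul_le_of_le_one_right (by positivity) (hexp1 s hs))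
  have hea : ‖e 0‖ ≤ a := by simp only [ha]; linarith [norm_nonneg (X (w 0))]
  have hxa : ‖X (w 0)‖ ≤ a := by simp only [ha]; linarith [norm_nonneg (e 0)]
  -- the storage function along the trajectory
  have hV := (h.isPrimitive_storage hx).add (((he.clmC c).re_inner hx).clm
    ((2 : ℝ) • ContinuousLinearMap.id ℝ ℝ))
  -- The exponential decay of e makes the accumulated cross terms finite uniformly in t, whence the
  -- factor 1/α; m enters only linearly.
  have hI1 : ∀ t ∈ Set.Icc 0 τ, ‖S (X (w t))‖ ^ 2 + 1 / 2 * ∫ s in (0 : ℝ)..t, ‖Y (w s)‖ ^ 2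
      ≤ β ^ 2 + κ₁ * (a ^ 2 + a * m) := by
    intro t ht
    have hVt := hV.eq t ht.1
    have hY2 := (hw.clm Y).sq ht.1
    have hσi : IntervalIntegrable (fun s => (inner ℂ (M (w s)) (w s)).re
        + 2 * (inner ℂ (k (e s)) (w s)).re + (inner ℂ (n (e s)) (e s)).re) volume 0 t :=
      (((hw.clm M).re_inner hw ht.1).add (((he.locL2.clm k).re_inner hw ht.1).const_mul 2)).add
        ((he.locL2.clm n).re_inner he.locL2 ht.1)
    have hei : IntervalIntegrable (fun s => κ * (C₂ ^ 2 + C₂) * (a ^ 2 + a * m) * Real.exp (-α * s))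
        volume 0 t := (by fun_prop : Continuous fun s =>
          κ * (C₂ ^ 2 + C₂) * (a ^ 2 + a * m) * Real.exp (-α * s)).intervalIntegrable _ _
    have hmono := intervalIntegral.integral_mono_on ht.1
      ((hY2.const_mul (1 / 2)).add (hV.integrable t ht.1)) (hσi.add hei) (fun s hs => by
        have h1 := hineq (w s) (e s)
        have h2 : ‖e s‖ ^ 2 + ‖e s‖ * ‖X (w s)‖
            ≤ (C₂ ^ 2 + C₂) * (a ^ 2 + a * m) * Real.exp (-α * s) := by
          have h3 := he' s hs.1
          have h4 := he1 s hs.1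
          have h5 := hm' s ⟨hs.1, hs.2.trans ht.2⟩
          have hex := Real.exp_pos (-α * s)
          have h6 : ‖e s‖ ^ 2 ≤ C₂ ^ 2 * a ^ 2 * Real.exp (-α * s) := by
            calc ‖e s‖ ^ 2 = ‖e s‖ * ‖e s‖ := sq _
              _ ≤ (C₂ * ‖e 0‖ * Real.exp (-α * s)) * (C₂ * ‖e 0‖) := by gcongr
              _ ≤ (C₂ * a * Real.exp (-α * s)) * (C₂ * a) := by gcongr
              _ = _ := by ring
          have h7 : ‖e s‖ * ‖X (w s)‖ ≤ C₂ * (a * m) * Real.exp (-α * s) := by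
            calc _ ≤ (C₂ * ‖e 0‖ * Real.exp (-α * s)) * m := by gcongr
              _ ≤ (C₂ * a * Real.exp (-α * s)) * m := by gcongr
              _ = _ := by ring
          have h8 : 0 ≤ (C₂ ^ 2 * (a * m) + C₂ * a ^ 2) * Real.exp (-α * s) := by positivity
          linarith
        have h9 := mul_le_mul_of_nonneg_left h2 hκ
        change 1 / 2 * ‖Y (w s)‖ ^ 2 + (2 * (inner ℂ (P (X (w s))) (D (w s) + G (e s))).re
          + 2 * ((inner ℂ (c (H (e s))) (X (w s))).re
            + (inner ℂ (c (e s)) (D (w s) + G (e s))).re)) ≤ _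
        refine h1.trans ?_
        linarith)
    rw [intervalIntegral.integral_add (hY2.const_mul _) (hV.integrable t ht.1),
      intervalIntegral.integral_add hσi hei, intervalIntegral.integral_const_mul,
      intervalIntegral.integral_const_mul] at hmono
    have hexpI := integral_exp_neg_mul_le hα t
    have hEt := hE t ht.1
    have hbig : κ * (C₂ ^ 2 + C₂) * (a ^ 2 + a * m) * ∫ s in (0 : ℝ)..t, Real.exp (-α * s)
        ≤ κ * (C₂ ^ 2 + C₂) * (a ^ 2 + a * m) * (1 / α) := by gcongr
    have hV' : (inner ℂ (P (X (w t))) (X (w t))).re + 2 * (inner ℂ (c (e t)) (X (w t))).re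
        = (inner ℂ (P (X (w 0))) (X (w 0))).re + 2 * (inner ℂ (c (e 0)) (X (w 0))).re
          + ∫ s in (0 : ℝ)..t, _ := hVt
    have hcross : -(‖c‖ * C₂ * (a * m)) ≤ (inner ℂ (c (e t)) (X (w t))).re := by
      have h1 : ‖c (e t)‖ * ‖X (w t)‖ ≤ (‖c‖ * (C₂ * a)) * m := by
        gcongr
        · refine (c.le_opNorm _).trans ?_
          gcongr
          exact (he1 t ht.1).trans (by gcongr)
        · exact hm' t ht
      have := abs_le.1 (abs_re_inner_le (c (e t)) (X (w t)))
      linarith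
    have hcross0 : (inner ℂ (c (e 0)) (X (w 0))).re ≤ ‖c‖ * a ^ 2 := by
      have h1 : ‖c (e 0)‖ * ‖X (w 0)‖ ≤ (‖c‖ * a) * a := by
        gcongr
        refine (c.le_opNorm _).trans ?_
        gcongr
      have := abs_le.1 (abs_re_inner_le (c (e 0)) (X (w 0)))
      linarith
    have hP0 : (inner ℂ (P (X (w 0))) (X (w 0))).re ≤ ‖P‖ * a ^ 2 := by
      have h1 : ‖P (X (w 0))‖ * ‖X (w 0)‖ ≤ (‖P‖ * a) * a := by
        gcongr
        refine (P.le_opNorm _).trans ?_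
        gcongr
      have := abs_le.1 (abs_re_inner_le (P (X (w 0))) (X (w 0)))
      linarith
    rw [hS2]
    have p1 : 0 ≤ 2 * ‖c‖ * C₂ * a ^ 2 := by positivity
    have p2 : 0 ≤ (‖P‖ + 2 * ‖c‖) * (a * m) := by positivity
    have e1 : κ₁ * (a ^ 2 + a * m) = κ * (C₂ ^ 2 + C₂) * (a ^ 2 + a * m) * (1 / α)
        + 2 * (‖c‖ * C₂ * (a * m)) + ‖P‖ * a ^ 2 + 2 * (‖c‖ * a ^ 2)
        + 2 * ‖c‖ * C₂ * a ^ 2 + (‖P‖ + 2 * ‖c‖) * (a * m) := by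
      rw [hκ₁]; ring
    rw [e1]
    linarith
  set b := √(2 * (β ^ 2 + κ₁ * (a ^ 2 + a * m))) with hb
  have hb2 : b ^ 2 = 2 * (β ^ 2 + κ₁ * (a ^ 2 + a * m)) := Real.sq_sqrt (by positivity)
  have hb0 : 0 < b := Real.sqrt_pos.2 (by positivity)
  have hYint : ∀ t ∈ Set.Icc 0 τ, 0 ≤ ∫ s in (0 : ℝ)..t, ‖Y (w s)‖ ^ 2 := fun t ht =>
    intervalIntegral.integral_nonneg ht.1 fun s _ => by positivity
  have hmb : m ≤ C₃ * (a + b) := by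
    have h1 := hstate w (fun s => G (e s)) τ (‖S‖ * b) (‖G‖ * (C₂ * a)) b hτ.1 (by positivity)
      (by positivity) hb0 hx hw (fun s hs => by
        rw [hS]
        refine (S.le_opNorm _).trans ?_
        gcongr
        refine le_of_sq_le_sq ?_ hb0.le
        rw [hb2]
        have := hI1 s hs
        have := hYint s hs
        have : 0 ≤ κ₁ * (a ^ 2 + a * m) := by positivity
        nlinarith [sq_nonneg β]) (fun s hs => by
        refine (G.le_opNorm _).trans ?_
        gcongr
        exact (he1 s hs.1).trans (by gcongr)) (by
        have := hI1 τ ⟨hτ.1, le_rfl⟩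
        have : 0 ≤ ‖S (X (w τ))‖ ^ 2 := by positivity
        rw [hb2]
        linarith)
    refine h1.trans ?_
    rw [hC₃, mul_assoc]
    gcongr
    have p : 0 ≤ (‖S‖ + 1) * a + ‖G‖ * C₂ * b := by positivity
    linarith [hb0.le]
  have hfinal := le_of_le_mul_add_sqrt hκ₁0 ha0 hβ hm0 hb2 hmb
  exact (hmax (Set.right_mem_Icc.2 hT)).trans hfinal

end Controllable

/-! ### Splitting off the reachable subspace -/

section Reduction

variable {E W : Type*} [NormedAddCommGroup E] [InnerProductSpace ℂ E] [FiniteDimensional ℂ E]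
  [NormedAddCommGroup W] [InnerProductSpace ℂ W] [FiniteDimensional ℂ W]
  [CompleteSpace E] [CompleteSpace W]

/-- The reachable subspace of `d/dt (X w) = D w`. -/
def reachable (X D : W →L[ℂ] E) : Submodule ℂ E :=
  sInf {Z : Submodule ℂ E | ∀ w, X w ∈ Z → D w ∈ Z}

theorem mem_reachable_of_mem {X D : W →L[ℂ] E} {w : W} (h : X w ∈ reachable X D) :
    D w ∈ reachable X D := by
  rw [reachable, Submodule.mem_sInf] at h ⊢
  exact fun Z hZ => hZ w (h Z hZ)

theorem reachable_le {X D : W →L[ℂ] E} {Z : Submodule ℂ E} (hZ : ∀ w, X w ∈ Z → D w ∈ Z) :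
    reachable X D ≤ Z := sInf_le hZ

variable {V Wr Eu : Type*} [NormedAddCommGroup V] [InnerProductSpace ℂ V] [FiniteDimensional ℂ V]
  [NormedAddCommGroup Wr] [InnerProductSpace ℂ Wr] [FiniteDimensional ℂ Wr]
  [NormedAddCommGroup Eu] [InnerProductSpace ℂ Eu] [FiniteDimensional ℂ Eu]
  [CompleteSpace V] [CompleteSpace Wr] [CompleteSpace Eu]

theorem IsBehavior.isPrimitive_quotient {X D : W →L[ℂ] E} {pu : E →L[ℂ] Eu} {H : Eu →L[ℂ] Eu}
    (hpuD : ∀ w, pu (D w) = H (pu (X w))) {w : ℝ → W} (hw : IsBehavior X D w) :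
    IsPrimitive (fun t => pu (X (w t))) (fun t => H (pu (X (w t)))) := by
  simpa only [hpuD] using hw.isPrimitive.clmC pu

theorem IsBehavior.quotient_eq {X D : W →L[ℂ] E} {pu : E →L[ℂ] Eu} {H : Eu →L[ℂ] Eu}
    (hpuD : ∀ w, pu (D w) = H (pu (X w))) {w : ℝ → W} (hw : IsBehavior X D w) {t : ℝ}
    (ht : 0 ≤ t) :
    pu (X (w t)) = expSemigroup (H.restrictScalars ℝ) t (pu (X (w 0))) :=
  IsPrimitive.eq_expSemigroup (H := H.restrictScalars ℝ) (hw.isPrimitive_quotient hpuD) ht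

theorem IsBehavior.isPrimitive_sub {X D : W →L[ℂ] E} {Xr Dr : Wr →L[ℂ] V} {pr : E →L[ℂ] V}
    {pu : E →L[ℂ] Eu} {wr : W →L[ℂ] Wr} {G : Eu →L[ℂ] V}
    (hXwr : ∀ w, Xr (wr w) = pr (X w)) (hprD : ∀ w, pr (D w) = Dr (wr w) + G (pu (X w)))
    {w : ℝ → W} (hw : IsBehavior X D w) :
    IsPrimitive (fun t => Xr (wr (w t))) (fun t => Dr (wr (w t)) + G (pu (X (w t)))) := by
  simpa only [hprD, ← hXwr] using hw.isPrimitive.clmC pr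

/-- The input does not act on the quotient, so the projection of any trajectory follows the
semigroup; the decaying trajectory supplied by minimal stability therefore shows that the semigroup
itself decays. -/
theorem IsMinimallyStable.tendsto_quotient {X D : W →L[ℂ] E} {M : W →L[ℂ] W}
    (hmin : IsMinimallyStable X D M) {pu : E →L[ℂ] Eu} {H : Eu →L[ℂ] Eu}
    (hpu : Function.Surjective pu) (hpuD : ∀ w, pu (D w) = H (pu (X w))) (e : Eu) :
    Tendsto (fun t => expSemigroup (H.restrictScalars ℝ) t e) atTop (𝓝 0) := by
  obtain ⟨x, rfl⟩ := hpu e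
  obtain ⟨w, hw, hw0, -, hlim⟩ := hmin x
  have h1 : Tendsto (fun t => pu (X (w t))) atTop (𝓝 0) := by
    have := (pu.continuous.tendsto 0).comp hlim
    simpa [Function.comp_def] using this
  refine h1.congr' ?_
  filter_upwards [eventually_ge_atTop 0] with t ht
  rw [hw.quotient_eq hpuD ht, hw0]

/-- A trajectory whose quotient component starts at zero keeps it zero, so a minimally stable
trajectory of the full system is one of the reachable part, with the same supply. -/
theorem IsMinimallyStable.restrict {X D : W →L[ℂ] E} {M : W →L[ℂ] W}
    (hmin : IsMinimallyStable X D M) {Xr Dr : Wr →L[ℂ] V} {Mr : Wr →L[ℂ] Wr} {pr : E →L[ℂ] V}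
    {pu : E →L[ℂ] Eu} {H : Eu →L[ℂ] Eu} {wr : W →L[ℂ] Wr} {G : Eu →L[ℂ] V}
    (hpuD : ∀ w, pu (D w) = H (pu (X w))) (hXwr : ∀ w, Xr (wr w) = pr (X w))
    (hprD : ∀ w, pr (D w) = Dr (wr w) + G (pu (X w)))
    (hpr : ∀ x : V, ∃ y, pr y = x ∧ pu y = 0)
    (hMr : ∀ w, pu (X w) = 0 → inner ℂ (Mr (wr w)) (wr w) = inner ℂ (M w) w) :
    IsMinimallyStable Xr Dr Mr := by
  intro x
  obtain ⟨y, rfl, hy⟩ := hpr x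
  obtain ⟨w, hw, hw0, hE, hlim⟩ := hmin y
  have he0 : ∀ t, 0 ≤ t → pu (X (w t)) = 0 := fun t ht => by
    rw [hw.quotient_eq hpuD ht, hw0, hy, map_zero]
  refine ⟨fun t => wr (w t), ⟨?_, hw.locL2.clm wr⟩, ?_, fun t ht => ?_, ?_⟩
  · refine (hw.isPrimitive_sub hXwr hprD).congr_ae fun t ht => Eventually.of_forall fun r hr => ?_
    rw [he0 r hr.1.le, map_zero, add_zero]
  · rw [hXwr, hw0]
  · refine le_of_eq_of_le (intervalIntegral.integral_congr fun r hr => ?_) (hE t ht)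
    rw [Set.uIcc_of_le ht] at hr
    simp only [hMr _ (he0 r hr.1)]
  · have := (pr.continuous.tendsto 0).comp hlim
    simpa [Function.comp_def, hXwr] using this

/-- Hyperstability of a system from that of its reachable part, the quotient being stable. -/
theorem IsDissipative.exists_bound_of_splitting {X D : W →L[ℂ] E} {M : W →L[ℂ] W}
    {Xr Dr : Wr →L[ℂ] V} {Mr : Wr →L[ℂ] Wr} {P : V →L[ℂ] V} {Y : Wr →L[ℂ] Wr}
    (hdis : IsDissipative Xr Dr Mr P Y) (hminr : IsMinimallyStable Xr Dr Mr)
    (hinj : ∀ w, Xr w = 0 → P (Dr w) = 0 → Y w = 0 → w = 0)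
    {pr : E →L[ℂ] V} {pu : E →L[ℂ] Eu} {H : Eu →L[ℂ] Eu} {wr : W →L[ℂ] Wr} {G : Eu →L[ℂ] V}
    {k : Eu →L[ℂ] Wr} {n : Eu →L[ℂ] Eu}
    (hpuD : ∀ w, pu (D w) = H (pu (X w))) (hXwr : ∀ w, Xr (wr w) = pr (X w))
    (hprD : ∀ w, pr (D w) = Dr (wr w) + G (pu (X w)))
    (hH : ∀ e, Tendsto (fun t => expSemigroup (H.restrictScalars ℝ) t e) atTop (𝓝 0))
    (hsupply : ∀ w, (inner ℂ (M w) w).re = (inner ℂ (Mr (wr w)) (wr w)).re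
      + 2 * (inner ℂ (k (pu (X w))) (wr w)).re + (inner ℂ (n (pu (X w))) (pu (X w))).re)
    (hprn : ∀ x, ‖pr x‖ ≤ ‖x‖) (hpun : ∀ x, ‖pu x‖ ≤ ‖x‖) (hnorm : ∀ x, ‖x‖ ≤ ‖pr x‖ + ‖pu x‖) :
    ∃ C : ℝ, 0 < C ∧ ∀ (w : ℝ → W) (β : ℝ), 0 ≤ β → IsBehavior X D w →
      (∀ t, 0 ≤ t → ∫ r in (0 : ℝ)..t, (inner ℂ (M (w r)) (w r)).re ≤ β ^ 2) →
      ∀ t, 0 ≤ t → ‖X (w t)‖ ≤ C * (‖X (w 0)‖ + β) := by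
  obtain ⟨C, hC, hbound⟩ := hdis.exists_bound_of_energy_le hminr hinj H hH G k n
  obtain ⟨C', α, hC', hα, hdecay⟩ := exists_expSemigroup_decay hH
  refine ⟨2 * C + C', by positivity, fun w β hβ hw hE t ht => ?_⟩
  -- The energy estimate requires a positive bound, so β is replaced by a larger β', which then
  -- decreases to β.
  have key : ∀ β' : ℝ, β < β' → ‖X (w t)‖ ≤ (2 * C + C') * (‖X (w 0)‖ + β') := by
    intro β' hβ'
    have hβ0 : 0 < β' := hβ.trans_lt hβ'
    have h1 := hbound (fun t => wr (w t)) (fun t => pu (X (w t))) β' hβ0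
      (hw.isPrimitive_quotient hpuD) (hw.isPrimitive_sub hXwr hprD)
      (hw.locL2.clm wr) (fun r hr => by
        refine le_trans ?_ ((hE r hr).trans (by gcongr))
        exact (intervalIntegral.integral_congr fun q _ => (hsupply (w q)).symm).le) t ht
    simp only [hXwr] at h1
    have h2 : ‖pu (X (w t))‖ ≤ C' * ‖pu (X (w 0))‖ := by
      rw [hw.quotient_eq hpuD ht]
      refine (ContinuousLinearMap.le_opNorm _ _).trans ?_
      gcongr
      refine (hdecay t ht).trans (mul_le_of_le_one_right hC'.le (Real.exp_le_one_iff.2 ?_))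
      nlinarith
    have h3 := hnorm (X (w t))
    have h4 := mul_le_mul_of_nonneg_left (hprn (X (w 0))) hC.le
    have h5 := mul_le_mul_of_nonneg_left (hpun (X (w 0))) hC.le
    have h6 := mul_le_mul_of_nonneg_left (hpun (X (w 0))) hC'.le
    have h7 : 0 ≤ C * β' + C' * β' := by positivity
    linarith
  have hlim : Tendsto (fun β' => (2 * C + C') * (‖X (w 0)‖ + β')) (𝓝[>] β)
      (𝓝 ((2 * C + C') * (‖X (w 0)‖ + β))) :=
    ((by fun_prop : Continuous fun β' => (2 * C + C') * (‖X (w 0)‖ + β')).tendsto β).mono_left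
      nhdsWithin_le_nhds
  refine ge_of_tendsto hlim ?_
  filter_upwards [self_mem_nhdsWithin] with β' hβ' using key β' hβ'

theorem exists_sesq_eq {W₁ W₂ : Type*} [NormedAddCommGroup W₁] [InnerProductSpace ℂ W₁]
    [NormedAddCommGroup W₂] [InnerProductSpace ℂ W₂] [CompleteSpace W₂]
    {s : W₁ →L[ℂ] W} {t : W₂ →L[ℂ] W} (M : W →L[ℂ] W) :
    ∃ N : W₁ →L[ℂ] W₂, ∀ v w, inner ℂ (N v) w = inner ℂ (M (s v)) (t w) := by
  refine ⟨t.adjoint ∘L M ∘L s, fun v w => ?_⟩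
  rw [ContinuousLinearMap.comp_apply, ContinuousLinearMap.comp_apply,
    ContinuousLinearMap.adjoint_inner_left]

theorem exists_restrict (X : W →L[ℂ] E) {s : Submodule ℂ W} {V : Submodule ℂ E}
    (h : ∀ w ∈ s, X w ∈ V) : ∃ Y : s →L[ℂ] V, ∀ w : s, (Y w : E) = X w :=
  ⟨(X ∘L s.subtypeL).codRestrict V fun w => h w w.2, fun _ => rfl⟩

/-- Minimal stability, the frequency inequality, and nondegeneracy at one frequency imply
hyperstability. -/
theorem exists_hyperstable_bound {X D : W →L[ℂ] E} {M : W →L[ℂ] W} (hM : IsSelfAdjoint M)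
    (s : E →L[ℂ] W) (hs : ∀ x, X (s x) = x) (hmin : IsMinimallyStable X D M)
    {σ : Set ℝ} (hσ : σ.Finite)
    (hF : ∀ ω : ℝ, ω ∉ σ → ∀ w, (Complex.I * ω) • X w = D w → 0 ≤ (inner ℂ (M w) w).re)
    {c : ℂ} (hdet : ∀ w, X w ∈ reachable X D → c • X w = D w →
      (∀ v, X v ∈ reachable X D → inner ℂ v (M w) = 0) → w = 0) :
    ∃ C : ℝ, 0 < C ∧ ∀ (w : ℝ → W) (β : ℝ), 0 ≤ β → IsBehavior X D w →
      (∀ t, 0 ≤ t → ∫ r in (0 : ℝ)..t, (inner ℂ (M (w r)) (w r)).re ≤ β ^ 2) →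
      ∀ t, 0 ≤ t → ‖X (w t)‖ ≤ C * (‖X (w 0)‖ + β) := by
  obtain ⟨V, hV⟩ : ∃ V : Submodule ℂ E, V = reachable X D := ⟨_, rfl⟩
  rw [← hV] at hdet
  obtain ⟨Wr, hWr⟩ : ∃ Wr : Submodule ℂ W, ∀ w, w ∈ Wr ↔ X w ∈ V :=
    ⟨V.comap X.toLinearMap, fun _ => Iff.rfl⟩
  obtain ⟨Xr, hXr0⟩ := exists_restrict X (s := Wr) (V := V) fun w hw => (hWr w).1 hw
  obtain ⟨Dr, hDr0⟩ := exists_restrict D (s := Wr) (V := V) fun w hw => by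
    rw [hV]
    exact mem_reachable_of_mem (hV ▸ (hWr w).1 hw)
  have hMs := ContinuousLinearMap.isSelfAdjoint_iff_isSymmetric.1 hM
  obtain ⟨Mr, hMr⟩ := exists_sesq_eq (s := Wr.subtypeL) (t := Wr.subtypeL) M
  simp only [Submodule.subtypeL_apply] at hMr
  have hMrs : IsSelfAdjoint Mr := by
    refine ContinuousLinearMap.isSelfAdjoint_iff_isSymmetric.2 fun v w => ?_
    change inner ℂ (Mr v) w = inner ℂ v (Mr w)
    rw [← inner_conj_symm v, hMr, hMr, inner_conj_symm]
    exact hMs _ _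
  have hXr : Function.Surjective Xr := fun x =>
    ⟨⟨s x, by rw [hWr, hs]; exact x.2⟩, Subtype.ext (by rw [hXr0, hs])⟩
  -- An invariant subspace of the restricted pencil is also invariant for the full one, so
  -- minimality of V makes it everything.
  have hCr : ∀ Z : Submodule ℂ V, (∀ w, Xr w ∈ Z → Dr w ∈ Z) → Z = ⊤ := by
    intro Z hZ
    have h1 : V ≤ Z.map V.subtype := by
      refine le_of_eq_of_le hV (reachable_le fun w hw => ?_)
      obtain ⟨z, hz, hzw⟩ := hw
      have hwV : X w ∈ V := by rw [← hzw]; exact z.2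
      have h2 : Xr ⟨w, (hWr w).2 hwV⟩ ∈ Z := by
        have : Xr ⟨w, (hWr w).2 hwV⟩ = z := Subtype.ext (by rw [hXr0]; exact hzw.symm)
        rw [this]; exact hz
      exact ⟨_, hZ _ h2, hDr0 _⟩
    rw [eq_top_iff]
    intro x _
    obtain ⟨z, hz, hzx⟩ := h1 x.2
    have : z = x := Subtype.ext hzx
    rw [← this]; exact hz
  have hFr : ∀ ω : ℝ, ω ∉ σ → ∀ w, (Complex.I * ω) • Xr w = Dr w →
      0 ≤ (inner ℂ (Mr w) w).re := by
    intro ω hω w hw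
    rw [hMr]
    refine hF ω hω w ?_
    rw [← hXr0, ← hDr0, ← hw]
    rfl
  obtain ⟨P, Y, hdis⟩ := exists_isDissipative hMrs hXr hCr hσ hFr
  obtain ⟨Vc, hVc⟩ : ∃ Vc : Submodule ℂ E, Vc = Vᗮ := ⟨_, rfl⟩
  obtain ⟨pr, pu, hsplit, hpuV, hprV, hpuu, hprn, hpun⟩ : ∃ (pr : E →L[ℂ] V) (pu : E →L[ℂ] Vc),
      (∀ x, (pr x : E) + (pu x : E) = x) ∧ (∀ x, x ∈ V → pu x = 0) ∧ (∀ x : V, pr x = x) ∧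
      (∀ e : Vc, pu e = e) ∧ (∀ x, ‖pr x‖ ≤ ‖x‖) ∧ ∀ x, ‖pu x‖ ≤ ‖x‖ := by
    subst hVc
    exact ⟨V.orthogonalProjectionOnto, Vᗮ.orthogonalProjectionOnto,
      fun x => V.starProjection_add_starProjection_orthogonal x,
      fun x hx => Submodule.orthogonalProjectionOnto_orthogonal_apply_eq_zero hx,
      fun x => Submodule.orthogonalProjectionOnto_mem_subspace_eq_self x,
      fun x => Submodule.orthogonalProjectionOnto_mem_subspace_eq_self x,
      fun x => V.norm_orthogonalProjectionOnto_apply_le x,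
      fun x => Vᗮ.norm_orthogonalProjectionOnto_apply_le x⟩
  obtain ⟨su, hsu, hXsu⟩ : ∃ su : Vc →L[ℂ] W, (∀ e : Vc, su e = s e) ∧ ∀ e : Vc, X (su e) = e :=
    ⟨s ∘L Vc.subtypeL, fun _ => rfl, fun _ => hs _⟩
  obtain ⟨H, hH0⟩ : ∃ H : Vc →L[ℂ] Vc, ∀ e, H e = pu (D (su e)) := ⟨pu ∘L D ∘L su, fun _ => rfl⟩
  obtain ⟨G, hG0⟩ : ∃ G : Vc →L[ℂ] V, ∀ e, G e = pr (D (su e)) := ⟨pr ∘L D ∘L su, fun _ => rfl⟩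
  have hXsub : ∀ w, X (w - su (pu (X w))) = pr (X w) := fun w => by
    rw [map_sub, hXsu, sub_eq_iff_eq_add, hsplit]
  -- Subtracting the reference lift of the unreachable component leaves a vector whose state lies in
  -- V. The lift then enters the reachable subsystem as the exogenous forcing G e.
  obtain ⟨wr, hwr⟩ : ∃ wr : W →L[ℂ] Wr, ∀ w, (wr w : W) = w - su (pu (X w)) :=
    ⟨(ContinuousLinearMap.id ℂ W - su ∘L pu ∘L X).codRestrict Wr (fun w => by
      rw [hWr]
      exact (hXsub w).symm ▸ (pr (X w)).2), fun _ => rfl⟩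
  have hwr' : ∀ w, w = (wr w : W) + su (pu (X w)) := fun w => by rw [hwr]; abel
  have hXwr : ∀ w, Xr (wr w) = pr (X w) := fun w => Subtype.ext (by rw [hXr0, hwr, hXsub])
  have hDwr : ∀ w, D w = (Dr (wr w) : E) + D (su (pu (X w))) := fun w => by
    conv_lhs => rw [hwr' w, map_add]
    rw [hDr0]
  have hpuD : ∀ w, pu (D w) = H (pu (X w)) := fun w => by
    rw [hDwr, map_add, hpuV _ (Dr (wr w)).2, zero_add, hH0]
  have hprD : ∀ w, pr (D w) = Dr (wr w) + G (pu (X w)) := fun w => by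
    rw [hDwr, map_add, hprV, hG0]
  have hminr : IsMinimallyStable Xr Dr Mr := by
    refine hmin.restrict hpuD hXwr hprD (fun x => ⟨x, hprV x, hpuV _ x.2⟩) fun w hw => ?_
    rw [hMr, hwr, hw, map_zero, sub_zero]
  have hinj : ∀ w, Xr w = 0 → P (Dr w) = 0 → Y w = 0 → w = 0 := by
    intro w h1 h2 h3
    refine hdis.eq_zero_of_lossless hminr (c := c) (fun v hv1 hv2 => ?_) h1 h2 h3
    have hcv : c • X v = D v := by
      rw [← hXr0, ← hDr0, ← hv1]
      rfl
    refine Subtype.ext (hdet v ((hWr _).1 v.2) hcv fun y hy => ?_)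
    have h4 : inner ℂ (Mr v) (⟨y, (hWr y).2 hy⟩ : Wr) = inner ℂ (M v) y := hMr v _
    rw [← inner_conj_symm, ← h4, hv2, inner_zero_left, map_zero]
  obtain ⟨k, hk⟩ := exists_sesq_eq (s := su) (t := Wr.subtypeL) M
  simp only [Submodule.subtypeL_apply] at hk
  obtain ⟨n, hn⟩ := exists_sesq_eq (s := su) (t := su) M
  have hsupply : ∀ w, (inner ℂ (M w) w).re = (inner ℂ (Mr (wr w)) (wr w)).re
      + 2 * (inner ℂ (k (pu (X w))) (wr w)).re + (inner ℂ (n (pu (X w))) (pu (X w))).re := by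
    intro w
    have h3 : (inner ℂ (M (wr w : W)) (su (pu (X w)))).re
        = (inner ℂ (M (su (pu (X w)))) (wr w : W)).re := by
      have : inner ℂ (M (wr w : W)) (su (pu (X w))) = inner ℂ (wr w : W) (M (su (pu (X w)))) :=
        hMs _ _
      rw [this, ← inner_conj_symm, Complex.conj_re]
    have h4 : w = (wr w : W) + su (pu (X w)) := hwr' w
    rw [hMr, hk, hn]
    conv_lhs => rw [h4]
    rw [map_add, inner_add_left, inner_add_right, inner_add_right]
    simp only [Complex.add_re, h3]
    ring
  exact hdis.exists_bound_of_splitting hminr hinj hpuD hXwr hprD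
    (hmin.tendsto_quotient (fun e => ⟨e, hpuu e⟩) hpuD) hsupply hprn hpun fun x => by
      conv_lhs => rw [← hsplit x]
      exact norm_add_le _ _

end Reduction

/-! ### From the matrix data to the pencil, and the Popov function as a form -/

section Matrices

variable {𝕜 : Type*} [RCLike 𝕜] {m n : ℕ}

theorem map_mul_complex (a b : 𝕜) : RCLike.map 𝕜 ℂ (a * b) = RCLike.map 𝕜 ℂ a * RCLike.map 𝕜 ℂ b := by
  rcases RCLike.I_eq_zero_or_im_I_eq_one (K := 𝕜) with h | h
  · have hi := RCLike.im_eq_zero (K := 𝕜) h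
    simp [RCLike.map_apply, RCLike.mul_re, hi]
  · simp only [RCLike.map_apply, RCLike.mul_re, RCLike.mul_im]
    apply Complex.ext <;> simp

theorem map_star_complex (a : 𝕜) : RCLike.map 𝕜 ℂ (star a) = star (RCLike.map 𝕜 ℂ a) := by
  apply Complex.ext <;> simp [RCLike.map_apply]

theorem re_map_complex (a : 𝕜) : (RCLike.map 𝕜 ℂ a).re = RCLike.re a := by
  simp [RCLike.map_apply]

theorem im_map_complex (a : 𝕜) : (RCLike.map 𝕜 ℂ a).im = RCLike.im a := by
  simp [RCLike.map_apply]

theorem norm_map_complex (a : 𝕜) : ‖RCLike.map 𝕜 ℂ a‖ = ‖a‖ := by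
  have h : ‖RCLike.map 𝕜 ℂ a‖ ^ 2 = ‖a‖ ^ 2 := by
    rw [← Complex.normSq_eq_norm_sq, Complex.normSq_apply, re_map_complex, im_map_complex,
      RCLike.norm_sq_eq_def]
  exact (sq_eq_sq₀ (norm_nonneg _) (norm_nonneg _)).1 h

theorem toComplex_conjTranspose {k l : Type*} (N : Matrix k l 𝕜) :
    toComplex N.conjTranspose = (toComplex N).conjTranspose := by
  ext i j
  simp [toComplex]

theorem toComplex_isHermitian {Q : Matrix (Fin m) (Fin m) 𝕜} {S : Matrix (Fin n) (Fin m) 𝕜}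
    {R : Matrix (Fin n) (Fin n) 𝕜} (hQ : Q.IsHermitian) (hR : R.IsHermitian) :
    (toComplex (Matrix.fromBlocks Q S.conjTranspose S R)).IsHermitian := by
  rw [Matrix.IsHermitian, ← toComplex_conjTranspose]
  congr 1
  exact Matrix.IsHermitian.fromBlocks hQ (Matrix.conjTranspose_conjTranspose S) hR

/-- The continuous linear map given by a complex matrix. -/
noncomputable def matL {k l : Type*} [Fintype k] [Fintype l] [DecidableEq l] (N : Matrix k l ℂ) :
    EuclideanSpace ℂ l →L[ℂ] EuclideanSpace ℂ k :=
  LinearMap.toContinuousLinearMap (Matrix.toEuclideanLin N)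

theorem ofLp_matL {k l : Type*} [Fintype k] [Fintype l] [DecidableEq l] (N : Matrix k l ℂ)
    (x : EuclideanSpace ℂ l) : (matL N x).ofLp = N.mulVec x.ofLp := rfl

/-- The state component of a pair (state, input). -/
noncomputable def stateL (m n : ℕ) : EuclideanSpace ℂ (Fin m ⊕ Fin n) →L[ℂ] EuclideanSpace ℂ (Fin m) :=
  matL (Matrix.fromCols 1 0)

/-- The inclusion of states into pairs with zero input. -/
noncomputable def ofStateL (m n : ℕ) :
    EuclideanSpace ℂ (Fin m) →L[ℂ] EuclideanSpace ℂ (Fin m ⊕ Fin n) :=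
  matL (Matrix.fromRows 1 0)

/-- The right-hand side `(x, u) ↦ A x + B u` of the complexified system. -/
noncomputable def dynL (A : Matrix (Fin m) (Fin m) 𝕜) (B : Matrix (Fin m) (Fin n) 𝕜) :
    EuclideanSpace ℂ (Fin m ⊕ Fin n) →L[ℂ] EuclideanSpace ℂ (Fin m) :=
  matL (Matrix.fromCols (toComplex A) (toComplex B))

/-- The operator of the complexified supply rate. -/
noncomputable def supplyL (Q : Matrix (Fin m) (Fin m) 𝕜) (S : Matrix (Fin n) (Fin m) 𝕜)
    (R : Matrix (Fin n) (Fin n) 𝕜) :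
    EuclideanSpace ℂ (Fin m ⊕ Fin n) →L[ℂ] EuclideanSpace ℂ (Fin m ⊕ Fin n) :=
  matL (toComplex (Matrix.fromBlocks Q S.conjTranspose S R))

theorem ofLp_stateL (w : EuclideanSpace ℂ (Fin m ⊕ Fin n)) :
    (stateL m n w).ofLp = w.ofLp ∘ Sum.inl := by
  rw [stateL, ofLp_matL, Matrix.fromCols_mulVec, Matrix.one_mulVec, Matrix.zero_mulVec, add_zero]

theorem ofLp_dynL (A : Matrix (Fin m) (Fin m) 𝕜) (B : Matrix (Fin m) (Fin n) 𝕜)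
    (w : EuclideanSpace ℂ (Fin m ⊕ Fin n)) :
    (dynL A B w).ofLp = (toComplex A).mulVec (w.ofLp ∘ Sum.inl)
      + (toComplex B).mulVec (w.ofLp ∘ Sum.inr) := by
  rw [dynL, ofLp_matL, Matrix.fromCols_mulVec]

theorem stateL_ofStateL (x : EuclideanSpace ℂ (Fin m)) : stateL m n (ofStateL m n x) = x := by
  apply WithLp.ofLp_injective
  rw [ofLp_stateL, ofStateL, ofLp_matL, Matrix.fromRows_mulVec, Matrix.one_mulVec]
  rfl

theorem supplyL_isSelfAdjoint {Q : Matrix (Fin m) (Fin m) 𝕜} {S : Matrix (Fin n) (Fin m) 𝕜}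
    {R : Matrix (Fin n) (Fin n) 𝕜} (hQ : Q.IsHermitian) (hR : R.IsHermitian) :
    IsSelfAdjoint (supplyL Q S R) :=
  ContinuousLinearMap.isSelfAdjoint_iff_isSymmetric.2
    (Matrix.isSymmetric_toEuclideanLin_iff.2 (toComplex_isHermitian hQ hR))

theorem frequencyColumn_mulVec (A : Matrix (Fin m) (Fin m) 𝕜) (B : Matrix (Fin m) (Fin n) 𝕜) (s : ℂ)
    (v : Fin n → ℂ) :
    (frequencyColumn A B s).mulVec v
      = Sum.elim ((charMat A s)⁻¹.mulVec ((toComplex B).mulVec v)) v := by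
  rw [frequencyColumn, Matrix.fromRows_mulVec, Matrix.mulVec_mulVec, Matrix.one_mulVec]

theorem charMat_mulVec (A : Matrix (Fin m) (Fin m) 𝕜) (s : ℂ) (x : Fin m → ℂ) :
    (charMat A s).mulVec x = s • x - (toComplex A).mulVec x := by
  rw [charMat, Matrix.sub_mulVec, Matrix.smul_mulVec, Matrix.one_mulVec]

/-- Away from the poles, exponential trajectories are given by the frequency column. -/
theorem smul_stateL_eq_dynL_iff {A : Matrix (Fin m) (Fin m) 𝕜} {B : Matrix (Fin m) (Fin n) 𝕜} {s : ℂ}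
    (hs : (charMat A s).det ≠ 0) (w : EuclideanSpace ℂ (Fin m ⊕ Fin n)) :
    s • stateL m n w = dynL A B w ↔
      w.ofLp = (frequencyColumn A B s).mulVec (w.ofLp ∘ Sum.inr) := by
  have hu : IsUnit (charMat A s).det := isUnit_iff_ne_zero.2 hs
  rw [frequencyColumn_mulVec, ← (WithLp.ofLp_injective 2).eq_iff, WithLp.ofLp_smul, ofLp_dynL,
    ofLp_stateL]
  have h1 : w.ofLp = Sum.elim (w.ofLp ∘ Sum.inl) (w.ofLp ∘ Sum.inr) :=
    (Sum.elim_comp_inl_inr _).symm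
  have h2 : w.ofLp = Sum.elim ((charMat A s)⁻¹.mulVec ((toComplex B).mulVec (w.ofLp ∘ Sum.inr)))
      (w.ofLp ∘ Sum.inr) ↔
      w.ofLp ∘ Sum.inl = (charMat A s)⁻¹.mulVec ((toComplex B).mulVec (w.ofLp ∘ Sum.inr)) := by
    constructor
    · intro h
      exact congrArg (fun f => f ∘ Sum.inl) h
    · intro h
      rw [← h]
      exact h1
  rw [h2]
  have h3 := charMat_mulVec A s (w.ofLp ∘ Sum.inl)
  constructor
  · intro h
    rw [h, add_sub_cancel_left] at h3
    rw [← h3, Matrix.mulVec_mulVec, Matrix.nonsing_inv_mul _ hu, Matrix.one_mulVec]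
  · intro h
    nth_rw 1 [h] at h3
    rw [Matrix.mulVec_mulVec, Matrix.mul_nonsing_inv _ hu, Matrix.one_mulVec] at h3
    rw [h3]
    abel

/-- Keeping η and ζ independent serves both uses of Π: η = -iω, ζ = iω gives the supply of an
exponential solution, while a general pair exploits det Π ≠ 0. -/
theorem inner_supplyL_frequencyColumn (A : Matrix (Fin m) (Fin m) 𝕜) (B : Matrix (Fin m) (Fin n) 𝕜)
    (Q : Matrix (Fin m) (Fin m) 𝕜) (S : Matrix (Fin n) (Fin m) 𝕜)
    (R : Matrix (Fin n) (Fin n) 𝕜) (η ζ : ℂ) (u v : Fin n → ℂ)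
    {w y : EuclideanSpace ℂ (Fin m ⊕ Fin n)} (hw : w.ofLp = (frequencyColumn A B ζ).mulVec u)
    (hy : y.ofLp = (frequencyColumn A B (star η)).mulVec v) :
    inner ℂ y (supplyL Q S R w) = dotProduct (star v) ((popov A B Q S R η ζ).mulVec u) := by
  rw [EuclideanSpace.inner_eq_star_dotProduct, supplyL, ofLp_matL, hw, hy, popov, dotProduct_comm,
    Matrix.star_mulVec, ← Matrix.mulVec_mulVec, ← Matrix.mulVec_mulVec, ← Matrix.dotProduct_mulVec]

theorem finite_setOf_det_charMat_eq_zero (A : Matrix (Fin m) (Fin m) 𝕜) :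
    {ω : ℝ | (charMat A (Complex.I * ω)).det = 0}.Finite := by
  have h1 : {z : ℂ | (toComplex A).charpoly.IsRoot z}.Finite :=
    Polynomial.finite_setOfPred_isRoot (Matrix.charpoly_monic _).ne_zero
  refine Set.Finite.subset (h1.preimage (f := fun ω : ℝ => Complex.I * ω) ?_) fun ω hω => ?_
  · intro a _ b _ h
    simpa using h
  · change Polynomial.eval _ _ = 0
    rw [Matrix.eval_charpoly]
    rw [Matrix.scalar_apply, ← Matrix.smul_one_eq_diagonal]
    exact hω

/-- The reachable subspace contains the range of B and is invariant under A. There s - A is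
injective, hence surjective, so the resolvent maps B u back into it. -/
theorem stateL_mem_reachable {A : Matrix (Fin m) (Fin m) 𝕜} {B : Matrix (Fin m) (Fin n) 𝕜} {s : ℂ}
    (hs : (charMat A s).det ≠ 0) {w : EuclideanSpace ℂ (Fin m ⊕ Fin n)}
    (hw : s • stateL m n w = dynL A B w) : stateL m n w ∈ reachable (stateL m n) (dynL A B) := by
  set V := reachable (stateL m n) (dynL A B)
  have hA : ∀ x ∈ V, matL (toComplex A) x ∈ V := by
    intro x hx
    have h1 := mem_reachable_of_mem (X := stateL m n) (D := dynL A B) (w := ofStateL m n x)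
      (by rw [stateL_ofStateL]; exact hx)
    convert h1 using 1
    apply WithLp.ofLp_injective
    have h2 : (ofStateL m n x).ofLp = Sum.elim x.ofLp 0 := by
      rw [ofStateL, ofLp_matL, Matrix.fromRows_mulVec, Matrix.one_mulVec, Matrix.zero_mulVec]
    rw [ofLp_dynL, ofLp_matL, h2, Sum.elim_comp_inl, Sum.elim_comp_inr, Matrix.mulVec_zero,
      add_zero]
  have hB : ∀ u : Fin n → ℂ, WithLp.toLp 2 ((toComplex B).mulVec u) ∈ V := by
    intro u
    have h1 := mem_reachable_of_mem (X := stateL m n) (D := dynL A B)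
      (w := WithLp.toLp 2 (Sum.elim 0 u)) (by
        convert V.zero_mem
        apply WithLp.ofLp_injective
        rw [ofLp_stateL]
        rfl)
    convert h1 using 1
    apply WithLp.ofLp_injective
    rw [ofLp_dynL]
    change _ = (toComplex A).mulVec (Sum.elim 0 u ∘ Sum.inl)
      + (toComplex B).mulVec (Sum.elim 0 u ∘ Sum.inr)
    rw [Sum.elim_comp_inl, Sum.elim_comp_inr, Matrix.mulVec_zero, zero_add]
  let f : V →ₗ[ℂ] V := (s • LinearMap.id - (matL (toComplex A)).toLinearMap).restrict
    (p := V) (q := V) fun x hx => V.sub_mem (V.smul_mem s hx) (hA x hx)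
  have hf : ∀ x : V, ((f x : V) : EuclideanSpace ℂ (Fin m)).ofLp
      = (charMat A s).mulVec (x : EuclideanSpace ℂ (Fin m)).ofLp := fun x => by
    rw [charMat_mulVec]; rfl
  have hinj : ∀ x y : Fin m → ℂ, (charMat A s).mulVec x = (charMat A s).mulVec y → x = y := by
    intro x y h
    exact Matrix.mulVec_injective_of_isUnit
      ((Matrix.isUnit_iff_isUnit_det _).2 (isUnit_iff_ne_zero.2 hs)) h
  have hfi : Function.Injective f := by
    intro x y h
    apply Subtype.ext
    apply WithLp.ofLp_injective
    exact hinj _ _ (by rw [← hf, ← hf, h])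
  obtain ⟨x, hx⟩ := LinearMap.injective_iff_surjective.1 hfi ⟨_, hB (w.ofLp ∘ Sum.inr)⟩
  have h1 : (stateL m n w) = x := by
    apply WithLp.ofLp_injective
    apply hinj
    rw [← hf, hx, charMat_mulVec, ← WithLp.ofLp_smul, hw, ofLp_dynL, ofLp_stateL,
      add_sub_cancel_left]
  rw [h1]
  exact x.2

/-- Hyperstability of the complexified system. -/
theorem exists_hyperstable_bound_of_FDI {A : Matrix (Fin m) (Fin m) 𝕜}
    {B : Matrix (Fin m) (Fin n) 𝕜} {Q : Matrix (Fin m) (Fin m) 𝕜} {S : Matrix (Fin n) (Fin m) 𝕜}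
    {R : Matrix (Fin n) (Fin n) 𝕜} (hQ : Q.IsHermitian) (hR : R.IsHermitian)
    (hmin : IsMinimallyStable (stateL m n) (dynL A B) (supplyL Q S R))
    (hdet : PopovDetNonzero A B Q S R) (hF : FDI A B Q S R) :
    ∃ C : ℝ, 0 < C ∧ ∀ (w : ℝ → EuclideanSpace ℂ (Fin m ⊕ Fin n)) (β : ℝ), 0 ≤ β →
      IsBehavior (stateL m n) (dynL A B) w →
      (∀ t, 0 ≤ t → ∫ r in (0 : ℝ)..t, (inner ℂ (supplyL Q S R (w r)) (w r)).re ≤ β ^ 2) →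
      ∀ t, 0 ≤ t → ‖stateL m n (w t)‖ ≤ C * (‖stateL m n (w 0)‖ + β) := by
  obtain ⟨η, ζ, hη, hζ, hdet⟩ := hdet
  refine exists_hyperstable_bound (supplyL_isSelfAdjoint hQ hR) (ofStateL m n) stateL_ofStateL hmin
    (finite_setOf_det_charMat_eq_zero A) (fun ω hω w hw => ?_) (c := ζ) fun w _ hw hv => ?_
  · rw [smul_stateL_eq_dynL_iff hω] at hw
    have h1 := inner_supplyL_frequencyColumn A B Q S R (-(Complex.I * ω)) (Complex.I * ω)
      (w.ofLp ∘ Sum.inr) (w.ofLp ∘ Sum.inr) hw (y := w) (by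
        have : star (-(Complex.I * (ω : ℂ))) = Complex.I * ω := by simp
        rw [this]
        exact hw)
    rw [← inner_conj_symm, Complex.conj_re, h1]
    exact (Complex.le_def.1 ((hF ω hω).dotProduct_mulVec_nonneg _)).1
  · rw [smul_stateL_eq_dynL_iff hζ] at hw
    -- Testing against the exponential vector at the conjugate of η with input v = Π u gives ‖Π u‖²
    -- = 0. The test vector is admissible because its state is reachable.
    have h1 : (popov A B Q S R η ζ).mulVec (w.ofLp ∘ Sum.inr) = 0 := by
      refine dotProduct_star_self_eq_zero.1 ?_
      set v := (popov A B Q S R η ζ).mulVec (w.ofLp ∘ Sum.inr)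
      let y : EuclideanSpace ℂ (Fin m ⊕ Fin n) :=
        WithLp.toLp 2 ((frequencyColumn A B (star η)).mulVec v)
      have hy : y.ofLp = (frequencyColumn A B (star η)).mulVec v := rfl
      rw [show dotProduct (star v) v = inner ℂ y (supplyL Q S R w) from
        (inner_supplyL_frequencyColumn A B Q S R η ζ (w.ofLp ∘ Sum.inr) v hw hy).symm]
      refine hv y (stateL_mem_reachable hη ?_)
      rw [smul_stateL_eq_dynL_iff hη]
      have : y.ofLp ∘ Sum.inr = v := by
        rw [hy, frequencyColumn_mulVec, Sum.elim_comp_inr]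
      rw [this]
    have h2 : w.ofLp ∘ Sum.inr = 0 := Matrix.eq_zero_of_mulVec_eq_zero hdet h1
    apply WithLp.ofLp_injective
    rw [hw, h2, Matrix.mulVec_zero]
    rfl

end Matrices

/-! ### Passing between scalars in 𝕜 and ℂ -/

section Complexification

variable {𝕜 : Type*} [RCLike 𝕜] {m n : ℕ}

/-- The coordinatewise embedding of `𝕜`-vectors into complex vectors. -/
noncomputable def cplx {k : Type*} [Fintype k] : EuclideanSpace 𝕜 k →L[ℝ] EuclideanSpace ℂ k :=
  LinearMap.toContinuousLinearMap
    { toFun := fun x => WithLp.toLp 2 fun i => RCLike.map 𝕜 ℂ (x i)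
      map_add' := fun x y => by
        ext i
        exact map_add (RCLike.map 𝕜 ℂ) (x i) (y i)
      map_smul' := fun c x => by
        ext i
        exact map_smul (RCLike.map 𝕜 ℂ) c (x i) }

theorem cplx_apply {k : Type*} [Fintype k] (x : EuclideanSpace 𝕜 k) (i : k) :
    cplx x i = RCLike.map 𝕜 ℂ (x i) := rfl

theorem ofLp_cplx {k : Type*} [Fintype k] (x : EuclideanSpace 𝕜 k) :
    (cplx x).ofLp = RCLike.map 𝕜 ℂ ∘ x.ofLp := rfl

theorem norm_cplx {k : Type*} [Fintype k] (x : EuclideanSpace 𝕜 k) : ‖cplx x‖ = ‖x‖ := by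
  rw [EuclideanSpace.norm_eq, EuclideanSpace.norm_eq]
  simp only [cplx_apply, norm_map_complex]

theorem toComplex_mulVec {k l : Type*} [Fintype l] (N : Matrix k l 𝕜) (x : l → 𝕜) :
    (toComplex N).mulVec (RCLike.map 𝕜 ℂ ∘ x) = RCLike.map 𝕜 ℂ ∘ N.mulVec x := by
  ext i
  simp only [Matrix.mulVec, dotProduct, toComplex, Matrix.map_apply, Function.comp_apply,
    ← map_mul_complex, ← map_sum]

theorem matL_cplx {k l : Type*} [Fintype k] [Fintype l] [DecidableEq l] (N : Matrix k l 𝕜)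
    (x : EuclideanSpace 𝕜 l) : matL (toComplex N) (cplx x) = cplx (N.toEuclideanLin x) := by
  apply WithLp.ofLp_injective
  rw [ofLp_matL, ofLp_cplx, toComplex_mulVec, ofLp_cplx]
  rfl

theorem inner_cplx {k : Type*} [Fintype k] (x y : EuclideanSpace 𝕜 k) :
    inner ℂ (cplx x) (cplx y) = RCLike.map 𝕜 ℂ (inner 𝕜 x y) := by
  rw [EuclideanSpace.inner_eq_star_dotProduct, EuclideanSpace.inner_eq_star_dotProduct]
  simp only [dotProduct, ofLp_cplx, Function.comp_apply, Pi.star_apply, ← map_star_complex,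
    ← map_mul_complex, ← map_sum]

/-- The pair (state, input) as a single vector. -/
def join (x : EuclideanSpace 𝕜 (Fin m)) (u : EuclideanSpace 𝕜 (Fin n)) :
    EuclideanSpace 𝕜 (Fin m ⊕ Fin n) :=
  WithLp.toLp 2 (Sum.elim x.ofLp u.ofLp)

theorem inner_join (x y : EuclideanSpace 𝕜 (Fin m)) (u v : EuclideanSpace 𝕜 (Fin n)) :
    inner 𝕜 (join x u) (join y v) = inner 𝕜 x y + inner 𝕜 u v := by
  simp only [PiLp.inner_apply, Fintype.sum_sum_type, join, Sum.elim_inl, Sum.elim_inr]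

theorem supplyRate_eq_re_inner_join (Q : Matrix (Fin m) (Fin m) 𝕜) (S : Matrix (Fin n) (Fin m) 𝕜)
    (R : Matrix (Fin n) (Fin n) 𝕜)
    (x : EuclideanSpace 𝕜 (Fin m)) (u : EuclideanSpace 𝕜 (Fin n)) :
    supplyRate Q S R x u = RCLike.re (inner 𝕜
      ((Matrix.fromBlocks Q S.conjTranspose S R).toEuclideanLin (join x u)) (join x u)) := by
  have h1 : (Matrix.fromBlocks Q S.conjTranspose S R).toEuclideanLin (join x u)
      = join (Q.toEuclideanLin x + S.conjTranspose.toEuclideanLin u)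
        (S.toEuclideanLin x + R.toEuclideanLin u) := by
    apply WithLp.ofLp_injective
    exact Matrix.fromBlocks_mulVec Q S.conjTranspose S R (Sum.elim x.ofLp u.ofLp)
  have h2 : RCLike.re (inner 𝕜 (S.conjTranspose.toEuclideanLin u) x)
      = RCLike.re (inner 𝕜 (S.toEuclideanLin x) u) := by
    rw [Matrix.toEuclideanLin_conjTranspose_eq_adjoint, LinearMap.adjoint_inner_left,
      inner_re_symm]
  rw [h1, inner_join, inner_add_left, inner_add_left]
  simp only [map_add, h2, supplyRate]
  ring

/-- The pair (state, input) as a complex vector. -/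
noncomputable def pairC (x : EuclideanSpace 𝕜 (Fin m)) (u : EuclideanSpace 𝕜 (Fin n)) :
    EuclideanSpace ℂ (Fin m ⊕ Fin n) :=
  cplx (join x u)

theorem ofLp_pairC (x : EuclideanSpace 𝕜 (Fin m)) (u : EuclideanSpace 𝕜 (Fin n)) :
    (pairC x u).ofLp = Sum.elim (cplx x).ofLp (cplx u).ofLp := by
  rw [pairC, ofLp_cplx, join, Sum.comp_elim]
  rfl

theorem pairC_eq_add (x : EuclideanSpace 𝕜 (Fin m)) (u : EuclideanSpace 𝕜 (Fin n)) :
    pairC x u = ofStateL m n (cplx x) + matL (Matrix.fromRows 0 1) (cplx u) := by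
  apply WithLp.ofLp_injective
  rw [ofLp_pairC, WithLp.ofLp_add, ofStateL, ofLp_matL, ofLp_matL, Matrix.fromRows_mulVec,
    Matrix.fromRows_mulVec, Matrix.one_mulVec, Matrix.one_mulVec, Matrix.zero_mulVec,
    Matrix.zero_mulVec]
  ext i
  rcases i with i | i <;> simp

theorem stateL_pairC (x : EuclideanSpace 𝕜 (Fin m)) (u : EuclideanSpace 𝕜 (Fin n)) :
    stateL m n (pairC x u) = cplx x := by
  apply WithLp.ofLp_injective
  rw [ofLp_stateL, ofLp_pairC, Sum.elim_comp_inl]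

theorem dynL_pairC (A : Matrix (Fin m) (Fin m) 𝕜) (B : Matrix (Fin m) (Fin n) 𝕜)
    (x : EuclideanSpace 𝕜 (Fin m)) (u : EuclideanSpace 𝕜 (Fin n)) :
    dynL A B (pairC x u) = cplx (A.toEuclideanLin x + B.toEuclideanLin u) := by
  rw [map_add, ← matL_cplx, ← matL_cplx]
  apply WithLp.ofLp_injective
  rw [ofLp_dynL, ofLp_pairC, Sum.elim_comp_inl, Sum.elim_comp_inr]
  rfl

theorem inner_supplyL_pairC (Q : Matrix (Fin m) (Fin m) 𝕜) (S : Matrix (Fin n) (Fin m) 𝕜)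
    (R : Matrix (Fin n) (Fin n) 𝕜)
    (x y : EuclideanSpace 𝕜 (Fin m)) (u v : EuclideanSpace 𝕜 (Fin n)) :
    inner ℂ (supplyL Q S R (pairC x u)) (pairC y v) = RCLike.map 𝕜 ℂ (inner 𝕜
      ((Matrix.fromBlocks Q S.conjTranspose S R).toEuclideanLin (join x u)) (join y v)) := by
  rw [pairC, supplyL, matL_cplx, pairC, inner_cplx]

theorem re_inner_supplyL_pairC (Q : Matrix (Fin m) (Fin m) 𝕜) (S : Matrix (Fin n) (Fin m) 𝕜)
    (R : Matrix (Fin n) (Fin n) 𝕜)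
    (x : EuclideanSpace 𝕜 (Fin m)) (u : EuclideanSpace 𝕜 (Fin n)) :
    (inner ℂ (supplyL Q S R (pairC x u)) (pairC x u)).re = supplyRate Q S R x u := by
  rw [inner_supplyL_pairC, re_map_complex, supplyRate_eq_re_inner_join]

theorem IsTrajectory.intervalIntegrable {A : Matrix (Fin m) (Fin m) 𝕜}
    {B : Matrix (Fin m) (Fin n) 𝕜} {x : ℝ → EuclideanSpace 𝕜 (Fin m)}
    {u : ℝ → EuclideanSpace 𝕜 (Fin n)} (h : IsTrajectory A B x u) {t : ℝ} (ht : 0 ≤ t) :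
    IntervalIntegrable (fun s => A.toEuclideanLin (x s) + B.toEuclideanLin (u s)) volume 0 t := by
  have h1 : ContinuousOn (fun s => A.toEuclideanLin (x s)) (Set.Icc 0 t) :=
    (LinearMap.continuous_of_finiteDimensional A.toEuclideanLin).comp_continuousOn
      (h.continuousOn_state.mono Set.Icc_subset_Ici_self)
  have h2 : MemLp (fun s => B.toEuclideanLin (u s)) 2 (volume.restrict (Set.Icc 0 t)) :=
    ContinuousLinearMap.comp_memLp' (LinearMap.toContinuousLinearMap B.toEuclideanLin)
      (h.memLp_input t ht)
  exact intervalIntegrable_of_integrable_Icc ht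
    (Integrable.add h1.integrableOn_Icc (h2.integrable one_le_two))

theorem IsTrajectory.locL2 {A : Matrix (Fin m) (Fin m) 𝕜} {B : Matrix (Fin m) (Fin n) 𝕜}
    {x : ℝ → EuclideanSpace 𝕜 (Fin m)} {u : ℝ → EuclideanSpace 𝕜 (Fin n)}
    (h : IsTrajectory A B x u) : LocL2 (fun t => pairC (x t) (u t)) := by
  have hx : LocL2 (fun t => cplx (x t)) := locL2_of_continuousOn fun T _ =>
    cplx.continuous.comp_continuousOn (h.continuousOn_state.mono Set.Icc_subset_Ici_self)
  have hu : LocL2 (fun t => cplx (u t)) := by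
    intro T hT
    have := ContinuousLinearMap.comp_memLp' (cplx (𝕜 := 𝕜) (k := Fin n)) (h.memLp_input T hT)
    exact this
  simp only [pairC_eq_add]
  exact (hx.clm _).add (hu.clm _)

theorem IsTrajectory.isBehavior {A : Matrix (Fin m) (Fin m) 𝕜} {B : Matrix (Fin m) (Fin n) 𝕜}
    {x : ℝ → EuclideanSpace 𝕜 (Fin m)} {u : ℝ → EuclideanSpace 𝕜 (Fin n)}
    (h : IsTrajectory A B x u) :
    IsBehavior (stateL m n) (dynL A B) (fun t => pairC (x t) (u t)) := by
  refine ⟨⟨fun T hT => (h.locL2.clm (dynL A B)).intervalIntegrable hT, fun t ht => ?_⟩, h.locL2⟩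
  simp only [stateL_pairC, dynL_pairC]
  have h1 := ContinuousLinearMap.intervalIntegral_comp_comm (cplx (𝕜 := 𝕜) (k := Fin m))
    (h.intervalIntegrable ht)
  rw [h1, ← map_add, ← h.state_eq t ht]

theorem IsBehavior.add {E W : Type*} [NormedAddCommGroup E] [InnerProductSpace ℂ E]
    [FiniteDimensional ℂ E] [NormedAddCommGroup W] [InnerProductSpace ℂ W] [FiniteDimensional ℂ W]
    [CompleteSpace E] [CompleteSpace W] {X D : W →L[ℂ] E} {w v : ℝ → W} (hw : IsBehavior X D w)
    (hv : IsBehavior X D v) : IsBehavior X D (fun t => w t + v t) where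
  isPrimitive := by
    simp only [map_add]
    exact hw.isPrimitive.add hv.isPrimitive
  locL2 := hw.locL2.add hv.locL2

theorem IsBehavior.smul {E W : Type*} [NormedAddCommGroup E] [InnerProductSpace ℂ E]
    [FiniteDimensional ℂ E] [NormedAddCommGroup W] [InnerProductSpace ℂ W] [FiniteDimensional ℂ W]
    [CompleteSpace E] [CompleteSpace W] {X D : W →L[ℂ] E} {w : ℝ → W} (hw : IsBehavior X D w)
    (c : ℂ) : IsBehavior X D (fun t => c • w t) where
  isPrimitive := by
    simp only [map_smul]
    exact hw.isPrimitive.clmC (c • ContinuousLinearMap.id ℂ E)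
  locL2 := hw.locL2.clm (c • ContinuousLinearMap.id ℂ W)

/-- Over ℝ, trajectories from the real and imaginary parts of the initial state are superposed as x
+ i y. The cross terms of the supply have zero real part, so the two energies simply add. -/
theorem MinimallyStable.isMinimallyStable {A : Matrix (Fin m) (Fin m) 𝕜}
    {B : Matrix (Fin m) (Fin n) 𝕜} {Q : Matrix (Fin m) (Fin m) 𝕜} {S : Matrix (Fin n) (Fin m) 𝕜}
    {R : Matrix (Fin n) (Fin n) 𝕜} (h : MinimallyStable A B Q S R) :
    IsMinimallyStable (stateL m n) (dynL A B) (supplyL Q S R) := by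
  intro x₀
  rcases RCLike.I_eq_zero_or_im_I_eq_one (K := 𝕜) with hI | hI
  · have him := RCLike.im_eq_zero (K := 𝕜) hI
    obtain ⟨x, u, hxu, hx0, hE, hlim⟩ := h (WithLp.toLp 2 fun i => ((x₀ i).re : 𝕜))
    obtain ⟨y, v, hyv, hy0, hE', hlim'⟩ := h (WithLp.toLp 2 fun i => ((x₀ i).im : 𝕜))
    have hw := hxu.isBehavior
    have hv := hyv.isBehavior
    refine ⟨_, hw.add (hv.smul Complex.I), ?_, fun t ht => ?_, ?_⟩
    · simp only [map_add, map_smul, stateL_pairC, hx0, hy0]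
      ext i
      simp only [PiLp.add_apply, PiLp.smul_apply, cplx_apply, smul_eq_mul]
      apply Complex.ext <;> simp [RCLike.map_apply]
    · have h1 : ∀ s, (inner ℂ (supplyL Q S R (pairC (x s) (u s) + Complex.I • pairC (y s) (v s)))
          (pairC (x s) (u s) + Complex.I • pairC (y s) (v s))).re
          = supplyRate Q S R (x s) (u s) + supplyRate Q S R (y s) (v s) := by
        intro s
        have h2 : (inner ℂ (supplyL Q S R (pairC (x s) (u s))) (pairC (y s) (v s))).im = 0 := by
          rw [inner_supplyL_pairC, im_map_complex, him]
        have h3 : (inner ℂ (supplyL Q S R (pairC (y s) (v s))) (pairC (x s) (u s))).im = 0 := by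
          rw [inner_supplyL_pairC, im_map_complex, him]
        rw [← re_inner_supplyL_pairC, ← re_inner_supplyL_pairC, map_add, map_smul, inner_add_left,
          inner_add_right, inner_add_right, inner_smul_left, inner_smul_right, inner_smul_left,
          inner_smul_right]
        simp [h2, h3]
      simp only [h1]
      have h4 := hw.locL2.clm (supplyL Q S R) |>.re_inner hw.locL2 ht
      have h5 := hv.locL2.clm (supplyL Q S R) |>.re_inner hv.locL2 ht
      simp only [re_inner_supplyL_pairC] at h4 h5
      rw [intervalIntegral.integral_add h4 h5]
      exact add_nonpos (hE t ht) (hE' t ht)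
    · simp only [map_add, map_smul, stateL_pairC]
      have h1 := ((cplx (𝕜 := 𝕜) (k := Fin m)).continuous.tendsto 0).comp hlim
      have h2 := (((cplx (𝕜 := 𝕜) (k := Fin m)).continuous.tendsto 0).comp hlim').const_smul
        Complex.I
      rw [map_zero] at h1 h2
      simpa using h1.add h2
  · obtain ⟨x, u, hxu, hx0, hE, hlim⟩ :=
      h (WithLp.toLp 2 fun i => ((x₀ i).re : 𝕜) + ((x₀ i).im : 𝕜) * RCLike.I)
    refine ⟨_, hxu.isBehavior, ?_, fun t ht => ?_, ?_⟩
    · simp only [stateL_pairC, hx0]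
      ext i
      rw [cplx_apply]
      apply Complex.ext
      · rw [re_map_complex]; simp
      · rw [im_map_complex]; simp [hI]
    · simp only [re_inner_supplyL_pairC]
      exact hE t ht
    · simp only [stateL_pairC]
      have h1 := ((cplx (𝕜 := 𝕜) (k := Fin m)).continuous.tendsto 0).comp hlim
      rwa [map_zero] at h1

/-- The frequency domain inequality implies hyperstability. -/
theorem FDI.hyperstable {A : Matrix (Fin m) (Fin m) 𝕜}
    {B : Matrix (Fin m) (Fin n) 𝕜} {Q : Matrix (Fin m) (Fin m) 𝕜} {S : Matrix (Fin n) (Fin m) 𝕜}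
    {R : Matrix (Fin n) (Fin n) 𝕜} (hF : FDI A B Q S R) (hQ : Q.IsHermitian) (hR : R.IsHermitian)
    (hmin : MinimallyStable A B Q S R) (hdet : PopovDetNonzero A B Q S R) :
    Hyperstable A B Q S R := by
  obtain ⟨C, hC, hbound⟩ := exists_hyperstable_bound_of_FDI hQ hR hmin.isMinimallyStable hdet hF
  refine ⟨C, hC, fun x u β hxu hβ hE t ht => ?_⟩
  have h1 := hbound _ β hβ hxu.isBehavior (fun r hr => by
    simp only [re_inner_supplyL_pairC]
    exact hE r hr) t ht
  simpa only [stateL_pairC, norm_cplx] using h1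

end Complexification

/-! ### Exponential trajectories and their energy -/

section Necessity

variable {𝕜 : Type*} [RCLike 𝕜] {m n : ℕ}

/-- The coordinatewise projection of complex vectors to `𝕜`-vectors. -/
noncomputable def deC {k : Type*} [Fintype k] : EuclideanSpace ℂ k →L[ℝ] EuclideanSpace 𝕜 k :=
  LinearMap.toContinuousLinearMap
    { toFun := fun x => WithLp.toLp 2 fun i => RCLike.map ℂ 𝕜 (x i)
      map_add' := fun x y => by
        ext i
        exact map_add (RCLike.map ℂ 𝕜) (x i) (y i)
      map_smul' := fun c x => by
        ext i
        exact map_smul (RCLike.map ℂ 𝕜) c (x i) }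

theorem ofLp_deC {k : Type*} [Fintype k] (x : EuclideanSpace ℂ k) :
    (deC x : EuclideanSpace 𝕜 k).ofLp = RCLike.map ℂ 𝕜 ∘ x.ofLp := rfl

/-- The projection ℂ → 𝕜 (the real part when 𝕜 is ℝ) is linear over 𝕜, so it commutes with A and B
and sends complex exponential solutions to genuine 𝕜-trajectories. -/
theorem map_map_mul (a : 𝕜) (z : ℂ) :
    RCLike.map ℂ 𝕜 (RCLike.map 𝕜 ℂ a * z) = a * RCLike.map ℂ 𝕜 z := by
  rcases RCLike.I_eq_zero_or_im_I_eq_one (K := 𝕜) with h | h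
  · have hi := RCLike.im_eq_zero (K := 𝕜) h
    apply RCLike.ext <;> simp [RCLike.map_apply, RCLike.mul_re, hi, h]
  · apply RCLike.ext <;> simp [RCLike.map_apply, RCLike.mul_re, RCLike.mul_im, h]

theorem deC_matL {k l : Type*} [Fintype k] [Fintype l] [DecidableEq l] (N : Matrix k l 𝕜)
    (z : EuclideanSpace ℂ l) : deC (matL (toComplex N) z) = N.toEuclideanLin (deC z) := by
  apply WithLp.ofLp_injective
  rw [ofLp_deC, ofLp_matL]
  change _ = N.mulVec (RCLike.map ℂ 𝕜 ∘ z.ofLp)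
  ext i
  simp only [Matrix.mulVec, dotProduct, toComplex, Matrix.map_apply, Function.comp_apply,
    map_sum, map_map_mul]

theorem cplx_deC_of_im_I {k : Type*} [Fintype k] (hI : RCLike.im (RCLike.I : 𝕜) = 1)
    (z : EuclideanSpace ℂ k) : cplx (deC z : EuclideanSpace 𝕜 k) = z := by
  ext i
  rw [cplx_apply, ofLp_deC]
  apply Complex.ext
  · rw [re_map_complex]; simp [RCLike.map_apply]
  · rw [im_map_complex]; simp [RCLike.map_apply, hI]

theorem cplx_deC_of_I {k : Type*} [Fintype k] (hI : (RCLike.I : 𝕜) = 0)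
    (z : EuclideanSpace ℂ k) :
    cplx (deC z : EuclideanSpace 𝕜 k) - Complex.I • cplx (deC (Complex.I • z) : EuclideanSpace 𝕜 k)
      = z := by
  have him := RCLike.im_eq_zero (K := 𝕜) hI
  ext i
  simp only [PiLp.sub_apply, PiLp.smul_apply, cplx_apply, ofLp_deC, Function.comp_apply,
    smul_eq_mul]
  apply Complex.ext <;> simp [RCLike.map_apply, hI]

/-- The quadratic form of the supply rate on pairs. -/
noncomputable def supplyForm (Q : Matrix (Fin m) (Fin m) 𝕜) (S : Matrix (Fin n) (Fin m) 𝕜)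
    (R : Matrix (Fin n) (Fin n) 𝕜) (p p' : EuclideanSpace 𝕜 (Fin m ⊕ Fin n)) : ℝ :=
  RCLike.re (inner 𝕜 ((Matrix.fromBlocks Q S.conjTranspose S R).toEuclideanLin p) p')

theorem continuous_supplyForm {T : Type*} [TopologicalSpace T] (Q : Matrix (Fin m) (Fin m) 𝕜)
    (S : Matrix (Fin n) (Fin m) 𝕜) (R : Matrix (Fin n) (Fin n) 𝕜)
    {f g : T → EuclideanSpace 𝕜 (Fin m ⊕ Fin n)} (hf : Continuous f) (hg : Continuous g) :
    Continuous fun t => supplyForm Q S R (f t) (g t) :=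
  RCLike.continuous_re.comp (((LinearMap.continuous_of_finiteDimensional
    (Matrix.fromBlocks Q S.conjTranspose S R).toEuclideanLin).comp hf).inner hg)

theorem supplyForm_real_combination (Q : Matrix (Fin m) (Fin m) 𝕜) (S : Matrix (Fin n) (Fin m) 𝕜)
    (R : Matrix (Fin n) (Fin n) 𝕜) (p p' : EuclideanSpace 𝕜 (Fin m ⊕ Fin n)) (a b : ℝ) :
    supplyForm Q S R (a • p + b • p') (a • p + b • p') = a ^ 2 * supplyForm Q S R p p
      + a * b * (supplyForm Q S R p p' + supplyForm Q S R p' p) + b ^ 2 * supplyForm Q S R p' p' := by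
  simp only [supplyForm, RCLike.real_smul_eq_coe_smul (K := 𝕜), map_add, map_smul, inner_add_left,
    inner_add_right, inner_smul_left, inner_smul_right, RCLike.conj_ofReal, RCLike.re_ofReal_mul]
  ring

/-- The left side is twice the mean supply over one oscillation. Over ℝ the two terms come from the
real and imaginary parts of w and add up to the Hermitian form; over ℂ each equals it. -/
theorem supplyForm_add_neg {Q : Matrix (Fin m) (Fin m) 𝕜} {S : Matrix (Fin n) (Fin m) 𝕜}
    {R : Matrix (Fin n) (Fin n) 𝕜} {w : EuclideanSpace ℂ (Fin m ⊕ Fin n)}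
    (hw : (inner ℂ (supplyL Q S R w) w).re < 0) :
    supplyForm Q S R (deC w) (deC w)
      + supplyForm Q S R (deC (Complex.I • w)) (deC (Complex.I • w)) < 0 := by
  have hform : ∀ p p' : EuclideanSpace 𝕜 (Fin m ⊕ Fin n),
      inner ℂ (supplyL Q S R (cplx p)) (cplx p') = RCLike.map 𝕜 ℂ (inner 𝕜
        ((Matrix.fromBlocks Q S.conjTranspose S R).toEuclideanLin p) p') := fun p p' => by
    rw [supplyL, matL_cplx, inner_cplx]
  have hre : ∀ p p' : EuclideanSpace 𝕜 (Fin m ⊕ Fin n),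
      supplyForm Q S R p p' = (inner ℂ (supplyL Q S R (cplx p)) (cplx p')).re := fun p p' => by
    rw [hform, re_map_complex, supplyForm]
  rcases RCLike.I_eq_zero_or_im_I_eq_one (K := 𝕜) with hI | hI
  · have him := RCLike.im_eq_zero (K := 𝕜) hI
    have h0 : ∀ p p' : EuclideanSpace 𝕜 (Fin m ⊕ Fin n),
        (inner ℂ (supplyL Q S R (cplx p)) (cplx p')).im = 0 := fun p p' => by
      rw [hform, im_map_complex, him]
    rw [← cplx_deC_of_I hI w] at hw
    rw [hre, hre]
    set p : EuclideanSpace 𝕜 (Fin m ⊕ Fin n) := deC w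
    set p' : EuclideanSpace 𝕜 (Fin m ⊕ Fin n) := deC (Complex.I • w)
    rw [map_sub, map_smul, inner_sub_left,
      inner_sub_right, inner_sub_right, inner_smul_left, inner_smul_right, inner_smul_left,
      inner_smul_right] at hw
    simpa [h0] using hw
  · rw [hre, hre, cplx_deC_of_im_I hI, cplx_deC_of_im_I hI, map_smul, inner_smul_left,
      inner_smul_right]
    simpa [← mul_assoc] using hw

/-- The amplitude, polynomial in `s`, of the exponential trajectory with rate `s`. -/
noncomputable def expVec (A : Matrix (Fin m) (Fin m) 𝕜) (B : Matrix (Fin m) (Fin n) 𝕜) (s : ℂ)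
    (v : Fin n → ℂ) : EuclideanSpace ℂ (Fin m ⊕ Fin n) :=
  WithLp.toLp 2 (Sum.elim ((charMat A s).adjugate.mulVec ((toComplex B).mulVec v))
    ((charMat A s).det • v))

theorem continuous_expVec (A : Matrix (Fin m) (Fin m) 𝕜) (B : Matrix (Fin m) (Fin n) 𝕜) :
    Continuous fun p : ℂ × (Fin n → ℂ) => expVec A B p.1 p.2 := by
  have h1 : Continuous fun p : ℂ × (Fin n → ℂ) => charMat A p.1 := by
    unfold charMat
    fun_prop
  refine (PiLp.continuous_toLp 2 _).comp (continuous_pi fun i => ?_)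
  rcases i with i | i
  · exact (continuous_apply i).comp (h1.matrix_adjugate.matrix_mulVec
      (continuous_const.matrix_mulVec continuous_snd))
  · exact h1.matrix_det.mul ((continuous_apply i).comp continuous_snd)

theorem smul_stateL_expVec (A : Matrix (Fin m) (Fin m) 𝕜) (B : Matrix (Fin m) (Fin n) 𝕜) (s : ℂ)
    (v : Fin n → ℂ) : s • stateL m n (expVec A B s v) = dynL A B (expVec A B s v) := by
  apply WithLp.ofLp_injective
  rw [WithLp.ofLp_smul, ofLp_dynL, ofLp_stateL, expVec, Sum.elim_comp_inl, Sum.elim_comp_inr,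
    Matrix.mulVec_smul, ← sub_eq_iff_eq_add', ← charMat_mulVec, Matrix.mulVec_mulVec,
    Matrix.mul_adjugate, Matrix.smul_mulVec, Matrix.one_mulVec]

theorem ofLp_expVec {A : Matrix (Fin m) (Fin m) 𝕜} (B : Matrix (Fin m) (Fin n) 𝕜) {s : ℂ}
    (hs : (charMat A s).det ≠ 0) (v : Fin n → ℂ) :
    (expVec A B s v).ofLp = (frequencyColumn A B s).mulVec ((charMat A s).det • v) := by
  have h := (smul_stateL_eq_dynL_iff hs _).1 (smul_stateL_expVec A B s v)
  rw [h]
  congr 1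

/-- If the state vanished, the equation would reduce to B u = 0 with u = det(s - A) v, contradicting
B v ≠ 0. -/
theorem stateL_expVec_ne_zero {A : Matrix (Fin m) (Fin m) 𝕜} {B : Matrix (Fin m) (Fin n) 𝕜} {s : ℂ}
    (hs : (charMat A s).det ≠ 0) {v : Fin n → ℂ} (hv : (toComplex B).mulVec v ≠ 0) :
    stateL m n (expVec A B s v) ≠ 0 := by
  intro h
  have h1 := smul_stateL_expVec A B s v
  rw [h, smul_zero] at h1
  have h2 := congrArg WithLp.ofLp h1
  rw [ofLp_dynL, ← ofLp_stateL, h, expVec, Sum.elim_comp_inr, WithLp.ofLp_zero,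
    Matrix.mulVec_zero, zero_add, Matrix.mulVec_smul] at h2
  exact hv ((smul_eq_zero.1 h2.symm).resolve_left hs)

/-- The input component of a pair (state, input). -/
noncomputable def inputL (m n : ℕ) : EuclideanSpace ℂ (Fin m ⊕ Fin n) →L[ℂ] EuclideanSpace ℂ (Fin n) :=
  matL (Matrix.fromCols 0 1)

theorem ofLp_inputL (w : EuclideanSpace ℂ (Fin m ⊕ Fin n)) :
    (inputL m n w).ofLp = w.ofLp ∘ Sum.inr := by
  rw [inputL, ofLp_matL, Matrix.fromCols_mulVec, Matrix.one_mulVec, Matrix.zero_mulVec, zero_add]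

theorem join_deC (w : EuclideanSpace ℂ (Fin m ⊕ Fin n)) :
    join (deC (stateL m n w) : EuclideanSpace 𝕜 (Fin m)) (deC (inputL m n w)) = deC w := by
  apply WithLp.ofLp_injective
  rw [ofLp_deC, join, ofLp_deC, ofLp_deC, ofLp_stateL, ofLp_inputL, ← Function.comp_assoc,
    ← Function.comp_assoc, Sum.elim_comp_inl_inr]

theorem hasDerivAt_exp_smul {F : Type*} [NormedAddCommGroup F] [NormedSpace ℂ F] (s : ℂ) (y : F)
    (t : ℝ) : HasDerivAt (fun t : ℝ => Complex.exp (s * t) • y) (Complex.exp (s * t) • s • y) t := by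
  have h1 : HasDerivAt (fun t : ℝ => s * (t : ℂ)) s t := by
    simpa using (Complex.ofRealCLM.hasDerivAt (x := t)).const_mul s
  rw [smul_smul]
  exact h1.cexp.smul_const y

/-- Exponential trajectories. -/
theorem isTrajectory_exp {A : Matrix (Fin m) (Fin m) 𝕜} {B : Matrix (Fin m) (Fin n) 𝕜} {s : ℂ}
    {w : EuclideanSpace ℂ (Fin m ⊕ Fin n)} (hw : s • stateL m n w = dynL A B w) :
    IsTrajectory A B (fun t => deC (stateL m n (Complex.exp (s * t) • w)))
      (fun t => deC (inputL m n (Complex.exp (s * t) • w))) := by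
  have hc : Continuous fun t : ℝ => Complex.exp (s * t) • w := by fun_prop
  have hder : ∀ t : ℝ, HasDerivAt
      (fun t : ℝ => (deC (stateL m n (Complex.exp (s * t) • w)) : EuclideanSpace 𝕜 (Fin m)))
      (A.toEuclideanLin (deC (stateL m n (Complex.exp (s * t) • w)))
        + B.toEuclideanLin (deC (inputL m n (Complex.exp (s * t) • w)))) t := by
    intro t
    have h1 := (deC (𝕜 := 𝕜) (k := Fin m)).hasFDerivAt.comp_hasDerivAt t
      (hasDerivAt_exp_smul s (stateL m n w) t)
    rw [hw, ← map_smul] at h1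
    simp only [map_smul (stateL m n)]
    refine h1.congr_deriv ?_
    rw [← map_smul (stateL m n), ← deC_matL, ← deC_matL, ← map_add]
    congr 1
    apply WithLp.ofLp_injective
    rw [WithLp.ofLp_add, ofLp_dynL, ofLp_matL, ofLp_matL, ofLp_stateL, ofLp_inputL]
  have hcx : Continuous fun t : ℝ =>
      (deC (stateL m n (Complex.exp (s * t) • w)) : EuclideanSpace 𝕜 (Fin m)) :=
    deC.continuous.comp ((stateL m n).continuous.comp hc)
  have hcu : Continuous fun t : ℝ =>
      (deC (inputL m n (Complex.exp (s * t) • w)) : EuclideanSpace 𝕜 (Fin n)) :=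
    deC.continuous.comp ((inputL m n).continuous.comp hc)
  refine ⟨fun T hT => ?_, hcx.continuousOn, fun t ht => ?_⟩
  · have h1 : LocL2 fun t : ℝ => inputL m n (Complex.exp (s * t) • w) :=
      locL2_of_continuousOn fun _ _ => ((inputL m n).continuous.comp hc).continuousOn
    have h2 := ContinuousLinearMap.comp_memLp' (deC (𝕜 := 𝕜) (k := Fin n)) (h1 T hT)
    exact h2
  · rw [intervalIntegral.integral_eq_sub_of_hasDerivAt (fun r _ => hder r)]
    · abel
    · exact (((LinearMap.continuous_of_finiteDimensional A.toEuclideanLin).comp hcx).add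
        ((LinearMap.continuous_of_finiteDimensional B.toEuclideanLin).comp hcu)).intervalIntegrable
        _ _

theorem deC_exp_smul {k : Type*} [Fintype k] (δ ω t : ℝ) (w : EuclideanSpace ℂ k) :
    (deC (Complex.exp ((δ + Complex.I * ω) * t) • w) : EuclideanSpace 𝕜 k)
      = (Real.exp (δ * t) * Real.cos (ω * t)) • deC w
        + (Real.exp (δ * t) * Real.sin (ω * t)) • deC (Complex.I • w) := by
  have h1 : Complex.exp ((δ + Complex.I * ω) * t) = ((Real.exp (δ * t) * Real.cos (ω * t) : ℝ) : ℂ)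
      + ((Real.exp (δ * t) * Real.sin (ω * t) : ℝ) : ℂ) * Complex.I := by
    rw [show (δ + Complex.I * ω) * (t : ℂ) = ((δ * t : ℝ) : ℂ) + ((ω * t : ℝ) : ℂ) * Complex.I by
      push_cast; ring, Complex.exp_add, Complex.exp_mul_I]
    push_cast
    ring
  rw [h1, add_smul, mul_smul, Complex.coe_smul, Complex.coe_smul, map_add, map_smul, map_smul]

/-- An exponentially growing oscillation with negative mean and slow growth has an integral
bounded above. -/
theorem exists_integral_exp_le {K L N δ ω : ℝ} (hδ : 0 < δ)
    (h : δ * ‖(L - N * Complex.I : ℂ)‖ + K * ‖(δ + Complex.I * ω : ℂ)‖ ≤ 0) :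
    ∃ β : ℝ, 0 ≤ β ∧ ∀ t : ℝ, ∫ r in (0 : ℝ)..t, Real.exp (2 * δ * r)
      * (K + L * Real.cos (2 * ω * r) + N * Real.sin (2 * ω * r)) ≤ β ^ 2 := by
  set s : ℂ := δ + Complex.I * ω with hs
  set z : ℂ := L - N * Complex.I with hz
  have hs0 : s ≠ 0 := by
    intro h0
    have := congrArg Complex.re h0
    simp [hs] at this
    exact hδ.ne' this
  have hsn : 0 < ‖s‖ := norm_pos_iff.2 hs0
  -- An explicit primitive. Its oscillating part has amplitude ‖z‖ / (2‖s‖) times the exponential,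
  -- so the hypothesis says exactly that the mean part K / (2δ) outweighs it; hence Φ ≤ 0 and β² =
  -- -Φ 0 suffices.
  let Φ : ℝ → ℝ := fun r => K / (2 * δ) * Real.exp (2 * δ * r)
    + (Complex.exp (2 * s * r) • (z / (2 * s))).re
  have hexp : ∀ r : ℝ, (Complex.exp (2 * s * r) * z).re = Real.exp (2 * δ * r)
      * (L * Real.cos (2 * ω * r) + N * Real.sin (2 * ω * r)) := by
    intro r
    have h1 : Complex.exp (2 * s * r) = ((Real.exp (2 * δ * r) * Real.cos (2 * ω * r) : ℝ) : ℂ)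
        + ((Real.exp (2 * δ * r) * Real.sin (2 * ω * r) : ℝ) : ℂ) * Complex.I := by
      rw [show 2 * s * (r : ℂ) = ((2 * δ * r : ℝ) : ℂ) + ((2 * ω * r : ℝ) : ℂ) * Complex.I by
        rw [hs]; push_cast; ring, Complex.exp_add, Complex.exp_mul_I]
      push_cast
      ring
    rw [h1, hz, Complex.mul_re]
    simp only [Complex.add_re, Complex.add_im, Complex.sub_re, Complex.sub_im, Complex.mul_re,
      Complex.mul_im, Complex.ofReal_re, Complex.ofReal_im, Complex.I_re, Complex.I_im]
    ring
  have hΦ : ∀ r, HasDerivAt Φ (Real.exp (2 * δ * r)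
      * (K + L * Real.cos (2 * ω * r) + N * Real.sin (2 * ω * r))) r := by
    intro r
    have h1 : HasDerivAt (fun r : ℝ => 2 * δ * r) (2 * δ) r := by
      simpa using (hasDerivAt_id r).const_mul (2 * δ)
    have h2 := (h1.exp.const_mul (K / (2 * δ)))
    have h3 := Complex.reCLM.hasFDerivAt.comp_hasDerivAt r
      (hasDerivAt_exp_smul (2 * s) (z / (2 * s)) r)
    refine (h2.add h3).congr_deriv ?_
    have h4 : (2 * s) • (z / (2 * s)) = z := by
      rw [smul_eq_mul]; field_simp
    rw [h4, smul_eq_mul, Complex.reCLM_apply, hexp]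
    field_simp
    ring
  have hΦle : ∀ r, Φ r ≤ 0 := by
    intro r
    have h1 : (Complex.exp (2 * s * r) • (z / (2 * s))).re
        ≤ Real.exp (2 * δ * r) * (‖z‖ / (2 * ‖s‖)) := by
      refine (Complex.re_le_norm _).trans ?_
      rw [norm_smul, Complex.norm_exp, norm_div, norm_mul, Complex.norm_ofNat]
      refine le_of_eq ?_
      congr 2
      simp [hs]
    have h2 : K / (2 * δ) + ‖z‖ / (2 * ‖s‖) ≤ 0 := by
      rw [div_add_div _ _ (by positivity) (by positivity)]
      refine div_nonpos_of_nonpos_of_nonneg ?_ (by positivity)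
      linarith
    have h3 := mul_nonpos_of_nonneg_of_nonpos (Real.exp_pos (2 * δ * r)).le h2
    change K / (2 * δ) * Real.exp (2 * δ * r) + _ ≤ 0
    linarith
  refine ⟨√(-Φ 0), Real.sqrt_nonneg _, fun t => ?_⟩
  rw [Real.sq_sqrt (by linarith [hΦle 0]),
    intervalIntegral.integral_eq_sub_of_hasDerivAt (fun r _ => hΦ r)
      (Continuous.intervalIntegrable (by fun_prop) _ _)]
  linarith [hΦle t]

/-- Dividing by exp(δt) leaves a periodic function tending to zero, hence identically zero. Time
zero and a quarter period read off the two coefficients. -/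
theorem eq_zero_of_exp_oscillation_le {F : Type*} [NormedAddCommGroup F] [NormedSpace ℝ F] {ξ ξ' : F}
    {δ ω C : ℝ} (hδ : 0 < δ) (hω : ω ≠ 0)
    (h : ∀ t, 0 ≤ t → ‖(Real.exp (δ * t) * Real.cos (ω * t)) • ξ
      + (Real.exp (δ * t) * Real.sin (ω * t)) • ξ'‖ ≤ C) : ξ = 0 ∧ ξ' = 0 := by
  let g : ℝ → F := fun t => Real.cos (ω * t) • ξ + Real.sin (ω * t) • ξ'
  have hlim : Tendsto g atTop (𝓝 0) := by
    have h1 : Tendsto (fun t => Real.exp (-(δ * t)) * C) atTop (𝓝 0) := by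
      rw [← zero_mul C]
      refine Tendsto.mul_const C (Real.tendsto_exp_neg_atTop_nhds_zero.comp ?_)
      exact tendsto_id.const_mul_atTop hδ
    refine squeeze_zero_norm' ?_ h1
    filter_upwards [eventually_ge_atTop 0] with t ht
    have h2 := h t ht
    rw [mul_smul, mul_smul, ← smul_add, norm_smul, Real.norm_of_nonneg (Real.exp_pos _).le] at h2
    rw [Real.exp_neg, inv_mul_eq_div, le_div_iff₀ (Real.exp_pos _), mul_comm]
    exact h2
  have hper : Function.Periodic g (2 * Real.pi / |ω|) := by
    intro t
    have h1 : ω * (t + 2 * Real.pi / |ω|) = ω * t + 2 * Real.pi ∨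
        ω * (t + 2 * Real.pi / |ω|) = ω * t - 2 * Real.pi := by
      rcases abs_cases ω with ⟨h, _⟩ | ⟨h, _⟩
      · left; rw [h]; field_simp
      · right; rw [h]; field_simp; ring
    rcases h1 with h1 | h1
    · simp only [g, h1, Real.cos_add_two_pi, Real.sin_add_two_pi]
    · simp only [g, h1, Real.cos_sub_two_pi, Real.sin_sub_two_pi]
  have hg : ∀ t, g t = 0 := by
    intro t
    have hT : 0 < 2 * Real.pi / |ω| := by positivity
    have h1 : Tendsto (fun k : ℕ => t + k * (2 * Real.pi / |ω|)) atTop atTop :=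
      tendsto_atTop_add_const_left _ _ (tendsto_natCast_atTop_atTop.atTop_mul_const hT)
    refine tendsto_nhds_unique ?_ (hlim.comp h1)
    have h2 : (g ∘ fun k : ℕ => t + k * (2 * Real.pi / |ω|)) = fun _ => g t := by
      funext k
      exact hper.nat_mul k t
    rw [h2]
    exact tendsto_const_nhds
  constructor
  · simpa [g] using hg 0
  · have h1 := hg (Real.pi / 2 / ω)
    simp only [g] at h1
    rw [mul_div_cancel₀ _ hω] at h1
    simpa using h1

theorem eq_zero_of_deC_eq_zero {k : Type*} [Fintype k] {z : EuclideanSpace ℂ k}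
    (h1 : (deC z : EuclideanSpace 𝕜 k) = 0) (h2 : (deC (Complex.I • z) : EuclideanSpace 𝕜 k) = 0) :
    z = 0 := by
  rcases RCLike.I_eq_zero_or_im_I_eq_one (K := 𝕜) with hI | hI
  · rw [← cplx_deC_of_I hI z, h1, h2]; simp
  · rw [← cplx_deC_of_im_I hI z, h1, map_zero]

end Necessity

/-! ### Hyperstability implies the frequency inequality -/

section Necessity

variable {𝕜 : Type*} [RCLike 𝕜] {m n : ℕ} {A : Matrix (Fin m) (Fin m) 𝕜}
  {B : Matrix (Fin m) (Fin n) 𝕜} {Q : Matrix (Fin m) (Fin m) 𝕜} {S : Matrix (Fin n) (Fin m) 𝕜}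
  {R : Matrix (Fin n) (Fin n) 𝕜}

/-- Hyperstability excludes slowly growing exponential trajectories of negative mean energy. -/
theorem Hyperstable.stateL_eq_zero (h : Hyperstable A B Q S R) {δ ω : ℝ} (hδ : 0 < δ) (hω : ω ≠ 0)
    {w : EuclideanSpace ℂ (Fin m ⊕ Fin n)}
    (hw : (δ + Complex.I * ω : ℂ) • stateL m n w = dynL A B w) {p p' : EuclideanSpace 𝕜 (Fin m ⊕ Fin n)}
    (hp : p = deC w) (hp' : p' = deC (Complex.I • w))
    (hE : δ * ‖((((supplyForm Q S R p p - supplyForm Q S R p' p') / 2 : ℝ) : ℂ)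
        - (((supplyForm Q S R p p' + supplyForm Q S R p' p) / 2 : ℝ) : ℂ) * Complex.I : ℂ)‖
      + (supplyForm Q S R p p + supplyForm Q S R p' p') / 2 * ‖(δ + Complex.I * ω : ℂ)‖ ≤ 0) :
    stateL m n w = 0 := by
  obtain ⟨β, hβ, hint⟩ := exists_integral_exp_le hδ hE
  obtain ⟨c, hc, hbound⟩ := h
  -- The double-angle formulas turn the supply of the oscillation into a mean and a second harmonic,
  -- the form integrated in `exists_integral_exp_le`.
  have h1 := hbound _ _ β (isTrajectory_exp hw) hβ (fun t ht => by
    refine le_of_eq_of_le ?_ (hint t)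
    refine intervalIntegral.integral_congr fun r _ => ?_
    simp only
    rw [supplyRate_eq_re_inner_join, join_deC, ← supplyForm, deC_exp_smul, ← hp, ← hp',
      supplyForm_real_combination, mul_assoc 2 ω r, mul_assoc 2 δ r, Real.cos_two_mul,
      Real.sin_two_mul, two_mul (δ * r), Real.exp_add]
    have h2 := Real.sin_sq (ω * r)
    rw [mul_pow, mul_pow, h2]
    ring)
  have h2 := eq_zero_of_exp_oscillation_le (ξ := (deC (stateL m n w) : EuclideanSpace 𝕜 (Fin m)))
    (ξ' := deC (Complex.I • stateL m n w)) hδ hω fun t ht => by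
      have h3 := h1 t ht
      rw [map_smul (stateL m n), deC_exp_smul] at h3
      exact h3
  exact eq_zero_of_deC_eq_zero h2.1 h2.2

theorem _root_.Continuous.expVec {T : Type*} [TopologicalSpace T] {f : T → ℂ} {g : T → Fin n → ℂ}
    (hf : Continuous f) (hg : Continuous g) : Continuous fun t => expVec A B (f t) (g t) := by
  have h1 := (continuous_expVec A B).comp (hf.prodMk hg)
  exact h1

theorem _root_.Continuous.re_inner_supplyL {T : Type*} [TopologicalSpace T]
    {f : T → EuclideanSpace ℂ (Fin m ⊕ Fin n)} (hf : Continuous f) :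
    Continuous fun t => (inner ℂ (supplyL Q S R (f t)) (f t)).re :=
  Complex.continuous_re.comp (((supplyL Q S R).continuous.comp hf).inner hf)

theorem _root_.Continuous.det_charMat {T : Type*} [TopologicalSpace T] {f : T → ℂ}
    (hf : Continuous f) : Continuous fun t => (charMat A (f t)).det := by
  have h1 : Continuous fun t => charMat A (f t) :=
    (hf.smul continuous_const).sub continuous_const
  exact h1.matrix_det

theorem _root_.Continuous.deC {T k : Type*} [Fintype k] [TopologicalSpace T]
    {f : T → EuclideanSpace ℂ k} (hf : Continuous f) :
    Continuous fun t => (deC (f t) : EuclideanSpace 𝕜 k) :=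
  (PopovLTI.deC (𝕜 := 𝕜) (k := k)).continuous.comp hf

/-- Under hyperstability, exponential trajectories at imaginary frequencies absorb energy. -/
theorem Hyperstable.re_inner_expVec_nonneg (h : Hyperstable A B Q S R) {ω : ℝ} (hω : ω ≠ 0)
    (hdet : (charMat A (Complex.I * ω)).det ≠ 0) {v : Fin n → ℂ}
    (hv : (toComplex B).mulVec v ≠ 0) :
    0 ≤ (inner ℂ (supplyL Q S R (expVec A B (Complex.I * ω) v))
      (expVec A B (Complex.I * ω) v)).re := by
  by_contra! hneg
  have hneg' := supplyForm_add_neg (𝕜 := 𝕜) hneg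
  let s : ℝ → ℂ := fun δ => δ + Complex.I * ω
  have hs : Continuous s := by fun_prop
  have hw : Continuous fun δ => expVec A B (s δ) v :=
    hs.expVec continuous_const
  let p : ℝ → EuclideanSpace 𝕜 (Fin m ⊕ Fin n) := fun δ => deC (expVec A B (s δ) v)
  let p' : ℝ → EuclideanSpace 𝕜 (Fin m ⊕ Fin n) := fun δ => deC (Complex.I • expVec A B (s δ) v)
  have hp : Continuous p := hw.deC
  have hp' : Continuous p' := (hw.const_smul Complex.I).deC
  have c11 := continuous_supplyForm Q S R hp hp
  have c12 := continuous_supplyForm Q S R hp hp'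
  have c21 := continuous_supplyForm Q S R hp' hp
  have c22 := continuous_supplyForm Q S R hp' hp'
  let G : ℝ → ℝ := fun δ =>
    δ * ‖((((supplyForm Q S R (p δ) (p δ) - supplyForm Q S R (p' δ) (p' δ)) / 2 : ℝ) : ℂ)
        - (((supplyForm Q S R (p δ) (p' δ) + supplyForm Q S R (p' δ) (p δ)) / 2 : ℝ) : ℂ)
          * Complex.I : ℂ)‖
      + (supplyForm Q S R (p δ) (p δ) + supplyForm Q S R (p' δ) (p' δ)) / 2 * ‖s δ‖
  have hG : Continuous G := by fun_prop
  have hs0 : s 0 = Complex.I * ω := by simp [s]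
  -- At δ = 0 only the negative mean times |ω| survives, which is why ω ≠ 0 is needed. By continuity
  -- the sign persists for small δ > 0.
  have hG0 : G 0 < 0 := by
    simp only [G, zero_mul, zero_add, p, p', hs0]
    refine mul_neg_of_neg_of_pos (by linarith) ?_
    simpa using hω
  have hd : Continuous fun δ => (charMat A (s δ)).det := hs.det_charMat
  have e1 : ∀ᶠ δ in 𝓝[>] (0 : ℝ), G δ < 0 :=
    ((hG.tendsto 0).eventually_lt_const hG0).filter_mono nhdsWithin_le_nhds
  have e2 : ∀ᶠ δ in 𝓝[>] (0 : ℝ), (charMat A (s δ)).det ≠ 0 :=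
    ((hd.tendsto 0).eventually_ne (by rw [hs0]; exact hdet)).filter_mono nhdsWithin_le_nhds
  obtain ⟨δ, ⟨hGδ, hdδ⟩, hδ⟩ := ((e1.and e2).and self_mem_nhdsWithin).exists
  exact stateL_expVec_ne_zero hdδ hv
    (h.stateL_eq_zero hδ hω (smul_stateL_expVec A B (s δ) v) (p := p δ) (p' := p' δ) rfl rfl hGδ.le)

/-- Hyperstability implies the frequency domain inequality. -/
theorem Hyperstable.fdi (h : Hyperstable A B Q S R) (hQ : Q.IsHermitian) (hR : R.IsHermitian)
    (hB : B ≠ 0) : FDI A B Q S R := by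
  have hBc : ∃ e, (toComplex B).mulVec e ≠ 0 := by
    by_contra! h0
    refine hB (Matrix.ext fun i j => ?_)
    have h1 := congrFun (h0 (Pi.single j 1)) i
    rw [Matrix.mulVec_single_one] at h1
    have h2 : ‖B i j‖ = 0 := by
      rw [← norm_map_complex]
      exact norm_eq_zero.2 h1
    simpa using h2
  obtain ⟨e, he⟩ := hBc
  have hnonneg : ∀ (ω : ℝ), (charMat A (Complex.I * ω)).det ≠ 0 → ∀ v : Fin n → ℂ,
      0 ≤ (inner ℂ (supplyL Q S R (expVec A B (Complex.I * ω) v))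
        (expVec A B (Complex.I * ω) v)).re := by
    intro ω hω v
    have hB' : ∀ v : Fin n → ℂ, (toComplex B).mulVec v ≠ 0 →
        0 ≤ (inner ℂ (supplyL Q S R (expVec A B (Complex.I * ω) v))
          (expVec A B (Complex.I * ω) v)).re := by
      intro v hv
      have hs : Continuous fun r : ℝ => Complex.I * (r : ℂ) := by fun_prop
      have hc : Continuous fun r : ℝ => (inner ℂ (supplyL Q S R (expVec A B (Complex.I * r) v))
          (expVec A B (Complex.I * r) v)).re :=
        (hs.expVec continuous_const).re_inner_supplyL
      have hd : Continuous fun r : ℝ => (charMat A (Complex.I * r)).det := hs.det_charMat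
      -- Nearby nonzero frequencies reach ω = 0 in the limit; `expVec` is polynomial in the
      -- frequency, so nothing blows up.
      have hω0 : ∀ᶠ r in 𝓝[≠] ω, r ≠ 0 := by
        rcases eq_or_ne ω 0 with rfl | h0
        · exact self_mem_nhdsWithin
        · exact (eventually_ne_nhds h0).filter_mono nhdsWithin_le_nhds
      refine ge_of_tendsto ((hc.tendsto ω).mono_left (nhdsWithin_le_nhds (s := {ω}ᶜ))) ?_
      filter_upwards [hω0, ((hd.tendsto ω).eventually_ne hω).filter_mono nhdsWithin_le_nhds]
        with r hr hdr using h.re_inner_expVec_nonneg hr hdr hv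
    -- Since B ≠ 0, an input direction with B v = 0 is a limit of the directions v + r e, for which
    -- the state is excited.
    by_cases hv : (toComplex B).mulVec v = 0
    · have hs : Continuous fun r : ℝ => v + (r : ℂ) • e := by fun_prop
      have hc : Continuous fun r : ℝ =>
          (inner ℂ (supplyL Q S R (expVec A B (Complex.I * ω) (v + (r : ℂ) • e)))
            (expVec A B (Complex.I * ω) (v + (r : ℂ) • e))).re :=
        (continuous_const.expVec hs).re_inner_supplyL
      have h1 := (hc.tendsto 0).mono_left (nhdsWithin_le_nhds (s := {(0 : ℝ)}ᶜ))
      rw [Complex.ofReal_zero, zero_smul, add_zero] at h1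
      refine ge_of_tendsto h1 ?_
      filter_upwards [self_mem_nhdsWithin] with r hr
      refine hB' _ ?_
      rw [Matrix.mulVec_add, hv, zero_add, Matrix.mulVec_smul]
      exact smul_ne_zero (Complex.ofReal_ne_zero.2 hr) he
    · exact hB' v hv
  intro ω hω
  have hstar : star (-(Complex.I * (ω : ℂ))) = Complex.I * ω := by simp
  refine Matrix.posSemidef_iff_dotProduct_mulVec.2 ⟨?_, fun v => ?_⟩
  · rw [popov, hstar]
    exact Matrix.isHermitian_conjTranspose_mul_mul _ (toComplex_isHermitian hQ hR)
  · set d := (charMat A (Complex.I * ω)).det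
    -- Dividing by the determinant converts the polynomial amplitude back into the frequency column
    -- applied to v.
    have h1 := ofLp_expVec B hω (d⁻¹ • v)
    rw [smul_smul, mul_inv_cancel₀ hω, one_smul] at h1
    have h2 := inner_supplyL_frequencyColumn A B Q S R (-(Complex.I * ω)) (Complex.I * ω) v v h1
      (y := expVec A B (Complex.I * ω) (d⁻¹ • v)) (by rw [hstar]; exact h1)
    have h3 := hnonneg ω hω (d⁻¹ • v)
    rw [← h2]
    set w := expVec A B (Complex.I * ω) (d⁻¹ • v)
    have h4 : inner ℂ (supplyL Q S R w) w = inner ℂ w (supplyL Q S R w) :=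
      ContinuousLinearMap.isSelfAdjoint_iff_isSymmetric.1 (supplyL_isSelfAdjoint hQ hR) w w
    have h5 : (starRingEnd ℂ) (inner ℂ w (supplyL Q S R w)) = inner ℂ w (supplyL Q S R w) := by
      rw [inner_conj_symm, h4]
    rw [h4] at h3
    exact Complex.le_def.2 ⟨h3, (Complex.conj_eq_iff_im.1 h5).symm⟩

end Necessity
end PopovLTI

theorem proposition2p12 {𝕜 : Type*} [RCLike 𝕜] {m n : ℕ}
    (A : Matrix (Fin m) (Fin m) 𝕜) (B : Matrix (Fin m) (Fin n) 𝕜)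
    (Q : Matrix (Fin m) (Fin m) 𝕜) (S : Matrix (Fin n) (Fin m) 𝕜)
    (R : Matrix (Fin n) (Fin n) 𝕜) (hQ : Q.IsHermitian) (hR : R.IsHermitian)
    (hB : B ≠ 0) (hmin : PopovLTI.MinimallyStable A B Q S R)
    (hdet : PopovLTI.PopovDetNonzero A B Q S R) :
    PopovLTI.Hyperstable A B Q S R ↔ PopovLTI.FDI A B Q S R := by
  exact ⟨fun h => h.fdi hQ hR hB, fun h => h.hyperstable hQ hR hmin hdet⟩
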